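/- Work over $\mathbb{C}$. For an octagon $v=(v_i)_{i\in\mathbb{Z}/8}$ in $\mathbb{P}^2$ let $T(v)=v'$ be the skew pentagram map $T_{0,2,1,4}$, $v'_i=\overline{v_iv_{i+2}}\cap\overline{v_{i+1}v_{i+4}}$, defined whenever these diagonals exist and are distinct. Call $v$ rotationally $4$-symmetric if there is $R\in \mathrm{PGL}_3$ with $v_{i+2}=Rv_i$ for all $i$. Let $\mathcal{C}_{8,\mathrm{RS}}$ be the set of $\mathrm{PGL}_3$-classes of rotationally $4$-symmetric octagons in general linear position (no two vertices equal, no three collinear), and let $\bar T_{\mathrm{RS}}$ be the map induced on it by $T$ (defined at the classes of those $v$ for which $T(v)$ is defined and again in general linear position). Each class in $\mathcal{C}_{8,\mathrm{RS}}$ has a unique representative with $v_1=[1:0:1]$, $v_3=[0:1:1]$, $v_5=[-1:0:1]$, $v_7=[0:-1:1]$; sending the class to $v_2$ of this representative defines an embedding $\iota:\mathcal{C}_{8,\mathrm{RS}}\hookrightarrow\mathbb{P}^2$. There is exactly one rational map $f:\mathbb{P}^2\dashrightarrow\mathbb{P}^2$ with $f\circ\iota=\iota\circ\bar T_{\mathrm{RS}}$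 wherever both sides are defined. It is dominant, of algebraic degree $5$ (the degree of its defining forms without common factor), and its dynamical degrees, which are those of $\bar T_{\mathrm{RS}}$, are $$\lambda_1(\bar T_{\mathrm{RS}})=\lim_{m\to\infty}(\deg f^m)^{1/m}=4,\qquad \lambda_2(\bar T_{\mathrm{RS}})=\lim_{m\to\infty}(\deg_{\mathrm{top}} f^m)^{1/m}=5,$$ where $\deg_{\mathrm{top}}$ is the number of points in a general fibre; moreover $\deg_{\mathrm{top}} f=5$. Let $\pi:\mathcal{X}\to\mathbb{P}^2$ be the blowup at the three fixed points $[0:0:1]$, $[1:i:0]$, $[1:-i:0]$ of the rotation $[X:Y:Z]\mapsto[-Y:X:Z]$, with exceptional curves $E_1,E_2,E_3$, and let $\hat f:\mathcal{X}\dashrightarrow\mathcal{X}$ be the conjugate of $f$ by $\pi$. Then $\hat f$ is algebraically stable, that is, $(\hat f^m)^*=(\hat f^*)^m$ on the group $\mathrm{Num}\,\mathcal{X}\cong\mathbb{Z}^4$ of divisors modulo numerical equivalence (the Néron–Severi group of $\mathcal{X}$) for all $m\ge 1$, and in the basis $\pi^*[H],[E_1],[E_2],[E_3]$, with $H$ a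 line in $\mathbb{P}^2$, the pullback $\hat f^*$ has matrix $$\begin{pmatrix}5&1&1&1\\-1&1&0&0\\-1&0&1&0\\-1&0&0&1\end{pmatrix},$$ whose eigenvalues, with multiplicity, are $4,2,1,1$. -/

import Mathlib

open scoped LinearAlgebra.Projectivization

namespace SkewPentagram

/-! ### Polygons in the projective plane and the skew pentagram map -/

/-- The set of closed points of `ℙ²` over `ℂ`. -/
abbrev Plane : Type := ℙ ℂ (Fin 3 → ℂ)

/-- The group of projective transformations of the plane. -/
abbrev PGL3 : Type := Matrix.ProjGenLinGroup (Fin 3) ℂ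

/-- Closed `n`-gons, with vertices indexed modulo `n`. -/
abbrev Polygon (n : ℕ) : Type := ZMod n → Plane

/-- The line through two points (a plane in `ℂ³`, when the points are distinct). -/
noncomputable def line (p q : Plane) : Submodule ℂ (Fin 3 → ℂ) := p.submodule ⊔ q.submodule

/-- General linear position: distinct vertices, no three of them collinear. -/
def GeneralLinearPosition {n : ℕ} (v : Polygon n) : Prop :=
  (∀ i j, i ≠ j → v i ≠ v j) ∧
    ∀ i j k, i ≠ j → j ≠ k → i ≠ k → ¬ (v k).submodule ≤ line (v i) (v j)

/-- `T_{a,b,c,d}` is defined at `v` with image `v'`: the diagonals `v_{i+a} v_{i+b}` and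
`v_{i+c} v_{i+d}` are defined and distinct, and `v'_i` is their point of intersection. -/
def IsSkewImage {n : ℕ} (a b c d : ZMod n) (v v' : Polygon n) : Prop :=
  ∀ i, v (i + a) ≠ v (i + b) ∧ v (i + c) ≠ v (i + d) ∧
    line (v (i + a)) (v (i + b)) ≠ line (v (i + c)) (v (i + d)) ∧
    (v' i).submodule = line (v (i + a)) (v (i + b)) ⊓ line (v (i + c)) (v (i + d))

/-! ### Rotationally `4`-symmetric octagons -/

/-- Rotationally `4`-symmetric octagons. -/
def RotationallySymmetric (v : Polygon 8) : Prop :=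
  ∃ R : PGL3, ∀ i, v (i + 2) = R • v i

/-- The octagons in general linear position that are rotationally `4`-symmetric. -/
def RSOctagon : Set (Polygon 8) := {v | GeneralLinearPosition v ∧ RotationallySymmetric v}

/-- The class of an octagon modulo the diagonal action of `PGL₃`. -/
abbrev OctagonClass : Type := MulAction.orbitRel.Quotient PGL3 (Polygon 8)

/-- The class of an octagon. -/
noncomputable def octagonClass (v : Polygon 8) : OctagonClass := Quotient.mk _ v

/-- The moduli space `𝒞_{8,RS}`. -/
def RSModuli : Set OctagonClass := octagonClass '' RSOctagon

/-- The graph of the map induced by `T = T_{0,2,1,4}` on `𝒞_{8,RS}`. -/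
def InducedMap (c c' : OctagonClass) : Prop :=
  ∃ v ∈ RSOctagon, ∃ v' ∈ RSOctagon, IsSkewImage 0 2 1 4 v v' ∧
    octagonClass v = c ∧ octagonClass v' = c'

/-- The point `[x : y : 1]`. -/
noncomputable def affinePoint (x y : ℂ) : Plane :=
  Projectivization.mk ℂ ![x, y, 1] (fun h => one_ne_zero (congrFun h 2))

/-- Normalized octagons. -/
def Normalized (v : Polygon 8) : Prop :=
  v 1 = affinePoint 1 0 ∧ v 3 = affinePoint 0 1 ∧
    v 5 = affinePoint (-1) 0 ∧ v 7 = affinePoint 0 (-1)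

/-- The graph of the embedding `ι : 𝒞_{8,RS} → ℙ²`, which sends a class to the vertex `v₂` of its
normalized representative. -/
def ModuliCoordinate (c : OctagonClass) (q : Plane) : Prop :=
  c ∈ RSModuli ∧ ∃ v, octagonClass v = c ∧ Normalized v ∧ v 2 = q

/-! ### Rational self-maps of the projective plane -/

/-- The homogeneous coordinate ring of `ℙ²`. -/
abbrev Poly : Type := MvPolynomial (Fin 3) ℂ

/-- A rational map `ℙ² ⇢ ℙ²`, written as a triple of forms of the same degree without common
factor; `degree` is its algebraic degree. The triple is determined by the map up to a nonzero
constant. -/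
structure RatMap where
  form : Fin 3 → Poly
  degree : ℕ
  isHomogeneous : ∀ i, (form i).IsHomogeneous degree
  coprime : ∀ h : Poly, (∀ i, h ∣ form i) → IsUnit h

namespace RatMap

/-- Two triples define the same rational map. -/
def Same (f g : RatMap) : Prop := ∀ i j, f.form i * g.form j = f.form j * g.form i

/-- The value of the triple at a vector. -/
noncomputable def value (f : RatMap) (x : Fin 3 → ℂ) : Fin 3 → ℂ :=
  fun i => MvPolynomial.eval x (f.form i)

/-- `p` is outside the indeterminacy locus of `f`, and `f p = q`. -/
def MapsTo (f : RatMap) (p q : Plane) : Prop :=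
  ∃ h : f.value p.rep ≠ 0, Projectivization.mk ℂ (f.value p.rep) h = q

/-- The image of `f` is Zariski dense. -/
def Dominant (f : RatMap) : Prop :=
  ∀ (n : ℕ) (P : Poly), P.IsHomogeneous n → P ≠ 0 →
    ∃ p q : Plane, f.MapsTo p q ∧ MvPolynomial.eval q.rep P ≠ 0

/-- `f` has generic topological degree `n`: over some nonempty principal Zariski open set, all
fibres of `f` have exactly `n` points. -/
def HasTopologicalDegree (f : RatMap) (n : ℕ) : Prop :=
  ∃ (k : ℕ) (P : Poly), P.IsHomogeneous k ∧ P ≠ 0 ∧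
    ∀ q : Plane, MvPolynomial.eval q.rep P ≠ 0 → {p | f.MapsTo p q}.encard = n

/-- The form `P(f₀, f₁, f₂)`. -/
noncomputable def pull (f : RatMap) (P : Poly) : Poly := MvPolynomial.bind₁ f.form P

/-- The identity map of `ℙ²`. -/
noncomputable def identity : RatMap where
  form := MvPolynomial.X
  degree := 1
  isHomogeneous := fun i => MvPolynomial.isHomogeneous_X ℂ i
  coprime := by
    intro h hh
    have h0 : Irreducible (MvPolynomial.X 0 : Poly) := MvPolynomial.X_prime.irreducible
    by_contra hu
    have hd : (MvPolynomial.X 0 : Poly) ∣ MvPolynomial.X 1 :=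
      ((h0.dvd_iff.mp (hh 0)).resolve_left hu).dvd.trans (hh 1)
    rw [MvPolynomial.X_dvd_X] at hd
    simp at hd

/-- `g` and `f` are composable and `h = g ∘ f` (the common factors are removed in `h`). -/
def IsComp (g f h : RatMap) : Prop :=
  (∃ i, f.pull (g.form i) ≠ 0) ∧
    ∀ i j, h.form i * f.pull (g.form j) = h.form j * f.pull (g.form i)

/-- `F m` is the `m`-th iterate of `f`, for all `m`. -/
def IsIterates (f : RatMap) (F : ℕ → RatMap) : Prop :=
  F 0 = identity ∧ ∀ m, IsComp f (F m) (F (m + 1))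

/-- `λ₁(f) = lim (deg fᵐ)^{1/m}` exists and equals `l`. -/
def HasFirstDynamicalDegree (f : RatMap) (l : ℝ) : Prop :=
  ∃ F : ℕ → RatMap, IsIterates f F ∧
    Filter.Tendsto (fun m : ℕ => ((F m).degree : ℝ) ^ (1 / (m : ℝ))) Filter.atTop (nhds l)

/-- `λ₂(f) = lim ((fᵐ)^* Δ²)^{1/m}` exists and equals `l`. Here `Δ²` is the class of a point of
`ℙ²`, and the degree of its pullback under a dominant map is the number of points of a general
fibre, that is, the generic topological degree. -/
def HasSecondDynamicalDegree (f : RatMap) (l : ℝ) : Prop :=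
  ∃ (F : ℕ → RatMap) (e : ℕ → ℕ), IsIterates f F ∧ (∀ m, (F m).HasTopologicalDegree (e m)) ∧
    Filter.Tendsto (fun m : ℕ => (e m : ℝ) ^ (1 / (m : ℝ))) Filter.atTop (nhds l)

/-- `f` is the projectivization via `ι` of the induced map on `𝒞_{8,RS}`: wherever both sides
are defined, `f ∘ ι` agrees with `ι` composed with the induced map. -/
def IsProjectivization (f : RatMap) : Prop :=
  ∀ c c' : OctagonClass, InducedMap c c' → ∀ p p' : Plane, ModuliCoordinate c p →
    ModuliCoordinate c' p' → ∀ q : Plane, f.MapsTo p q → q = p'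

end RatMap

/-! ### Divisors on the blowup `𝒳` of `ℙ²` at the three fixed points of the rotation -/

/-- The fixed points `[0:0:1]`, `[1:i:0]`, `[1:-i:0]` of the rotation `[X:Y:Z] ↦ [-Y:X:Z]`. -/
noncomputable def center : Fin 3 → Fin 3 → ℂ :=
  ![![0, 0, 1], ![1, Complex.I, 0], ![1, -Complex.I, 0]]

/-- The linear forms vanishing at the `k`-th center. -/
def centerForms (k : Fin 3) : Set Poly :=
  {l | l.IsHomogeneous 1 ∧ MvPolynomial.eval (center k) l = 0}

/-- The multiplicity of (the curve defined by) a form at the `k`-th center: the largest `n` such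
that the form lies in the `n`-th power of the ideal of that point; it is `⊤` for the form `0`. -/
noncomputable def multAt (k : Fin 3) (P : Poly) : ℕ∞ :=
  sSup {n : ℕ∞ | ∃ m : ℕ, n = m ∧ P ∈ Ideal.span (centerForms k) ^ m}

/-- Irreducible plane curves: irreducible forms up to multiplication by a constant. -/
def PlaneCurve : Type :=
  {C : Associates Poly // Irreducible C ∧
    ∃ (n : ℕ) (P : Poly), P.IsHomogeneous n ∧ Associates.mk P = C}

/-- An equation of a plane curve. -/
noncomputable def PlaneCurve.equation (C : PlaneCurve) : Poly := Quotient.out C.1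

/-- The degree of a plane curve. -/
noncomputable def PlaneCurve.degree (C : PlaneCurve) : ℕ := C.equation.totalDegree

/-- The prime divisors of `𝒳`: the strict transforms of the irreducible plane curves, and the
exceptional curves `E₁, E₂, E₃`. -/
inductive PrimeDivisor : Type where
  | strict (C : PlaneCurve)
  | exceptional (k : Fin 3)

/-- The order of vanishing along a prime divisor of the section of `π^* 𝒪(d)` given by a form of
degree `d`. Along `E_k` it is the multiplicity of the form at the `k`-th center. -/
noncomputable def PrimeDivisor.ord : PrimeDivisor → Poly → ℕ∞
  | .strict C, P => emultiplicity C.equation P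
  | .exceptional k, P => multAt k P

/-- Weil divisors on `𝒳`. -/
abbrev Divisor : Type := PrimeDivisor →₀ ℤ

/-- The class of a prime divisor in `Num 𝒳 = ℤ⁴`, in the basis `π^*[H], [E₁], [E₂], [E₃]`: a
strict transform has class `deg(C) π^*[H] - ∑ mult_k(C) [E_k]`. The intersection form in this
basis is `diag(1, -1, -1, -1)`. -/
noncomputable def PrimeDivisor.numClass : PrimeDivisor → Fin 4 → ℤ
  | .strict C => ![(C.degree : ℤ), -((multAt 0 C.equation).toNat : ℤ),
      -((multAt 1 C.equation).toNat : ℤ), -((multAt 2 C.equation).toNat : ℤ)]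
  | .exceptional k => Pi.single k.succ 1

/-- The class of a divisor in `Num 𝒳 = ℤ⁴`. -/
noncomputable def numClass (D : Divisor) : Fin 4 → ℤ := D.sum fun B n => n • B.numClass

namespace RatMap

/-- The least order of vanishing along `B` of the three forms defining `g`. -/
noncomputable def baseOrd (g : RatMap) (B : PrimeDivisor) : ℕ∞ := ⨅ i, B.ord (g.form i)

/-- For the conjugate `ĝ : 𝒳 ⇢ 𝒳` of a dominant `g`: the order of vanishing along `B` of
`ψ ∘ ĝ`, where `ψ` is a local equation of `E_k` at the image of the generic point of `B`. The
ideal of `E_k` on `𝒳` is generated by the linear forms through the `k`-th center, divided by a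
linear form that does not vanish at the image point. -/
noncomputable def exceptionalPullbackMult (g : RatMap) (k : Fin 3) (B : PrimeDivisor) : ℤ :=
  ((⨅ l ∈ centerForms k, B.ord (g.pull l)).toNat : ℤ) - ((g.baseOrd B).toNat : ℤ)

/-- For the conjugate `ĝ : 𝒳 ⇢ 𝒳` of a dominant `g`: the multiplicity of `B` in the pullback of
a prime divisor, that is, the order of vanishing along `B` of `ψ ∘ ĝ`, where `ψ` is a local
equation of that prime divisor at the image of the generic point of `B`. For a strict transform
`Ĉ` this uses `π^* C = Ĉ + ∑ mult_k(C) E_k`. -/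
noncomputable def pullbackMult (g : RatMap) : PrimeDivisor → PrimeDivisor → ℤ
  | .exceptional k, B => g.exceptionalPullbackMult k B
  | .strict C, B =>
      ((B.ord (g.pull C.equation)).toNat : ℤ) - C.degree * ((g.baseOrd B).toNat : ℤ) -
        ∑ k : Fin 3, ((multAt k C.equation).toNat : ℤ) * g.exceptionalPullbackMult k B

/-- `D' = ĝ^* D` as divisors on `𝒳`. -/
def IsPullback (g : RatMap) (D D' : Divisor) : Prop :=
  ∀ B, D' B = D.sum fun A n => n * g.pullbackMult A B

/-- The pullback `ĝ^* : Num 𝒳 → Num 𝒳` has matrix `M` in the basis `π^*[H], [E₁], [E₂], [E₃]`. -/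
def HasPullbackMatrix (g : RatMap) (M : Matrix (Fin 4) (Fin 4) ℤ) : Prop :=
  ∀ D : Divisor, ∃ D' : Divisor, g.IsPullback D D' ∧ numClass D' = M.mulVec (numClass D)

/-- The conjugate `f̂ : 𝒳 ⇢ 𝒳` of a dominant `f` is algebraically stable: `(f̂ᵐ)^* = (f̂^*)ᵐ` on
`Num 𝒳` for all `m ≥ 1`. -/
def AlgebraicallyStableOnBlowup (f : RatMap) : Prop :=
  ∃ (F : ℕ → RatMap) (M : Matrix (Fin 4) (Fin 4) ℤ), IsIterates f F ∧ f.HasPullbackMatrix M ∧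
    ∀ m : ℕ, 1 ≤ m → (F m).HasPullbackMatrix (M ^ m)

end RatMap

/-- The matrix of the pullback on `Num 𝒳`. -/
def stableMatrix : Matrix (Fin 4) (Fin 4) ℤ :=
  !![5, 1, 1, 1; -1, 1, 0, 0; -1, 0, 1, 0; -1, 0, 0, 1]

end SkewPentagram

namespace SkewPentagram

open MvPolynomial

/-! ### Homogeneous polynomials -/

/-! The rotation [X:Y:Z] ↦ [-Y:X:Z] is diagonal in the coordinates `coord` = (-Z, X - iY, X + iY),
whose coordinate points are the three centers. In a normalized octagon the symmetry R is forced to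
be this rotation, so the odd and the even vertices are the orbits of (1,0,1) and of v₂. Let c be the
diagonal coordinates of v₂. The image octagon is symmetric under the same rotation; the diagonal
coordinates of v'₁ are proportional to L_j(c) (`lineForm`), and those of v'₂, up to the signs
(-1,1,1), to c_j Q_j(c) (`conicForm`). Renormalizing means applying a diagonal matrix that takes v'₁
to (1,0,1). Hence f is c_j ↦ c_j Q_j / L_j, and clearing denominators gives the quintic forms c_j
Q_j L_{j+1} L_{j+2} (`octagonMap_isProjectivization`). Uniqueness holds because a general v₂ gives
an octagon and an image in general position, which determines the value of f there
(`RatMap.IsProjectivization.same`).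

The line L_k = 0 passes through no center and is contracted by f to the k-th center. On the blowup
this contraction disappears: comparing orders of vanishing, f̂ maps the line onto E_k, and maps E_k
onto itself (`octagonMap_transports_contractedLine`, `octagonMap_transports_exceptional`). No other
curve is contracted (`isConstant_of_fibre`). So every prime divisor B is carried onto a prime
divisor B' with a ramification index e, that is, the valuation of B restricts to e times that of B'
(`Transports`). Such data compose, which makes the pullback functorial (`HasPullbackMatrix.comp`)
and f̂ algebraically stable. Moreover f̂^* E_k is E_k plus the strict transform of L_k = 0, of class
H + E_k, and f̂^* H = 5H - E₁ - E₂ - E₃ because the forms of f have order one along each E_k. The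
degree of f^m is the corner entry (3·4^m - 2^m)/2 of the m-th power of the matrix, whence λ₁ = 4.

For the topological degree, f(c) = q says that c Q(c) is proportional to g = q b, where b = L(c)
lies on a fixed line because v'₁ lies on v₁v₃. That v'₂ lies on v₃v₆ then recovers c from b, and
that v'₂ lies on v₂v₄ becomes a binary quintic in b with coefficients cubic in q
(`incidenceForm_eq_sum`). For general q its five roots are simple and correspond to the points of
the fibre (`IsGeneric.encard_fibre`). Topological degrees multiply under composition, so λ₂ = 5. The
same quintic, read at the generic point of a curve, shows non-contraction: if q is constant along
the curve, then b is constant, and then so is c. -/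

lemma aeval_mul_of_isHomogeneous {A : Type*} [CommRing A] [Algebra ℂ A] {P : Poly} {n : ℕ}
    (hP : P.IsHomogeneous n) (r : A) (x : Fin 3 → A) :
    aeval (fun i => r * x i) P = r ^ n * aeval x P := by
  rw [aeval_def, aeval_def, eval₂_eq', eval₂_eq', Finset.mul_sum]
  refine Finset.sum_congr rfl fun d hd => ?_
  have hdn : ∑ i, d i = n := by
    have := hP.degree_eq_sum_deg_support hd
    rw [this]
    exact (Finset.sum_subset (Finset.subset_univ _) fun i _ hi => by simpa using hi).symm
  simp only [mul_pow, Finset.prod_mul_distrib, Finset.prod_pow_eq_pow_sum, hdn]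
  ring

lemma eval_smul_of_isHomogeneous {P : Poly} {n : ℕ} (hP : P.IsHomogeneous n) (r : ℂ)
    (x : Fin 3 → ℂ) : eval (r • x) P = r ^ n * eval x P := by
  have := aeval_mul_of_isHomogeneous hP r x
  simpa [aeval_eq_eval, Pi.smul_def] using this

/-- The substitution `Xᵢ ↦ μᵢ + νᵢ T`. -/
noncomputable def pencilHom (μ ν : Fin 3 → Poly) : Poly →ₐ[ℂ] Polynomial Poly :=
  aeval fun i => Polynomial.C (μ i) + Polynomial.C (ν i) * Polynomial.X

lemma pencilHom_X (μ ν : Fin 3 → Poly) (i : Fin 3) :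
    pencilHom μ ν (X i) = Polynomial.C (μ i) + Polynomial.C (ν i) * Polynomial.X := by
  simp [pencilHom]

lemma pencilHom_C (μ ν : Fin 3 → Poly) (a : ℂ) :
    pencilHom μ ν (C a) = Polynomial.C (C a) := by
  rw [← algebraMap_eq, AlgHom.commutes]
  rfl

lemma eval_one_pencilHom {μ ν : Fin 3 → Poly} (h : ∀ i, μ i + ν i = X i) (P : Poly) :
    (pencilHom μ ν P).eval 1 = P := by
  induction P using MvPolynomial.induction_on with
  | C a => simp
  | add p q hp hq => simp [hp, hq]
  | mul_X p i hp => simp [hp, pencilHom_X, h i]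

lemma pencilHom_injective {μ ν : Fin 3 → Poly} (h : ∀ i, μ i + ν i = X i) :
    Function.Injective (pencilHom μ ν) := by
  intro P Q hPQ
  rw [← eval_one_pencilHom h P, hPQ, eval_one_pencilHom h]

lemma coeff_pencilHom_isHomogeneous (P : Poly) (j : ℕ) :
    ((pencilHom 0 X P).coeff j).IsHomogeneous j := by
  induction P using MvPolynomial.induction_on generalizing j with
  | C a =>
    rw [pencilHom_C, Polynomial.coeff_C]
    split_ifs with h
    · subst h; exact isHomogeneous_C _ _
    · exact isHomogeneous_zero _ _ _
  | add p q hp hq => simpa using (hp j).add (hq j)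
  | mul_X p i hp =>
    rw [map_mul, pencilHom_X, Pi.zero_apply, map_zero, zero_add, ← mul_assoc]
    cases j with
    | zero => simpa using isHomogeneous_zero _ _ _
    | succ j =>
      rw [Polynomial.coeff_mul_X, Polynomial.coeff_mul_C]
      exact (hp j).mul (isHomogeneous_X _ _)

lemma pencilHom_of_isHomogeneous {P : Poly} {n : ℕ} (hP : P.IsHomogeneous n) :
    pencilHom 0 X P = Polynomial.C P * Polynomial.X ^ n := by
  have h := aeval_mul_of_isHomogeneous hP (Polynomial.X : Polynomial Poly)
    (fun i => Polynomial.C (X i))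
  have h2 : aeval (fun i => (Polynomial.C (X i) : Polynomial Poly)) P = Polynomial.C P := by
    have : (aeval (fun i => (Polynomial.C (X i) : Polynomial Poly)) : Poly →ₐ[ℂ] Polynomial Poly)
        = (Polynomial.CAlgHom : Poly →ₐ[Poly] _).restrictScalars ℂ := by
      ext i : 1; simp
    rw [this]; rfl
  rw [h2, mul_comm] at h
  rw [← h]
  have : pencilHom 0 X = aeval (fun i => Polynomial.X * (Polynomial.C (X i) : Polynomial Poly)) := by
    ext i : 1; simp [pencilHom]
  rw [this]

/-- Under Xᵢ ↦ Xᵢ T a form of degree n becomes a multiple of Tⁿ. Degree and trailing degree in T are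
additive and agree for the product, so they agree for each factor. -/
lemma isHomogeneous_left_of_mul {Q R : Poly} {n : ℕ} (h : (Q * R).IsHomogeneous n)
    (h0 : Q * R ≠ 0) : ∃ m, Q.IsHomogeneous m := by
  set q := pencilHom 0 X Q with hq
  set r := pencilHom 0 X R with hr
  have hadd : ∀ i : Fin 3, (0 : Fin 3 → Poly) i + X i = X i := fun i => zero_add _
  have hQ0 : Q ≠ 0 := left_ne_zero_of_mul h0
  have hR0 : R ≠ 0 := right_ne_zero_of_mul h0
  have hq0 : q ≠ 0 := fun h => hQ0 (pencilHom_injective hadd (by simpa [hq] using h))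
  have hr0 : r ≠ 0 := fun h => hR0 (pencilHom_injective hadd (by simpa [hr] using h))
  have hqr : q * r = Polynomial.C (Q * R) * Polynomial.X ^ n := by
    rw [hq, hr, ← map_mul, pencilHom_of_isHomogeneous h]
  have hd : (q * r).natDegree = n := by
    rw [hqr, Polynomial.natDegree_C_mul_X_pow _ _ h0]
  have ht : (q * r).natTrailingDegree = n := by
    rw [hqr, Polynomial.C_mul_X_pow_eq_monomial, Polynomial.natTrailingDegree_monomial h0]
  rw [Polynomial.natDegree_mul hq0 hr0] at hd
  rw [Polynomial.natTrailingDegree_mul hq0 hr0] at ht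
  have h1 := Polynomial.natTrailingDegree_le_natDegree q
  have h2 := Polynomial.natTrailingDegree_le_natDegree r
  have h3 : q.natTrailingDegree = q.natDegree := by omega
  refine ⟨q.natDegree, ?_⟩
  have hmon : q = Polynomial.C (q.coeff q.natDegree) * Polynomial.X ^ q.natDegree := by
    ext1 j
    rw [Polynomial.coeff_C_mul_X_pow]
    split_ifs with hj
    · rw [hj]
    · rcases lt_or_gt_of_ne hj with hj | hj
      · exact Polynomial.coeff_eq_zero_of_lt_natTrailingDegree (by omega)
      · exact Polynomial.coeff_eq_zero_of_natDegree_lt hj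
  have : Q = q.coeff q.natDegree := by
    conv_lhs => rw [← eval_one_pencilHom hadd Q, ← hq, hmon]
    simp
  rw [this]
  exact coeff_pencilHom_isHomogeneous Q _

lemma isHomogeneous_of_dvd {Q P : Poly} {n : ℕ} (hP : P.IsHomogeneous n) (h0 : P ≠ 0)
    (h : Q ∣ P) : ∃ m, Q.IsHomogeneous m := by
  obtain ⟨R, rfl⟩ := h
  exact isHomogeneous_left_of_mul hP h0

lemma isHomogeneous_right_of_mul {Q R : Poly} {m n : ℕ} (h : (Q * R).IsHomogeneous n)
    (hQ : Q.IsHomogeneous m) (h0 : Q * R ≠ 0) : m ≤ n ∧ R.IsHomogeneous (n - m) := by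
  obtain ⟨k, hk⟩ := isHomogeneous_left_of_mul (Q := R) (R := Q) (n := n) (by rwa [mul_comm])
    (by rwa [mul_comm])
  have := (hQ.mul hk).inj_right h h0
  have h2 : n - m = k := by omega
  exact ⟨by omega, h2 ▸ hk⟩

lemma isUnit_iff_exists_C {P : Poly} : IsUnit P ↔ ∃ a : ℂ, a ≠ 0 ∧ P = C a := by
  rw [MvPolynomial.isUnit_iff_eq_C_of_isReduced]
  simp [isUnit_iff_ne_zero]

/-! ### Multiplicity at a center -/

/-- A linear form that takes the value one at the `k`-th center. -/
noncomputable def unitForm (k : Fin 3) : Poly := X (![2, 0, 0] k)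

lemma eval_unitForm (k : Fin 3) : eval (center k) (unitForm k) = 1 := by
  fin_cases k <;> simp [unitForm, center]

lemma unitForm_isHomogeneous (k : Fin 3) : (unitForm k).IsHomogeneous 1 := isHomogeneous_X _ _

/-- The part of the coordinate `Xᵢ` along the `k`-th center. -/
noncomputable def alongCenter (k i : Fin 3) : Poly := C (center k i) * unitForm k

/-- The substitution that contracts the plane linearly to the `k`-th center. -/
noncomputable def contractHom (k : Fin 3) : Poly →ₐ[ℂ] Polynomial Poly :=
  pencilHom (alongCenter k) fun i => X i - alongCenter k i

lemma contractHom_injective (k : Fin 3) : Function.Injective (contractHom k) :=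
  pencilHom_injective fun i => by ring

lemma eval_one_contractHom (k : Fin 3) (P : Poly) : (contractHom k P).eval 1 = P :=
  eval_one_pencilHom (fun i => by ring) P

lemma X_sub_alongCenter_mem (k i : Fin 3) : X i - alongCenter k i ∈ centerForms k := by
  refine ⟨(isHomogeneous_X _ _).sub ((unitForm_isHomogeneous k).C_mul _), ?_⟩
  simp [alongCenter, eval_unitForm]

lemma coeff_contractHom_mem (k : Fin 3) (P : Poly) (j : ℕ) :
    (contractHom k P).coeff j ∈ Ideal.span (centerForms k) ^ j := by
  induction P using MvPolynomial.induction_on generalizing j with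
  | C a =>
    rw [contractHom, pencilHom_C, Polynomial.coeff_C]
    split_ifs with h
    · subst h; simp
    · exact zero_mem _
  | add p q hp hq => simpa using add_mem (hp j) (hq j)
  | mul_X p i hp =>
    have hX : contractHom k (X i) = Polynomial.C (alongCenter k i) +
        Polynomial.C (X i - alongCenter k i) * Polynomial.X := pencilHom_X _ _ _
    rw [map_mul, hX, mul_add, ← mul_assoc, Polynomial.coeff_add, Polynomial.coeff_mul_C]
    refine add_mem (Ideal.mul_mem_right _ _ (hp j)) ?_
    cases j with
    | zero => simp
    | succ j =>
      rw [Polynomial.coeff_mul_X, Polynomial.coeff_mul_C, pow_succ]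
      exact Ideal.mul_mem_mul (hp j) (Ideal.subset_span (X_sub_alongCenter_mem k i))

lemma coeff_zero_contractHom {k : Fin 3} {P : Poly} {n : ℕ} (hP : P.IsHomogeneous n) :
    (contractHom k P).coeff 0 = unitForm k ^ n * C (eval (center k) P) := by
  have h := aeval_mul_of_isHomogeneous hP (unitForm k) (fun i => (C (center k i) : Poly))
  have h1 : aeval (fun i => (C (center k i) : Poly)) P = C (eval (center k) P) := by
    have : (aeval (fun i => (C (center k i) : Poly)) : Poly →ₐ[ℂ] Poly) =
        (Algebra.ofId ℂ Poly).comp (aeval (center k)) := by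
      ext i : 1; simp [Algebra.ofId_apply, algebraMap_eq]
    rw [this]; simp [Algebra.ofId_apply, algebraMap_eq, aeval_eq_eval]
  rw [← h1, ← h, Polynomial.coeff_zero_eq_eval_zero]
  have : ∀ Q : Poly, (contractHom k Q).eval 0 = aeval (fun i => unitForm k * C (center k i)) Q := by
    intro Q
    induction Q using MvPolynomial.induction_on with
    | C a => simp [contractHom, algebraMap_eq]
    | add p q hp hq => simp [hp, hq]
    | mul_X p i hp =>
      have hX : contractHom k (X i) = Polynomial.C (alongCenter k i) +
          Polynomial.C (X i - alongCenter k i) * Polynomial.X := pencilHom_X _ _ _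
      simp [hp, hX, alongCenter, mul_comm]
  exact this P

/-- Linear forms through the center are sent into (T), which gives one direction. Conversely T = 1
recovers P as the sum of its coefficients, and the j-th coefficient lies in the j-th power of the
ideal. Multiplicity at a center thereby becomes a T-adic order. -/
lemma mem_span_centerForms_pow_iff {k : Fin 3} {P : Poly} {m : ℕ} :
    P ∈ Ideal.span (centerForms k) ^ m ↔ Polynomial.X ^ m ∣ contractHom k P := by
  constructor
  · intro h
    have hle : Ideal.span (centerForms k) ≤
        (Ideal.span {(Polynomial.X : Polynomial Poly)}).comap (contractHom k) := by
      rw [Ideal.span_le]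
      intro l hl
      rw [SetLike.mem_coe, Ideal.mem_comap, Ideal.mem_span_singleton, Polynomial.X_dvd_iff,
        coeff_zero_contractHom hl.1, hl.2]
      simp
    have h2 := (Ideal.pow_right_mono hle m).trans (Ideal.le_comap_pow _ m) h
    rwa [Ideal.mem_comap, Ideal.span_singleton_pow, Ideal.mem_span_singleton] at h2
  · intro h
    rw [Polynomial.X_pow_dvd_iff] at h
    rw [← eval_one_contractHom k P, Polynomial.eval_eq_sum_range]
    refine sum_mem fun j _ => ?_
    rw [one_pow, mul_one]
    by_cases hj : j < m
    · rw [h j hj]; exact zero_mem _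
    · exact Ideal.pow_le_pow_right (not_lt.mp hj) (coeff_contractHom_mem k P j)

lemma multAt_eq_emultiplicity (k : Fin 3) (P : Poly) :
    multAt k P = emultiplicity Polynomial.X (contractHom k P) := by
  apply le_antisymm
  · apply sSup_le
    rintro n ⟨m, rfl, hm⟩
    exact le_emultiplicity_of_pow_dvd (mem_span_centerForms_pow_iff.mp hm)
  · refine ENat.forall_natCast_le_iff_le.mp fun m hm => ?_
    exact le_sSup ⟨m, rfl, mem_span_centerForms_pow_iff.mpr (pow_dvd_of_le_emultiplicity hm)⟩

/-! ### Orders of vanishing along prime divisors -/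

lemma PlaneCurve.mk_equation (C : PlaneCurve) : Associates.mk C.equation = C.1 :=
  Quotient.out_eq _

lemma PlaneCurve.prime_equation (C : PlaneCurve) : Prime C.equation := by
  have h := C.2.1
  rw [← C.mk_equation, Associates.irreducible_mk] at h
  exact h.prime

lemma PlaneCurve.isHomogeneous (C : PlaneCurve) : C.equation.IsHomogeneous C.degree := by
  obtain ⟨n, P, hP, hPC⟩ := C.2.2
  rw [← C.mk_equation, Associates.mk_eq_mk_iff_associated] at hPC
  have hP0 : P ≠ 0 := hPC.symm.ne_zero_iff.mp C.prime_equation.ne_zero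
  obtain ⟨m, hm⟩ := isHomogeneous_of_dvd hP hP0 hPC.symm.dvd
  rw [PlaneCurve.degree, hm.totalDegree C.prime_equation.ne_zero]
  exact hm

/-- The plane curve defined by an irreducible form. -/
noncomputable def PlaneCurve.ofForm {P : Poly} {n : ℕ} (hP : P.IsHomogeneous n)
    (hi : Irreducible P) : PlaneCurve :=
  ⟨Associates.mk P, Associates.irreducible_mk.mpr hi, n, P, hP, rfl⟩

lemma PlaneCurve.associated_ofForm {P : Poly} {n : ℕ} (hP : P.IsHomogeneous n)
    (hi : Irreducible P) : Associated (PlaneCurve.ofForm hP hi).equation P := by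
  rw [← Associates.mk_eq_mk_iff_associated, PlaneCurve.mk_equation]
  rfl

lemma PlaneCurve.eq_of_dvd {C C' : PlaneCurve} (h : C.equation ∣ C'.equation) : C = C' := by
  apply Subtype.ext
  rw [← C.mk_equation, ← C'.mk_equation, Associates.mk_eq_mk_iff_associated]
  exact C.prime_equation.associated_of_dvd C'.prime_equation h

namespace PrimeDivisor

lemma ord_exceptional (k : Fin 3) (P : Poly) :
    (exceptional k).ord P = emultiplicity Polynomial.X (contractHom k P) :=
  multAt_eq_emultiplicity k P

lemma ord_strict (C : PlaneCurve) (P : Poly) :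
    (strict C).ord P = emultiplicity C.equation P := rfl

/-- For exceptional curves this is where the T-adic description is used: T is prime in a polynomial
ring over a domain. -/
lemma ord_mul (B : PrimeDivisor) (P Q : Poly) : B.ord (P * Q) = B.ord P + B.ord Q := by
  cases B with
  | strict C => exact emultiplicity_mul C.prime_equation
  | exceptional k =>
    simp only [ord_exceptional, map_mul]
    exact emultiplicity_mul Polynomial.prime_X

lemma min_le_ord_add (B : PrimeDivisor) (P Q : Poly) :
    min (B.ord P) (B.ord Q) ≤ B.ord (P + Q) := by
  cases B with
  | strict C => exact min_le_emultiplicity_add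
  | exceptional k =>
    simp only [ord_exceptional, map_add]
    exact min_le_emultiplicity_add

lemma ord_zero (B : PrimeDivisor) : B.ord 0 = ⊤ := by
  cases B with
  | strict C => exact emultiplicity_zero _
  | exceptional k => rw [ord_exceptional, map_zero, emultiplicity_zero]

lemma ord_ne_top (B : PrimeDivisor) {P : Poly} (hP : P ≠ 0) : B.ord P ≠ ⊤ := by
  cases B with
  | strict C =>
    exact finiteMultiplicity_iff_emultiplicity_ne_top.mp
      (FiniteMultiplicity.of_prime_left C.prime_equation hP)
  | exceptional k =>
    rw [ord_exceptional]
    refine finiteMultiplicity_iff_emultiplicity_ne_top.mp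
      (FiniteMultiplicity.of_prime_left Polynomial.prime_X ?_)
    exact fun h => hP (contractHom_injective k (by rw [h, map_zero]))

lemma ord_of_isUnit (B : PrimeDivisor) {P : Poly} (hP : IsUnit P) : B.ord P = 0 := by
  cases B with
  | strict C => exact emultiplicity_of_unit_right C.prime_equation.not_isUnit hP.unit
  | exceptional k =>
    rw [ord_exceptional]
    exact emultiplicity_of_unit_right Polynomial.prime_X.not_isUnit (hP.map (contractHom k)).unit

lemma ord_one (B : PrimeDivisor) : B.ord 1 = 0 := B.ord_of_isUnit isUnit_one

lemma ord_pow (B : PrimeDivisor) (P : Poly) (n : ℕ) : B.ord (P ^ n) = n * B.ord P := by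
  induction n with
  | zero => simp [ord_one]
  | succ n ih => rw [pow_succ, ord_mul, ih]; push_cast; ring

lemma ord_eq_of_associated (B : PrimeDivisor) {P Q : Poly} (h : Associated P Q) :
    B.ord P = B.ord Q := by
  obtain ⟨u, rfl⟩ := h
  rw [ord_mul, B.ord_of_isUnit u.isUnit, add_zero]

lemma ord_neg (B : PrimeDivisor) (P : Poly) : B.ord (-P) = B.ord P :=
  B.ord_eq_of_associated (Associated.neg_left (Associated.refl P))

lemma ord_add_eq_left (B : PrimeDivisor) {P Q : Poly} (h : B.ord P < B.ord Q) :
    B.ord (P + Q) = B.ord P := by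
  apply le_antisymm
  · by_contra! hlt
    have := B.min_le_ord_add (P + Q) (-Q)
    rw [add_neg_cancel_right, ord_neg] at this
    exact absurd (lt_min hlt h) (not_lt.mpr this)
  · simpa [min_eq_left h.le] using B.min_le_ord_add P Q

end PrimeDivisor

/-! ### Linear forms -/

lemma irreducible_of_isHomogeneous_one {l : Poly} (hl : l.IsHomogeneous 1) (h0 : l ≠ 0) :
    Irreducible l := by
  refine ⟨fun hu => ?_, fun P Q hPQ => ?_⟩
  · obtain ⟨a, _, ha⟩ := isUnit_iff_exists_C.mp hu
    exact absurd (hl.inj_right (ha ▸ isHomogeneous_C _ _) h0) one_ne_zero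
  · subst hPQ
    obtain ⟨m, hm⟩ := isHomogeneous_left_of_mul hl h0
    obtain ⟨hle, hQ⟩ := isHomogeneous_right_of_mul hl hm h0
    have hunit : ∀ {R : Poly}, R ≠ 0 → R.IsHomogeneous 0 → IsUnit R := by
      intro R hR0 hR
      rw [← totalDegree_zero_iff_isHomogeneous, totalDegree_eq_zero_iff_eq_C] at hR
      exact isUnit_iff_exists_C.mpr ⟨_, fun h => hR0 (by rw [hR, h, map_zero]), hR⟩
    rcases Nat.le_one_iff_eq_zero_or_eq_one.mp hle with rfl | rfl
    · exact Or.inl (hunit (left_ne_zero_of_mul h0) hm)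
    · exact Or.inr (hunit (right_ne_zero_of_mul h0) hQ)

/-- Linear forms dual to the centers: coordinates that diagonalize the rotation. -/
noncomputable def coord : Fin 3 → Poly :=
  ![-X 2, X 0 - C Complex.I * X 1, X 0 + C Complex.I * X 1]

lemma coord_isHomogeneous (j : Fin 3) : (coord j).IsHomogeneous 1 := by
  fin_cases j
  · exact (isHomogeneous_X _ _).neg
  · exact (isHomogeneous_X _ _).sub (isHomogeneous_C_mul_X _ _)
  · exact (isHomogeneous_X _ _).add (isHomogeneous_C_mul_X _ _)

lemma eval_coord_center_self (j : Fin 3) : eval (center j) (coord j) ≠ 0 := by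
  fin_cases j <;> simp [coord, center]

lemma eval_coord_center_ne {j k : Fin 3} (h : j ≠ k) : eval (center k) (coord j) = 0 := by
  fin_cases j <;> fin_cases k <;> first | exact absurd rfl h | simp [coord, center]

lemma coord_ne_zero (j : Fin 3) : coord j ≠ 0 := fun h =>
  eval_coord_center_self j (by rw [h, map_zero])

lemma coord_mem_centerForms {j k : Fin 3} (h : j ≠ k) : coord j ∈ centerForms k :=
  ⟨coord_isHomogeneous j, eval_coord_center_ne h⟩

lemma PlaneCurve.not_dvd_coord (C : PlaneCurve) {a b : Fin 3} (hab : a ≠ b) :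
    ¬ (C.equation ∣ coord a ∧ C.equation ∣ coord b) := by
  rintro ⟨ha, hb⟩
  have h1 := C.prime_equation.irreducible.associated_of_dvd
    (irreducible_of_isHomogeneous_one (coord_isHomogeneous a) (coord_ne_zero a)) ha
  obtain ⟨r, hr⟩ := h1.symm.dvd.trans hb
  have h2 := congrArg (eval (center b)) hr
  rw [map_mul, eval_coord_center_ne hab, zero_mul] at h2
  exact eval_coord_center_self b h2

lemma contractHom_of_mem_centerForms {k : Fin 3} {l : Poly} (hl : l ∈ centerForms k) :
    contractHom k l = Polynomial.C l * Polynomial.X := by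
  -- The contraction of a linear form is affine in T; it is known for the variables and extends
  -- linearly.
  have key : ∀ l : Poly, l ∈ homogeneousSubmodule (Fin 3) ℂ 1 →
      contractHom k l = Polynomial.C (C (eval (center k) l) * unitForm k) +
        Polynomial.C (l - C (eval (center k) l) * unitForm k) * Polynomial.X := by
    intro l hl
    rw [homogeneousSubmodule_one_eq_span_X] at hl
    induction hl using Submodule.span_induction with
    | mem x hx =>
      obtain ⟨i, rfl⟩ := hx
      have hX : contractHom k (X i) = _ := pencilHom_X _ _ _
      rw [hX, eval_X]
      rfl
    | zero => simp
    | add x y _ _ hx hy => simp only [map_add, hx, hy, Polynomial.C_sub, Polynomial.C_mul]; ring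
    | smul a x _ hx =>
      rw [map_smul, hx, ← C_mul', ← algebraMap_smul (Polynomial Poly) a]
      simp only [map_mul, eval_C, Polynomial.algebraMap_apply, smul_eq_mul,
        MvPolynomial.algebraMap_eq, Polynomial.C_sub]
      ring
  rw [key l hl.1, hl.2]
  simp

namespace PrimeDivisor

lemma ord_exceptional_of_mem {k : Fin 3} {l : Poly} (hl : l ∈ centerForms k) (h0 : l ≠ 0) :
    (exceptional k).ord l = 1 := by
  rw [ord_exceptional, contractHom_of_mem_centerForms hl, emultiplicity_mul Polynomial.prime_X,
    emultiplicity_eq_zero.mpr, zero_add]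
  · simpa using (FiniteMultiplicity.of_prime_left Polynomial.prime_X
      Polynomial.X_ne_zero : FiniteMultiplicity (Polynomial.X : Polynomial Poly) _).emultiplicity_self
  · rw [Polynomial.X_dvd_iff]; simpa using h0

lemma ord_exceptional_eq_zero {k : Fin 3} {P : Poly} {n : ℕ} (hP : P.IsHomogeneous n)
    (h : eval (center k) P ≠ 0) : (exceptional k).ord P = 0 := by
  rw [ord_exceptional, emultiplicity_eq_zero, Polynomial.X_dvd_iff, coeff_zero_contractHom hP]
  exact mul_ne_zero (pow_ne_zero _ (X_ne_zero _)) (by simpa using h)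

open Classical in
/-- The order of the ideal of `E_k` along `B`. -/
lemma exists_ord_centerForms (B : PrimeDivisor) (k : Fin 3) :
    (∀ l ∈ centerForms k, (if exceptional k = B then (1 : ℕ∞) else 0) ≤ B.ord l) ∧
      ∃ l ∈ centerForms k, B.ord l = if exceptional k = B then 1 else 0 := by
  have hk : k + 1 ≠ k := by fin_cases k <;> decide
  have hk' : k + 2 ≠ k := by fin_cases k <;> decide
  have hk2 : k + 1 ≠ k + 2 := by fin_cases k <;> decide
  split_ifs with h
  · subst h
    refine ⟨fun l hl => ?_, coord (k + 1), coord_mem_centerForms hk,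
      ord_exceptional_of_mem (coord_mem_centerForms hk) (coord_ne_zero _)⟩
    by_cases h0 : l = 0
    · rw [h0, ord_zero]; exact le_top
    · exact (ord_exceptional_of_mem hl h0).ge
  · refine ⟨fun _ _ => zero_le, ?_⟩
    cases B with
    | strict C =>
      by_cases h1 : C.equation ∣ coord (k + 1)
      · refine ⟨coord (k + 2), coord_mem_centerForms hk', emultiplicity_eq_zero.mpr fun h2 => ?_⟩
        exact C.not_dvd_coord hk2 ⟨h1, h2⟩
      · exact ⟨coord (k + 1), coord_mem_centerForms hk, emultiplicity_eq_zero.mpr h1⟩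
    | exceptional j =>
      have hjk : j ≠ k := fun hjk => h (by rw [hjk])
      exact ⟨coord j, coord_mem_centerForms hjk,
        ord_exceptional_eq_zero (coord_isHomogeneous j) (eval_coord_center_self j)⟩

end PrimeDivisor

/-! ### Divisors of forms -/

lemma numClass_add (D E : Divisor) : numClass (D + E) = numClass D + numClass E :=
  Finsupp.sum_add_index' (fun _ => zero_smul _ _) fun _ _ _ => add_smul _ _ _

lemma numClass_single (B : PrimeDivisor) (n : ℤ) :
    numClass (Finsupp.single B n) = n • B.numClass :=
  Finsupp.sum_single_index (zero_smul _ _)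

lemma numClass_zero : numClass 0 = 0 := Finsupp.sum_zero_index

lemma numClass_smul (n : ℤ) (D : Divisor) : numClass (n • D) = n • numClass D :=
  map_zsmul (AddMonoidHom.mk' numClass numClass_add) n D

lemma numClass_sum {ι : Type*} (s : Finset ι) (D : ι → Divisor) :
    numClass (∑ i ∈ s, D i) = ∑ i ∈ s, numClass (D i) :=
  map_sum (AddMonoidHom.mk' numClass numClass_add) D s

/-- The divisor is the total transform of the curve. An irreducible factor p contributes its strict
transform plus the multiples mult_k(p) of E_k, and in the class the exceptional parts cancel,
leaving deg(p) times the class of a line. -/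
lemma exists_divisor_of_form (P : Poly) (h0 : P ≠ 0) (n : ℕ) (hP : P.IsHomogeneous n) :
    ∃ D : Divisor, (∀ B, D B = ((B.ord P).toNat : ℤ)) ∧ numClass D = ![(n : ℤ), 0, 0, 0] := by
  classical
  induction P using UniqueFactorizationMonoid.induction_on_prime generalizing n with
  | h₁ => exact absurd rfl h0
  | h₂ x hx =>
    refine ⟨0, fun B => by simp [B.ord_of_isUnit hx], ?_⟩
    obtain ⟨a, _, rfl⟩ := isUnit_iff_exists_C.mp hx
    rw [hP.inj_right (isHomogeneous_C _ _) h0, numClass_zero]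
    ext i; fin_cases i <;> rfl
  | h₃ a p ha hp ih =>
    obtain ⟨m, hm⟩ := isHomogeneous_left_of_mul hP h0
    obtain ⟨hle, hna⟩ := isHomogeneous_right_of_mul hP hm h0
    obtain ⟨D, hD, hDc⟩ := ih ha _ hna
    set C := PlaneCurve.ofForm hm hp.irreducible
    have hass : Associated C.equation p := PlaneCurve.associated_ofForm _ _
    refine ⟨D + Finsupp.single (.strict C) 1 + ∑ k : Fin 3,
      Finsupp.single (.exceptional k) ((multAt k p).toNat : ℤ), fun B => ?_, ?_⟩
    · rw [B.ord_mul, ENat.toNat_add (B.ord_ne_top hp.ne_zero) (B.ord_ne_top ha),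
        Finsupp.add_apply, Finsupp.add_apply, hD]
      cases B with
      | strict C' =>
        have h1 : (∑ k : Fin 3, Finsupp.single (PrimeDivisor.exceptional k)
            ((multAt k p).toNat : ℤ)) (.strict C') = 0 := by
          simp [Finsupp.finsetSum_apply]
        rw [h1]
        by_cases hC : C = C'
        · subst hC
          rw [PrimeDivisor.ord_strict, PrimeDivisor.ord_strict C p,
            emultiplicity_eq_of_associated_right hass.symm,
            (FiniteMultiplicity.of_prime_left C.prime_equation
              C.prime_equation.ne_zero).emultiplicity_self]
          simp [add_comm]
        · have : (PrimeDivisor.strict C').ord p = 0 := by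
            rw [PrimeDivisor.ord_strict, emultiplicity_eq_zero]
            exact fun h => hC (PlaneCurve.eq_of_dvd (h.trans hass.symm.dvd)).symm
          rw [this, Finsupp.single_eq_of_ne (by simpa using fun h => hC h.symm)]
          simp
      | exceptional k =>
        rw [Finsupp.single_eq_of_ne (by simp), Finsupp.finsetSum_apply,
          Finset.sum_eq_single k (fun j _ hj => Finsupp.single_eq_of_ne (by simpa using hj.symm))
            (fun h => absurd (Finset.mem_univ _) h), Finsupp.single_eq_same]
        simp only [PrimeDivisor.ord]
        push_cast; ring
    · have hdeg : C.degree = m := by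
        rw [PlaneCurve.degree, C.isHomogeneous.totalDegree C.prime_equation.ne_zero]
        exact C.isHomogeneous.inj_right
          (by obtain ⟨u, hu⟩ := hass.symm
              obtain ⟨c, _, hc⟩ := isUnit_iff_exists_C.mp u.isUnit
              rw [← hu, hc, mul_comm]; exact hm.C_mul c) C.prime_equation.ne_zero
      have hmult : ∀ k, multAt k C.equation = multAt k p := fun k =>
        (PrimeDivisor.exceptional k).ord_eq_of_associated hass
      rw [numClass_add, numClass_add, hDc, numClass_single, numClass_sum]
      simp only [numClass_single, PrimeDivisor.numClass, hdeg, hmult, Fin.sum_univ_three]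
      have hcast : ((n - m : ℕ) : ℤ) = n - m := by omega
      rw [hcast]
      ext i; fin_cases i <;> simp

lemma natCast_mul_ne_top (n : ℕ) {a : ℕ∞} (ha : a ≠ ⊤) : (n : ℕ∞) * a ≠ ⊤ := by
  lift a to ℕ using ha
  exact_mod_cast ENat.natCast_ne_top (n * a)

namespace RatMap

/-! ### Composition of rational maps -/

lemma pull_isHomogeneous (g : RatMap) {P : Poly} {n : ℕ} (hP : P.IsHomogeneous n) :
    (g.pull P).IsHomogeneous (g.degree * n) :=
  hP.aeval _ g.isHomogeneous

lemma pull_mul (g : RatMap) (P Q : Poly) : g.pull (P * Q) = g.pull P * g.pull Q :=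
  map_mul _ _ _

lemma exists_form_ne_zero (g : RatMap) : ∃ i, g.form i ≠ 0 := by
  by_contra! h
  have := g.coprime 0 (fun i => by rw [h i])
  exact not_isUnit_zero this

lemma exists_not_dvd_form (g : RatMap) {h : Poly} (hh : ¬ IsUnit h) : ∃ i, ¬ h ∣ g.form i := by
  by_contra! H
  exact hh (g.coprime h H)

lemma baseOrd_strict (g : RatMap) (C : PlaneCurve) : g.baseOrd (.strict C) = 0 := by
  obtain ⟨i, hi⟩ := g.exists_not_dvd_form C.prime_equation.not_isUnit
  exact ENat.iInf_eq_zero.mpr ⟨i, emultiplicity_eq_zero.mpr hi⟩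

lemma baseOrd_ne_top (g : RatMap) (B : PrimeDivisor) : g.baseOrd B ≠ ⊤ := by
  obtain ⟨i, hi⟩ := g.exists_form_ne_zero
  exact ne_top_of_le_ne_top (B.ord_ne_top hi) (iInf_le _ i)

/-- The two triples are proportional over the function field. As the forms of h have no common
factor, the denominator of the proportionality factor divides all of them and is a unit. -/
lemma IsComp.exists_factor {g f h : RatMap} (hc : IsComp g f h) :
    ∃ c : Poly, c ≠ 0 ∧ ∀ i, f.pull (g.form i) = c * h.form i := by
  obtain ⟨⟨i₀, hi₀⟩, hc⟩ := hc
  obtain ⟨j, hj⟩ := h.exists_form_ne_zero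
  obtain ⟨a, b, t, hab, ha, hb⟩ :=
    UniqueFactorizationMonoid.exists_reduced_factors (h.form j) hj (f.pull (g.form j))
  have ht : t ≠ 0 := fun h0 => hj (by rw [← ha, h0, zero_mul])
  have hunit : IsUnit a := by
    refine h.coprime a fun i => ?_
    have h1 := hc i j
    rw [← hb, ← ha] at h1
    have h2 : h.form i * b = a * f.pull (g.form i) := mul_left_cancel₀ ht (by linear_combination h1)
    exact hab.dvd_of_dvd_mul_right (Dvd.intro _ h2.symm)
  have hdvd : h.form j ∣ f.pull (g.form j) := by
    rw [← ha, ← hb]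
    exact mul_dvd_mul_left t hunit.dvd
  obtain ⟨c, hcj⟩ := hdvd
  have hall : ∀ i, f.pull (g.form i) = c * h.form i := fun i => by
    have h1 := hc i j
    rw [hcj] at h1
    exact mul_left_cancel₀ hj (by linear_combination -h1)
  exact ⟨c, fun h0 => hi₀ (by rw [hall, h0, zero_mul]), hall⟩

lemma pull_pull {g f h : RatMap} {c : Poly} (hc : ∀ i, f.pull (g.form i) = c * h.form i)
    {P : Poly} {n : ℕ} (hP : P.IsHomogeneous n) :
    f.pull (g.pull P) = c ^ n * h.pull P := by
  have h1 : f.pull (g.pull P) = bind₁ (fun i => f.pull (g.form i)) P := bind₁_bind₁ _ _ _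
  rw [h1, funext hc]
  exact aeval_mul_of_isHomogeneous hP c h.form

lemma exists_isComp (g f : RatMap) (h0 : ∃ i, f.pull (g.form i) ≠ 0) :
    ∃ h : RatMap, IsComp g f h := by
  let : NormalizedGCDMonoid Poly := Classical.choice inferInstance
  obtain ⟨q, hq, hq1⟩ := Finset.extract_gcd (s := Finset.univ) (fun i => f.pull (g.form i))
    Finset.univ_nonempty
  set d := Finset.univ.gcd fun i => f.pull (g.form i) with hd
  obtain ⟨i₀, hi₀⟩ := h0
  have hhom : ∀ i, (f.pull (g.form i)).IsHomogeneous (f.degree * g.degree) := fun i =>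
    f.pull_isHomogeneous (g.isHomogeneous i)
  have hd0 : d ≠ 0 := fun h => hi₀ (by rw [hq i₀ (Finset.mem_univ _), h, zero_mul])
  obtain ⟨m, hm⟩ := isHomogeneous_of_dvd (hhom i₀) hi₀
    (Finset.gcd_dvd (Finset.mem_univ i₀) : d ∣ _)
  refine ⟨⟨q, f.degree * g.degree - m, fun i => ?_, fun h hh => ?_⟩, ⟨i₀, hi₀⟩, fun i j => ?_⟩
  · by_cases hi : q i = 0
    · rw [hi]; exact isHomogeneous_zero _ _ _
    · have h1 := hq i (Finset.mem_univ _)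
      exact (isHomogeneous_right_of_mul (h1 ▸ hhom i) hm (mul_ne_zero hd0 hi)).2
  · exact isUnit_of_dvd_one (hq1 ▸ Finset.dvd_gcd fun i _ => hh i)
  · change q i * _ = q j * _
    rw [hq i (Finset.mem_univ _), hq j (Finset.mem_univ _)]
    ring

/-! ### Transport of prime divisors -/

/-- The conjugate of `g` maps the prime divisor `B` onto the prime divisor `B'`, with ramification
index `e`. -/
def Transports (g : RatMap) (B B' : PrimeDivisor) (e : ℕ) : Prop :=
  ∀ (n : ℕ) (P : Poly), P.IsHomogeneous n →
    B.ord (g.pull P) = e * B'.ord P + n * g.baseOrd B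

/-- The conjugate of `g` on the blowup contracts no curve to a point. -/
def NonContracting (g : RatMap) : Prop := ∀ B, ∃ B' e, g.Transports B B' e

/-- Orders multiply along the composition, except that a common factor c has been removed from the
composed forms. This lowers the order of a pulled back form of degree n by n times ord c, and the
base order by ord c, so that it cancels. -/
lemma Transports.comp {g f h : RatMap} (hc : IsComp g f h) {B B' B'' : PrimeDivisor} {e e' : ℕ}
    (hf : f.Transports B B' e) (hg : g.Transports B' B'' e') : h.Transports B B'' (e * e') := by
  obtain ⟨c, hc0, hc⟩ := hc.exists_factor
  have hfin := B.ord_ne_top hc0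
  have hbase : B.ord c + h.baseOrd B = e * g.baseOrd B' + g.degree * f.baseOrd B := by
    rw [baseOrd, baseOrd, ENat.mul_iInf, ENat.iInf_add, ENat.add_iInf]
    refine iInf_congr fun i => ?_
    rw [← B.ord_mul, ← hc i]
    exact hf _ _ (g.isHomogeneous i)
  intro n P hP
  have h1 := hf _ _ (g.pull_isHomogeneous hP)
  rw [pull_pull hc hP, B.ord_mul, B.ord_pow, hg n P hP] at h1
  have hfin' : (n : ℕ∞) * B.ord c ≠ ⊤ := natCast_mul_ne_top n hfin
  refine ENat.add_right_injective_of_ne_top hfin' ?_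
  calc n * B.ord c + B.ord (h.pull P)
      = e * e' * B''.ord P + n * (e * g.baseOrd B' + g.degree * f.baseOrd B) := by
        rw [h1]; push_cast; ring
    _ = _ := by rw [← hbase]; push_cast; ring

lemma NonContracting.comp {g f h : RatMap} (hc : IsComp g f h) (hf : f.NonContracting)
    (hg : g.NonContracting) : h.NonContracting := fun B => by
  obtain ⟨B', e, h1⟩ := hf B
  obtain ⟨B'', e', h2⟩ := hg B'
  exact ⟨B'', e * e', h1.comp hc h2⟩

lemma pull_identity (P : Poly) : identity.pull P = P := by
  simp [pull, identity]

lemma baseOrd_identity (B : PrimeDivisor) : identity.baseOrd B = 0 := by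
  cases B with
  | strict C => exact baseOrd_strict _ C
  | exceptional k =>
    refine ENat.iInf_eq_zero.mpr ⟨![2, 0, 0] k, ?_⟩
    refine PrimeDivisor.ord_exceptional_eq_zero (unitForm_isHomogeneous k) ?_
    change eval (center k) (unitForm k) ≠ 0
    rw [eval_unitForm]
    exact one_ne_zero

lemma identity_transports (B : PrimeDivisor) : identity.Transports B B 1 := fun n P _ => by
  rw [pull_identity, baseOrd_identity]; simp

open Classical in
-- The base order cancels, and what remains is e times the least order along B' of the linear forms
-- through the center, which is one on E_k and zero on every other prime divisor.
lemma Transports.exceptionalPullbackMult_eq {g : RatMap} {B B' : PrimeDivisor} {e : ℕ}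
    (h : g.Transports B B' e) (k : Fin 3) :
    g.exceptionalPullbackMult k B = if .exceptional k = B' then (e : ℤ) else 0 := by
  obtain ⟨hle, l₀, hl₀, hl₀'⟩ := B'.exists_ord_centerForms k
  set δ : ℕ∞ := if .exceptional k = B' then 1 else 0 with hδ
  have h1 : (⨅ l ∈ centerForms k, B.ord (g.pull l)) = e * δ + g.baseOrd B := by
    apply le_antisymm
    · refine (iInf₂_le l₀ hl₀).trans ?_
      rw [h 1 l₀ hl₀.1, hl₀']
      simp
    · refine le_iInf₂ fun l hl => ?_
      rw [h 1 l hl.1, Nat.cast_one, one_mul]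
      gcongr
      exact hle l hl
  have hδtop : (e : ℕ∞) * δ ≠ ⊤ :=
    natCast_mul_ne_top _ (by rw [hδ]; split_ifs <;> simp)
  rw [exceptionalPullbackMult, h1, ENat.toNat_add hδtop (g.baseOrd_ne_top B)]
  rw [hδ]
  split_ifs <;> simp

open Classical in
-- The base orders cancel. If B' is exceptional, the multiplicity of C at that center is exactly
-- what the correction from total to strict transform removes.
lemma Transports.pullbackMult_eq {g : RatMap} {B B' : PrimeDivisor} {e : ℕ}
    (h : g.Transports B B' e) (A : PrimeDivisor) :
    g.pullbackMult A B = if A = B' then (e : ℤ) else 0 := by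
  cases A with
  | exceptional k => exact h.exceptionalPullbackMult_eq k
  | strict C =>
    have hC0 := C.prime_equation.ne_zero
    rw [pullbackMult, h _ _ C.isHomogeneous, ENat.toNat_add
      (natCast_mul_ne_top _ (B'.ord_ne_top hC0))
      (natCast_mul_ne_top _ (g.baseOrd_ne_top B))]
    simp only [h.exceptionalPullbackMult_eq, ENat.toNat_mul, ENat.toNat_natCast]
    cases B' with
    | strict C' =>
      simp only [reduceCtorEq, if_false, mul_zero, Finset.sum_const_zero, sub_zero]
      by_cases hC : C = C'
      · subst hC
        rw [PrimeDivisor.ord_strict, (FiniteMultiplicity.of_prime_left C.prime_equation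
              hC0).emultiplicity_self]
        simp
      · have : (PrimeDivisor.strict C').ord C.equation = 0 := emultiplicity_eq_zero.mpr
          fun h => hC (PlaneCurve.eq_of_dvd h).symm
        rw [this, if_neg (by simpa using hC)]
        simp
    | exceptional j =>
      rw [Finset.sum_eq_single j (fun k _ hk => by simp [hk])
        (fun h => absurd (Finset.mem_univ _) h)]
      simp only [PrimeDivisor.ord, reduceCtorEq, if_false, if_true]
      push_cast
      ring

lemma Transports.sum_pullbackMult {g : RatMap} {B B' : PrimeDivisor} {e : ℕ}
    (h : g.Transports B B' e) (D : Divisor) :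
    (D.sum fun A n => n * g.pullbackMult A B) = e * D B' := by
  classical
  simp only [h.pullbackMult_eq, mul_ite, mul_zero]
  rw [Finsupp.sum_ite_eq']
  split_ifs with hB
  · ring
  · rw [Finsupp.notMem_support_iff.mp hB]; simp

/-- The coefficient of B in a pullback is e times the coefficient of B' in the divisor. Pulling back
in two steps thus multiplies by e e', as the composite does. This functoriality needs every prime
divisor to be carried onto a prime divisor. -/
lemma HasPullbackMatrix.comp {g f h : RatMap} (hc : IsComp g f h) (hf : f.NonContracting)
    (hg : g.NonContracting) {M N : Matrix (Fin 4) (Fin 4) ℤ} (hfN : f.HasPullbackMatrix N)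
    (hgM : g.HasPullbackMatrix M) : h.HasPullbackMatrix (N * M) := by
  intro D
  obtain ⟨D', hD', hc'⟩ := hgM D
  obtain ⟨D'', hD'', hc''⟩ := hfN D'
  refine ⟨D'', fun B => ?_, by rw [hc'', hc', Matrix.mulVec_mulVec]⟩
  obtain ⟨B', e, h1⟩ := hf B
  obtain ⟨B'', e', h2⟩ := hg B'
  rw [(h1.comp hc h2).sum_pullbackMult, hD'', h1.sum_pullbackMult, hD', h2.sum_pullbackMult]
  push_cast; ring

lemma identity_hasPullbackMatrix : identity.HasPullbackMatrix 1 := fun D =>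
  ⟨D, fun B => by rw [(identity_transports B).sum_pullbackMult]; simp, by simp⟩

/-! ### The degree is determined by the pullback -/

/-- Tested on a line through none of the centers. The divisor of its pulled back equation has class
`g.degree` times H, and it differs from the pullback of the line only by exceptional curves, which
do not affect the coefficient of H. -/
lemma degree_eq_of_hasPullbackMatrix {g : RatMap} (hinj : ∀ n P, P.IsHomogeneous n → P ≠ 0 →
    g.pull P ≠ 0) {M : Matrix (Fin 4) (Fin 4) ℤ}
    (hM : g.HasPullbackMatrix M) : (g.degree : ℤ) = M 0 0 := by
  classical
  -- At each center exactly one of the three summands is nonzero.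
  set l : Poly := coord 0 + coord 1 + coord 2 with hl
  have hl1 : l.IsHomogeneous 1 :=
    ((coord_isHomogeneous 0).add (coord_isHomogeneous 1)).add (coord_isHomogeneous 2)
  have hlk : ∀ k, eval (center k) l ≠ 0 := by
    intro k
    have : eval (center k) l = eval (center k) (coord k) := by
      fin_cases k <;> simp [hl, eval_coord_center_ne]
    rw [this]
    exact eval_coord_center_self k
  have hl0 : l ≠ 0 := fun h => hlk 0 (by rw [h, map_zero])
  set C := PlaneCurve.ofForm hl1 (irreducible_of_isHomogeneous_one hl1 hl0)
  have hass : Associated C.equation l := PlaneCurve.associated_ofForm _ _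
  have hord : ∀ k, multAt k C.equation = 0 := fun k =>
    ((PrimeDivisor.exceptional k).ord_eq_of_associated hass).trans
      (PrimeDivisor.ord_exceptional_eq_zero hl1 (hlk k))
  have hdeg : C.degree = 1 := by
    obtain ⟨u, hu⟩ := hass.symm
    obtain ⟨c, _, hc⟩ := isUnit_iff_exists_C.mp u.isUnit
    exact C.isHomogeneous.inj_right (by rw [← hu, hc, mul_comm]; exact hl1.C_mul c)
      C.prime_equation.ne_zero
  obtain ⟨D', hD', hc'⟩ := hM (Finsupp.single (.strict C) 1)
  have hhom := g.pull_isHomogeneous C.isHomogeneous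
  obtain ⟨E, hE, hEc⟩ := exists_divisor_of_form (g.pull C.equation)
    (hinj _ _ C.isHomogeneous C.prime_equation.ne_zero) _ hhom
  have key : E = D' + ∑ k : Fin 3, Finsupp.single (.exceptional k)
      (((g.baseOrd (.exceptional k)).toNat : ℤ)) := by
    ext B
    have h1 : D' B = ((B.ord (g.pull C.equation)).toNat : ℤ) - ((g.baseOrd B).toNat : ℤ) := by
      rw [hD', Finsupp.sum_single_index (by simp)]
      simp [pullbackMult, hdeg, hord]
    rw [Finsupp.add_apply, h1, hE, Finsupp.finsetSum_apply]
    cases B with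
    | strict C' => simp [baseOrd_strict]
    | exceptional j =>
      rw [Finset.sum_eq_single j (fun k _ hk => Finsupp.single_eq_of_ne (by simpa using hk.symm))
        (fun h => absurd (Finset.mem_univ _) h)]
      simp
  have h2 := congrFun hEc 0
  rw [key, numClass_add, hc', numClass_sum, numClass_single] at h2
  simp only [numClass_single, PrimeDivisor.numClass, hdeg, hord, Fin.sum_univ_three] at h2
  simpa [Matrix.mulVec, dotProduct, Fin.sum_univ_four] using h2.symm

end RatMap

/-! ### Binary forms -/

/-- The binary form `∑ cᵢ xⁱ y^(m-i)` of degree `m` given by the coefficients of a polynomial. -/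
noncomputable def binaryForm {A : Type} [CommRing A] [Algebra ℂ A] (m : ℕ) (x y : A) :
    Polynomial ℂ →ₗ[ℂ] A :=
  ∑ i ∈ Finset.range (m + 1), (Polynomial.lcoeff ℂ i).smulRight (x ^ i * y ^ (m - i))

lemma binaryForm_apply {A : Type} [CommRing A] [Algebra ℂ A] (m : ℕ) (x y : A)
    (p : Polynomial ℂ) :
    binaryForm m x y p = ∑ i ∈ Finset.range (m + 1), p.coeff i • (x ^ i * y ^ (m - i)) := by
  simp [binaryForm]

lemma binaryForm_monomial {A : Type} [CommRing A] [Algebra ℂ A] {m a : ℕ} (ha : a ≤ m) (x y : A)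
    (c : ℂ) : binaryForm m x y (Polynomial.monomial a c) = c • (x ^ a * y ^ (m - a)) := by
  rw [binaryForm_apply, Finset.sum_eq_single a]
  · simp
  · intro i _ hi
    rw [Polynomial.coeff_monomial_of_ne c hi, zero_smul]
  · intro h
    exact absurd (Finset.mem_range.mpr (by omega)) h

lemma binaryForm_succ {A : Type} [CommRing A] [Algebra ℂ A] {m : ℕ} (x y : A)
    {p : Polynomial ℂ} (hp : p.natDegree ≤ m) :
    binaryForm (m + 1) x y p = y * binaryForm m x y p := by
  rw [binaryForm_apply, binaryForm_apply, Finset.sum_range_succ,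
    Polynomial.coeff_eq_zero_of_natDegree_lt (by omega), zero_smul, add_zero, Finset.mul_sum]
  refine Finset.sum_congr rfl fun i hi => ?_
  rw [Finset.mem_range] at hi
  rw [show m + 1 - i = (m - i) + 1 by omega, pow_succ, mul_smul_comm]
  congr 1
  ring

lemma binaryForm_X_mul {A : Type} [CommRing A] [Algebra ℂ A] (m : ℕ) (x y : A)
    (p : Polynomial ℂ) :
    binaryForm (m + 1) x y (Polynomial.X * p) = x * binaryForm m x y p := by
  rw [binaryForm_apply, binaryForm_apply, Finset.sum_range_succ', Finset.mul_sum]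
  simp only [Polynomial.coeff_X_mul, Polynomial.coeff_X_mul_zero, zero_smul, add_zero]
  refine Finset.sum_congr rfl fun i _ => ?_
  rw [Nat.add_sub_add_right, mul_smul_comm]
  congr 1
  ring

/-- Over `ℂ`, binary forms split into linear forms. -/
lemma exists_binaryForm_eq_prod (m : ℕ) (p : Polynomial ℂ) (hp : p ≠ 0) (hd : p.natDegree ≤ m) :
    ∃ (c : ℂ) (s : Multiset (ℂ × ℂ)), c ≠ 0 ∧ s.card = m ∧ (∀ t ∈ s, t ≠ 0) ∧
      ∀ (A : Type) [CommRing A] [Algebra ℂ A] (x y : A),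
        binaryForm m x y p = c • (s.map fun t => t.1 • x + t.2 • y).prod := by
  induction m generalizing p with
  | zero =>
    rw [Nat.le_zero, Polynomial.natDegree_eq_zero] at hd
    obtain ⟨c, rfl⟩ := hd
    exact ⟨c, 0, by simpa using hp, rfl, by simp, fun A _ _ x y => by simp [binaryForm_apply]⟩
  | succ m ih =>
    by_cases hd' : p.natDegree ≤ m
    · obtain ⟨c, s, hc, hs, hs0, h⟩ := ih p hp hd'
      refine ⟨c, (0, 1) ::ₘ s, hc, by simp [hs], ?_, fun A _ _ x y => ?_⟩
      · intro t ht
        rcases Multiset.mem_cons.mp ht with rfl | ht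
        · simp
        · exact hs0 t ht
      · rw [binaryForm_succ x y hd', h]
        simp
    · obtain ⟨r, hr⟩ := Complex.exists_root (f := p)
        (Polynomial.natDegree_pos_iff_degree_pos.mp (by omega))
      obtain ⟨q, hq⟩ := Polynomial.dvd_iff_isRoot.mpr hr
      have hq0 : q ≠ 0 := fun h => hp (by rw [hq, h, mul_zero])
      have hqd : q.natDegree ≤ m := by
        have := Polynomial.natDegree_mul (Polynomial.X_sub_C_ne_zero r) hq0
        rw [← hq, Polynomial.natDegree_X_sub_C] at this
        omega
      obtain ⟨c, s, hc, hs, hs0, h⟩ := ih q hq0 hqd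
      refine ⟨c, (1, -r) ::ₘ s, hc, by simp [hs], ?_, fun A _ _ x y => ?_⟩
      · intro t ht
        rcases Multiset.mem_cons.mp ht with rfl | ht
        · simp
        · exact hs0 t ht
      · have : p = Polynomial.X * q - r • q := by
          rw [hq, Polynomial.smul_eq_C_mul]; ring
        rw [this, map_sub, map_smul, binaryForm_X_mul, binaryForm_succ x y hqd, h]
        simp only [Multiset.map_cons, Multiset.prod_cons, Algebra.smul_def, map_neg, map_one]
        ring

lemma exists_binaryForm_of_isHomogeneous {m : ℕ} {G : MvPolynomial (Fin 2) ℂ}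
    (hG : G.IsHomogeneous m) : ∃ p : Polynomial ℂ, p.natDegree ≤ m ∧
      ∀ (A : Type) [CommRing A] [Algebra ℂ A] (x : Fin 2 → A),
        aeval x G = binaryForm m (x 0) (x 1) p := by
  have hsum : ∀ d ∈ G.support, d 0 + d 1 = m := fun d hd => by
    have h1 := hG.degree_eq_sum_deg_support hd
    have h2 : ∑ i ∈ d.support, d i = ∑ i, d i :=
      Finset.sum_subset (Finset.subset_univ _) fun i _ hi => by simpa using hi
    rw [h1, h2, Fin.sum_univ_two]
  refine ⟨∑ d ∈ G.support, Polynomial.monomial (d 0) (G.coeff d), ?_, fun A _ _ x => ?_⟩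
  · refine Polynomial.natDegree_sum_le_of_forall_le _ _ fun d hd => ?_
    exact (Polynomial.natDegree_monomial_le _).trans (by have := hsum d hd; omega)
  · rw [map_sum, aeval_def, eval₂_eq']
    refine Finset.sum_congr rfl fun d hd => ?_
    have := hsum d hd
    rw [binaryForm_monomial (by omega), Algebra.smul_def, Fin.prod_univ_two,
      show m - d 0 = d 1 by omega]

/-- The expansion of a ternary form in powers of the last variable. -/
lemma exists_expansion_of_isHomogeneous {n : ℕ} {G : Poly} (hG : G.IsHomogeneous n) :
    ∃ p : ℕ → Polynomial ℂ, (∀ j, (p j).natDegree ≤ j) ∧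
      ∀ (A : Type) [CommRing A] [Algebra ℂ A] (x : Fin 3 → A),
        aeval x G = ∑ j ∈ Finset.range (n + 1), x 2 ^ (n - j) * binaryForm j (x 0) (x 1) (p j) := by
  have hsum : ∀ d ∈ G.support, d 0 + d 1 + d 2 = n := fun d hd => by
    have h1 := hG.degree_eq_sum_deg_support hd
    have h2 : ∑ i ∈ d.support, d i = ∑ i, d i :=
      Finset.sum_subset (Finset.subset_univ _) fun i _ hi => by simpa using hi
    rw [h1, h2, Fin.sum_univ_three]
  refine ⟨fun j => ∑ d ∈ G.support with d 0 + d 1 = j, Polynomial.monomial (d 0) (G.coeff d),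
    fun j => ?_, fun A _ _ x => ?_⟩
  · refine Polynomial.natDegree_sum_le_of_forall_le _ _ fun d hd => ?_
    exact (Polynomial.natDegree_monomial_le _).trans
      (by have := (Finset.mem_filter.mp hd).2; omega)
  · rw [aeval_def, eval₂_eq', ← Finset.sum_fiberwise_of_maps_to (g := fun d => d 0 + d 1)
      (t := Finset.range (n + 1)) (fun d hd => Finset.mem_range.mpr (by
        have := hsum d hd; omega))]
    refine Finset.sum_congr rfl fun j _ => ?_
    rw [map_sum, Finset.mul_sum]
    refine Finset.sum_congr rfl fun d hd => ?_
    obtain ⟨hd, hj⟩ := Finset.mem_filter.mp hd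
    have := hsum d hd
    rw [binaryForm_monomial (by omega), Algebra.smul_def, Fin.prod_univ_three,
      show j - d 0 = d 1 by omega, show n - j = d 2 by omega]
    ring

/-! ### Algebraic independence in quotients -/

/-- Killing a nonzero element of a domain costs at least one in transcendence degree. In a relation
for a over ℂ[x], powers of a can be divided out until the constant coefficient is nonzero; but φ
kills a, hence also that coefficient, against the independence of y. -/
lemma exists_algebraicIndependent_option {A A' ι : Type} [CommRing A] [IsDomain A] [Algebra ℂ A]
    [CommRing A'] [Algebra ℂ A'] (φ : A →ₐ[ℂ] A') (hφ : Function.Surjective φ)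
    {a : A} (ha : a ≠ 0) (hφa : φ a = 0) {y : ι → A'} (hy : AlgebraicIndependent ℂ y) :
    ∃ x : Option ι → A, AlgebraicIndependent ℂ x := by
  choose x hx using fun i => hφ (y i)
  have hxy : φ ∘ x = y := funext hx
  have hind : AlgebraicIndependent ℂ x := .of_comp φ (hxy ▸ hy)
  refine ⟨_, (hind.option_iff_transcendental a).mpr ?_⟩
  intro halg
  obtain ⟨p, hp0, hpa⟩ := halg
  obtain ⟨q, hq, hq0⟩ := Polynomial.exists_eq_pow_rootMultiplicity_mul_and_not_dvd p hp0 0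
  rw [map_zero, sub_zero] at hq hq0
  rw [hq, map_mul, map_pow, Polynomial.aeval_X] at hpa
  have hqa := (mul_eq_zero.mp hpa).resolve_left (pow_ne_zero _ ha)
  rw [Polynomial.X_dvd_iff] at hq0
  apply hq0
  rw [← Polynomial.divX_mul_X_add q, map_add, map_mul, Polynomial.aeval_X, Polynomial.aeval_C]
    at hqa
  have h1 := congrArg φ hqa
  rw [map_add, map_mul, hφa, mul_zero, zero_add, map_zero] at h1
  have hmem : ∀ b ∈ Algebra.adjoin ℂ (Set.range x),
      ∃ G : MvPolynomial ι ℂ, aeval x G = b := by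
    rw [Algebra.adjoin_range_eq_range_aeval]
    exact fun b hb => hb
  obtain ⟨G, hG⟩ := hmem _ (q.coeff 0).2
  have h2 : φ (aeval x G) = 0 := by
    rw [hG]; exact h1
  rw [comp_aeval_apply] at h2
  have hG0 : G = 0 := (algebraicIndependent_iff.mp hy) G (by rw [← hxy]; exact h2)
  apply Subtype.ext
  rw [← hG, hG0]
  simp

lemma not_algebraicIndependent_option_fin_three (x : Option (Fin 3) → Poly) :
    ¬ AlgebraicIndependent ℂ x := by
  intro h
  have h1 := h.cardinalMk_le_trdeg
  rw [trdeg_of_isDomain] at h1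
  simp at h1
  exact absurd h1 (by norm_num)

lemma homogeneousComponent_dvd {H F : Poly} {m : ℕ} (hH : H.IsHomogeneous m) (h : H ∣ F) (n : ℕ) :
    H ∣ homogeneousComponent n F := by
  let _ := MvPolynomial.gradedAlgebra (σ := Fin 3) (R := ℂ)
  rw [← Ideal.mem_span_singleton] at h ⊢
  refine homogeneousComponent_mem_of_mem
    (Ideal.homogeneous_span (homogeneousSubmodule (Fin 3) ℂ) _ ?_) h n
  rintro _ rfl
  exact ⟨m, hH⟩

/-- The homogeneous components of the substitution of forms of degree `d > 0`. -/
lemma homogeneousComponent_aeval {σ : Type} {d : ℕ} (hd : 0 < d)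
    {x : σ → Poly} (hx : ∀ i, (x i).IsHomogeneous d) (G : MvPolynomial σ ℂ) (n : ℕ) :
    homogeneousComponent (d * n) (aeval x G) = aeval x (homogeneousComponent n G) := by
  conv_lhs => rw [← sum_homogeneousComponent G, map_sum, map_sum]
  have hhom : ∀ i, (aeval x (homogeneousComponent i G)).IsHomogeneous (d * i) := fun i =>
    (homogeneousComponent_isHomogeneous i G).aeval _ hx
  have hval : ∀ i, homogeneousComponent (d * n) (aeval x (homogeneousComponent i G)) =
      if i = n then aeval x (homogeneousComponent n G) else 0 := fun i => by
    rw [homogeneousComponent_of_mem ((mem_homogeneousSubmodule _ _).mpr (hhom i))]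
    by_cases hi : i = n
    · subst hi; simp
    · rw [if_neg hi, if_neg]
      intro h
      exact hi (Nat.eq_of_mul_eq_mul_left hd h).symm
  simp only [hval, Finset.sum_ite_eq', Finset.mem_range]
  split_ifs with h
  · rfl
  · rw [homogeneousComponent_eq_zero _ _ (by omega), map_zero]

lemma exists_homogeneousComponent_ne_zero {σ : Type} {G : MvPolynomial σ ℂ} (hG : G ≠ 0) :
    ∃ n, homogeneousComponent n G ≠ 0 := by
  by_contra! h
  exact hG (by rw [← sum_homogeneousComponent G]; simp [h])

/-! ### Images of plane curves, by transcendence degree -/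

namespace RatMap

/-- The image of a plane curve is contained in a plane curve. -/
lemma exists_form_of_prime (g : RatMap) (hg : 0 < g.degree) {H : Poly} (hH : Prime H) {m : ℕ}
    (hm : H.IsHomogeneous m) : ∃ (n : ℕ) (G : Poly), G.IsHomogeneous n ∧ G ≠ 0 ∧ H ∣ g.pull G := by
  set φ := Ideal.Quotient.mkₐ ℂ (Ideal.span {H})
  have hker : ∀ F, φ F = 0 ↔ H ∣ F := fun F => by
    rw [← Ideal.mem_span_singleton]; exact Ideal.Quotient.eq_zero_iff_mem
  -- If the three forms were independent modulo H, their lifts together with H would give four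
  -- independent elements in a ring of transcendence degree three. The resulting relation is then
  -- replaced by a homogeneous component.
  have hnot : ¬ AlgebraicIndependent ℂ (fun i => φ (g.form i)) := fun h => by
    obtain ⟨x, hx⟩ := exists_algebraicIndependent_option φ (Ideal.Quotient.mkₐ_surjective _ _)
      hH.ne_zero ((hker H).mpr dvd_rfl) h
    exact not_algebraicIndependent_option_fin_three x hx
  rw [algebraicIndependent_iff] at hnot
  push Not at hnot
  obtain ⟨G, hG, hG0⟩ := hnot
  have hdvd : H ∣ g.pull G := by
    rw [← hker, ← hG, pull, bind₁, comp_aeval_apply]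
  obtain ⟨n, hn⟩ := exists_homogeneousComponent_ne_zero hG0
  refine ⟨n, _, homogeneousComponent_isHomogeneous n G, hn, ?_⟩
  have := homogeneousComponent_dvd hm hdvd (g.degree * n)
  rwa [pull, bind₁, homogeneousComponent_aeval hg g.isHomogeneous] at this

/-- Every point of the curve H = 0 at which g is defined is mapped into G = 0. This keeps general
points away from the images of bad curves. -/
lemma exists_form_dvd_pull (g : RatMap) (hg : 0 < g.degree) (H : Poly) (h0 : H ≠ 0) (m : ℕ)
    (hm : H.IsHomogeneous m) : ∃ (n : ℕ) (G : Poly), G.IsHomogeneous n ∧ G ≠ 0 ∧ H ∣ g.pull G := by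
  induction H using UniqueFactorizationMonoid.induction_on_prime generalizing m with
  | h₁ => exact absurd rfl h0
  | h₂ x hx => exact ⟨0, 1, isHomogeneous_one _ _, one_ne_zero, hx.dvd⟩
  | h₃ a p ha hp ih =>
    obtain ⟨k, hk⟩ := isHomogeneous_left_of_mul hm h0
    obtain ⟨n, G, hG, hG0, hd⟩ := ih ha _ (isHomogeneous_right_of_mul hm hk h0).2
    obtain ⟨n', G', hG', hG0', hd'⟩ := g.exists_form_of_prime hg hp hk
    refine ⟨_, _, hG'.mul hG, mul_ne_zero hG0' hG0, ?_⟩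
    rw [pull_mul]
    exact mul_dvd_mul hd' hd

/-- Two of the forms are algebraically independent on a curve that is not contracted. -/
lemma exists_algebraicIndependent_pair (g : RatMap) (hg : 0 < g.degree) (C : PlaneCurve)
    (hnc : ∀ q : Fin 3 → ℂ, q ≠ 0 → ∃ i j,
      ¬ C.equation ∣ q i • g.form j - q j • g.form i) :
    ∃ i j, AlgebraicIndependent ℂ
      (Ideal.Quotient.mkₐ ℂ (Ideal.span {C.equation}) ∘ g.form ∘ ![i, j]) := by
  obtain ⟨i, hi⟩ := g.exists_not_dvd_form C.prime_equation.not_isUnit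
  -- Otherwise each form is a constant multiple r j of the i-th one modulo C. If r i = 1, the curve
  -- is contracted to the point r; if r i ≠ 1, the i-th form itself vanishes on C.
  have hj : ∃ j, ∀ r : ℂ, ¬ C.equation ∣ g.form j - r • g.form i := by
    by_contra! h
    choose r hr using h
    by_cases hri : r i = 1
    · obtain ⟨a, b, hab⟩ := hnc r (fun h => by rw [h] at hri; simp at hri)
      apply hab
      have : r a • g.form b - r b • g.form a = r a • (g.form b - r b • g.form i) -
          r b • (g.form a - r a • g.form i) := by
        simp only [smul_sub, smul_smul, mul_comm (r b)]; abel
      rw [this]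
      exact dvd_sub (dvd_smul_of_dvd _ (hr b)) (dvd_smul_of_dvd _ (hr a))
    · have h1 := hr i
      have h2 : g.form i - r i • g.form i = (1 - r i) • g.form i := by rw [sub_smul, one_smul]
      rw [h2] at h1
      apply hi
      have h3 : (1 - r i) ≠ 0 := sub_ne_zero.mpr (Ne.symm hri)
      have := dvd_smul_of_dvd (1 - r i)⁻¹ h1
      rwa [smul_smul, inv_mul_cancel₀ h3, one_smul] at this
  obtain ⟨j, hj⟩ := hj
  refine ⟨i, j, ?_⟩
  have hker : ∀ F, Ideal.Quotient.mkₐ ℂ (Ideal.span {C.equation}) F = 0 ↔ C.equation ∣ F :=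
    fun F => by rw [← Ideal.mem_span_singleton]; exact Ideal.Quotient.eq_zero_iff_mem
  rw [algebraicIndependent_iff]
  intro G hG
  by_contra hG0
  rw [Function.comp_def, ← comp_aeval_apply, hker] at hG
  obtain ⟨n, hn⟩ := exists_homogeneousComponent_ne_zero hG0
  have hd := homogeneousComponent_dvd C.isHomogeneous hG (g.degree * n)
  rw [homogeneousComponent_aeval hg (x := g.form ∘ ![i, j]) (fun a => g.isHomogeneous _)] at hd
  -- A homogeneous relation between two forms splits over ℂ into linear ones, and the prime C
  -- divides one of them: the ratio of the two forms would be constant on C.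
  obtain ⟨p, hp, hpe⟩ := exists_binaryForm_of_isHomogeneous
    (homogeneousComponent_isHomogeneous n G)
  have hp0 : p ≠ 0 := by
    rintro rfl
    apply hn
    have := hpe _ (X : Fin 2 → MvPolynomial (Fin 2) ℂ)
    rwa [map_zero, aeval_X_left_apply] at this
  obtain ⟨c, s, hc, -, hs, hprod⟩ := exists_binaryForm_eq_prod n p hp0 hp
  rw [hpe, hprod] at hd
  have hd' := dvd_smul_of_dvd c⁻¹ hd
  rw [smul_smul, inv_mul_cancel₀ hc, one_smul] at hd'
  obtain ⟨t, ht, htd⟩ := C.prime_equation.exists_mem_multiset_map_dvd hd'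
  simp only [Function.comp_apply, Matrix.cons_val_zero, Matrix.cons_val_one] at htd
  by_cases ht2 : t.2 = 0
  · have ht1 : t.1 ≠ 0 := fun h => hs t ht (Prod.ext h ht2)
    rw [ht2, zero_smul, add_zero] at htd
    have := dvd_smul_of_dvd t.1⁻¹ htd
    rw [smul_smul, inv_mul_cancel₀ ht1, one_smul] at this
    exact hi this
  · have := dvd_smul_of_dvd t.2⁻¹ htd
    rw [smul_add, smul_smul, smul_smul, inv_mul_cancel₀ ht2, one_smul] at this
    apply hj (-(t.2⁻¹ * t.1))
    rw [neg_smul, sub_neg_eq_add, add_comm]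
    exact this

/-- A curve that is not contracted is transported to a curve. -/
lemma exists_transports_strict (g : RatMap) (hg : 0 < g.degree)
    (hinj : ∀ n P, P.IsHomogeneous n → P ≠ 0 → g.pull P ≠ 0) (C : PlaneCurve)
    (hnc : ∀ q : Fin 3 → ℂ, q ≠ 0 → ∃ i j,
      ¬ C.equation ∣ q i • g.form j - q j • g.form i) :
    ∃ C' e, g.Transports (.strict C) (.strict C') e := by
  set ψ := Ideal.Quotient.mkₐ ℂ (Ideal.span {C.equation}) with hψ
  have hψker : ∀ F, ψ F = 0 ↔ C.equation ∣ F :=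
    fun F => by rw [← Ideal.mem_span_singleton]; exact Ideal.Quotient.eq_zero_iff_mem
  have hprime : (Ideal.span {C.equation}).IsPrime :=
    (Ideal.span_singleton_prime C.prime_equation.ne_zero).mpr C.prime_equation
  set χ : Poly →ₐ[ℂ] Poly ⧸ Ideal.span {C.equation} := ψ.comp (bind₁ g.form) with hχ
  have hχker : ∀ F, χ F = 0 ↔ C.equation ∣ g.pull F := fun F => hψker _
  obtain ⟨n, G, hG, hG0, hCG⟩ := g.exists_form_of_prime hg C.prime_equation C.isHomogeneous
  -- The curve P' = 0 will be the image of C.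
  have hfac : ∃ P', Prime P' ∧ P' ∣ G ∧ C.equation ∣ g.pull P' := by
    clear hG
    induction G using UniqueFactorizationMonoid.induction_on_prime with
    | h₁ => exact absurd rfl hG0
    | h₂ x hx =>
      have h1 : IsUnit (g.pull x) := hx.map (bind₁ g.form)
      exact absurd (isUnit_of_dvd_unit hCG h1) C.prime_equation.not_isUnit
    | h₃ a p ha hp ih =>
      rw [pull_mul] at hCG
      rcases C.prime_equation.dvd_or_dvd hCG with h | h
      · exact ⟨p, hp, dvd_mul_right _ _, h⟩
      · obtain ⟨P', h1, h2, h3⟩ := ih ha h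
        exact ⟨P', h1, h2.mul_left _, h3⟩
  obtain ⟨P', hP', hP'G, hCP'⟩ := hfac
  obtain ⟨d, hd⟩ := isHomogeneous_of_dvd hG hG0 hP'G
  -- Otherwise start from two independent elements modulo the kernel of χ. Lifting along Poly/(P') →
  -- Poly/ker χ, which kills the nonzero class of R, gains a third one, and lifting along Poly →
  -- Poly/(P') gains a fourth: one too many.
  have key : ∀ R, R ≠ 0 → ¬ P' ∣ R → ¬ C.equation ∣ g.pull R := by
    intro R _ hPR hCR
    obtain ⟨i, j, hij⟩ := g.exists_algebraicIndependent_pair hg C hnc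
    set I := RingHom.ker χ
    set J : Ideal Poly := Ideal.span {P'}
    have hJI : J ≤ I := by
      rw [Ideal.span_singleton_le_iff_mem]
      exact (hχker P').mpr hCP'
    have hI : AlgebraicIndependent ℂ (fun a => Ideal.Quotient.mkₐ ℂ I (X (![i, j] a))) := by
      refine AlgebraicIndependent.of_comp (Ideal.kerLiftAlg χ) ?_
      convert hij using 1
      funext a
      change χ (X (![i, j] a)) = ψ (g.form (![i, j] a))
      simp [hχ]
    have hJ : J.IsPrime := (Ideal.span_singleton_prime hP'.ne_zero).mpr hP'
    obtain ⟨x, hx⟩ := exists_algebraicIndependent_option (Ideal.Quotient.factorₐ ℂ hJI)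
      (Ideal.Quotient.factor_surjective hJI) (a := Ideal.Quotient.mk J R)
      (fun h => hPR (Ideal.mem_span_singleton.mp (Ideal.Quotient.eq_zero_iff_mem.mp h)))
      (by
        change Ideal.Quotient.mk I R = 0
        exact Ideal.Quotient.eq_zero_iff_mem.mpr ((hχker R).mpr hCR)) hI
    obtain ⟨z, hz⟩ := exists_algebraicIndependent_option (Ideal.Quotient.mkₐ ℂ J)
      (Ideal.Quotient.mkₐ_surjective _ _) hP'.ne_zero
      (Ideal.Quotient.eq_zero_iff_mem.mpr (Ideal.mem_span_singleton_self P')) hx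
    have e : Option (Fin 3) ≃ Option (Option (Fin 2)) :=
      Fintype.equivOfCardEq (by simp)
    exact not_algebraicIndependent_option_fin_three _ (hz.comp e e.injective)
  have hfin : FiniteMultiplicity C.equation (g.pull P') :=
    .of_prime_left C.prime_equation (hinj _ _ hd hP'.ne_zero)
  refine ⟨PlaneCurve.ofForm hd hP'.irreducible, multiplicity C.equation (g.pull P'),
    fun n Q hQ => ?_⟩
  rw [baseOrd_strict, mul_zero, add_zero]
  have hass : Associated (PlaneCurve.ofForm hd hP'.irreducible).equation P' :=
    PlaneCurve.associated_ofForm _ _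
  have hpos : multiplicity C.equation (g.pull P') ≠ 0 := by
    intro h0
    have h1 := hfin.emultiplicity_eq_multiplicity
    rw [h0, Nat.cast_zero, emultiplicity_eq_zero] at h1
    exact h1 hCP'
  -- The zero form has order ⊤ on both sides; this needs a nonzero ramification index.
  by_cases hQ0 : Q = 0
  · rw [hQ0, pull, map_zero, PrimeDivisor.ord_zero, PrimeDivisor.ord_zero, ENat.mul_top]
    exact_mod_cast hpos
  obtain ⟨k, R, hPR, hQR⟩ := WfDvdMonoid.max_power_factor hQ0 hP'.irreducible
  have hR0 : R ≠ 0 := fun h => hQ0 (by rw [hQR, h, mul_zero])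
  have h1 : (PrimeDivisor.strict C).ord (g.pull R) = 0 :=
    emultiplicity_eq_zero.mpr (key R hR0 hPR)
  have h2 : (PrimeDivisor.strict (PlaneCurve.ofForm hd hP'.irreducible)).ord R = 0 :=
    emultiplicity_eq_zero.mpr fun h => hPR (hass.symm.dvd.trans h)
  have h3 : (PrimeDivisor.strict (PlaneCurve.ofForm hd hP'.irreducible)).ord P' = 1 := by
    rw [← PrimeDivisor.ord_eq_of_associated _ hass, PrimeDivisor.ord_strict]
    exact (FiniteMultiplicity.of_prime_left (PlaneCurve.prime_equation _)
      (PlaneCurve.prime_equation _).ne_zero).emultiplicity_self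
  have h4 : g.pull (P' ^ k) = g.pull P' ^ k := map_pow _ _ _
  rw [hQR, pull_mul, h4, PrimeDivisor.ord_mul, PrimeDivisor.ord_pow, PrimeDivisor.ord_mul,
    PrimeDivisor.ord_pow, h1, h2, h3, PrimeDivisor.ord_strict, hfin.emultiplicity_eq_multiplicity]
  ring

end RatMap

/-! ### Transport to an exceptional curve -/

/-- The point with given values of the forms `coord`. -/
noncomputable def fromCoord {A : Type} [CommRing A] [Algebra ℂ A] (c : Fin 3 → A) : Fin 3 → A :=
  ![(1 / 2 : ℂ) • (c 1 + c 2), (Complex.I / 2) • (c 1 - c 2), -c 0]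

lemma fromCoord_map {A B : Type} [CommRing A] [Algebra ℂ A] [CommRing B] [Algebra ℂ B]
    (φ : A →ₐ[ℂ] B) (c : Fin 3 → A) (i : Fin 3) :
    φ (fromCoord c i) = fromCoord (fun j => φ (c j)) i := by
  fin_cases i <;> simp [fromCoord]

lemma fromCoord_coord : fromCoord coord = X := by
  have hI : (C Complex.I : Poly) * C Complex.I = -1 := by
    rw [← C_mul, Complex.I_mul_I]; simp
  have h2 : (C (1 / 2) : Poly) * 2 = 1 := by
    rw [show (2 : Poly) = C 2 from (map_ofNat C 2).symm, ← C_mul]; norm_num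
  have h3 : (C (Complex.I / 2) : Poly) = C (1 / 2) * C Complex.I := by rw [← C_mul]; ring_nf
  funext i
  fin_cases i
  · simp only [fromCoord, coord, Fin.zero_eta, Matrix.cons_val_zero, Matrix.cons_val_one,
      Matrix.cons_val_two, Matrix.head_cons, Matrix.tail_cons, smul_eq_C_mul]
    linear_combination X 0 * h2
  · simp only [fromCoord, coord, Fin.mk_one, Matrix.cons_val_zero, Matrix.cons_val_one,
      Matrix.cons_val_two, Matrix.head_cons, Matrix.tail_cons, smul_eq_C_mul, h3]
    linear_combination X 1 * h2 - 2 * C (1 / 2) * X 1 * hI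
  · simp [fromCoord, coord]

lemma algHom_eq_aeval_fromCoord {A : Type} [CommRing A] [Algebra ℂ A] (φ : Poly →ₐ[ℂ] A)
    (Q : Poly) : φ Q = aeval (fromCoord fun j => φ (coord j)) Q := by
  have : φ = aeval (fromCoord fun j => φ (coord j)) := by
    ext i
    rw [aeval_X, ← fromCoord_map, fromCoord_coord]
  exact DFunLike.congr_fun this Q

/-- The k-th coordinate is nonzero at the center and the other two are local parameters there.
Quantifying over all homomorphisms lets the same coefficients serve for a form and for its pullback.
-/
lemma exists_expansion_at_center (k : Fin 3) {n : ℕ} {Q : Poly} (hQ : Q.IsHomogeneous n) :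
    ∃ p : ℕ → Polynomial ℂ, (∀ j, (p j).natDegree ≤ j) ∧
      ∀ (A : Type) [CommRing A] [Algebra ℂ A] (φ : Poly →ₐ[ℂ] A),
        φ Q = ∑ j ∈ Finset.range (n + 1), φ (coord k) ^ (n - j) *
          binaryForm j (φ (coord (k + 1))) (φ (coord (k + 2))) (p j) := by
  -- The inverse change of coordinates, shifted cyclically so that the last variable takes the place
  -- of `coord k`.
  set y : Fin 3 → Poly := fromCoord fun j => X (j - k - 1) with hy
  have hy1 : ∀ i, (y i).IsHomogeneous 1 := by
    intro i
    fin_cases i <;> simp only [hy, fromCoord, smul_eq_C_mul]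
    · exact ((isHomogeneous_X _ _).add (isHomogeneous_X _ _)).C_mul _
    · exact ((isHomogeneous_X _ _).sub (isHomogeneous_X _ _)).C_mul _
    · exact (isHomogeneous_X _ _).neg
  have hQ' : (aeval y Q).IsHomogeneous n := by simpa using hQ.aeval y hy1
  obtain ⟨p, hp, h⟩ := exists_expansion_of_isHomogeneous hQ'
  refine ⟨p, hp, fun A _ _ φ => ?_⟩
  have h1 := h A fun a => φ (coord (k + 1 + a))
  have e2 : k + 1 + 2 = k := by fin_cases k <;> decide
  have e1 : k + 1 + 1 = k + 2 := by fin_cases k <;> decide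
  simp only [e2, e1, add_zero] at h1
  rw [← h1, comp_aeval_apply, algHom_eq_aeval_fromCoord φ Q]
  congr 2
  funext i
  rw [hy, fromCoord_map]
  congr 1
  funext j
  rw [aeval_X]
  congr 2
  abel

namespace PrimeDivisor

lemma lt_ord_sum (B : PrimeDivisor) {ι : Type*} (s : Finset ι) (t : ι → Poly) {a : ℕ∞}
    (ha : a < ⊤) (h : ∀ i ∈ s, a < B.ord (t i)) : a < B.ord (∑ i ∈ s, t i) := by
  classical
  induction s using Finset.induction_on with
  | empty => simpa [ord_zero] using ha
  | insert i s hi ih =>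
    rw [Finset.sum_insert hi]
    exact (lt_min (h i (Finset.mem_insert_self _ _))
      (ih fun j hj => h j (Finset.mem_insert_of_mem hj))).trans_le (B.min_le_ord_add _ _)

lemma ord_smul (B : PrimeDivisor) {c : ℂ} (hc : c ≠ 0) (P : Poly) : B.ord (c • P) = B.ord P := by
  rw [smul_eq_C_mul, ord_mul, B.ord_of_isUnit (isUnit_iff_exists_C.mpr ⟨c, hc, rfl⟩), zero_add]

lemma ord_binaryForm (B : PrimeDivisor) {x y : Poly} {r : ℕ∞}
    (hxy : ∀ t : ℂ × ℂ, t ≠ 0 → B.ord (t.1 • x + t.2 • y) = r) {m : ℕ} {p : Polynomial ℂ}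
    (hp : p ≠ 0) (hd : p.natDegree ≤ m) : B.ord (binaryForm m x y p) = m * r := by
  obtain ⟨c, s, hc, hs, hs0, h⟩ := exists_binaryForm_eq_prod m p hp hd
  rw [h, ord_smul B hc, ← hs]
  clear h hs
  induction s using Multiset.induction_on with
  | empty => simp [ord_one]
  | cons t s ih =>
    rw [Multiset.map_cons, Multiset.prod_cons, ord_mul, hxy t (hs0 t (Multiset.mem_cons_self _ _)),
      ih fun u hu => hs0 u (Multiset.mem_cons_of_mem hu), Multiset.card_cons]
    push_cast; ring

/-- The j-th term, when nonzero, has order exactly (n - j) r + j (r + e) = e j + n r, since binary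
forms split into linear ones. These orders increase strictly with j, so the lowest nonzero term
decides. -/
lemma ord_expansion (B : PrimeDivisor) {x y z : Poly} {r e : ℕ} (he : 0 < e) (hz : B.ord z = r)
    (hxy : ∀ t : ℂ × ℂ, t ≠ 0 → B.ord (t.1 • x + t.2 • y) = r + e) {n : ℕ}
    {p : ℕ → Polynomial ℂ} (hp : ∀ j, (p j).natDegree ≤ j) {j₀ : ℕ} (hj₀ : j₀ ≤ n)
    (hpj : p j₀ ≠ 0) (hlt : ∀ j < j₀, p j = 0) :
    B.ord (∑ j ∈ Finset.range (n + 1), z ^ (n - j) * binaryForm j x y (p j)) =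
      e * j₀ + n * r := by
  have hterm : ∀ j ≤ n, p j ≠ 0 → B.ord (z ^ (n - j) * binaryForm j x y (p j)) =
      ((e * j + n * r : ℕ) : ℕ∞) := fun j hj hpj => by
    rw [ord_mul, ord_pow, hz, B.ord_binaryForm hxy hpj (hp j)]
    obtain ⟨k, rfl⟩ := Nat.exists_eq_add_of_le hj
    rw [Nat.add_sub_cancel_left]
    push_cast; ring
  rw [← Finset.add_sum_erase _ _ (Finset.mem_range.mpr (Nat.lt_succ_of_le hj₀)), ord_add_eq_left,
    hterm j₀ hj₀ hpj]
  · push_cast; ring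
  · refine B.lt_ord_sum _ _ ?_ fun j hj => ?_
    · rw [hterm j₀ hj₀ hpj]; exact ENat.natCast_lt_top _
    · obtain ⟨hne, hj⟩ := Finset.mem_erase.mp hj
      rw [hterm j₀ hj₀ hpj]
      by_cases h0 : p j = 0
      · rw [h0, map_zero, mul_zero, ord_zero]; exact ENat.natCast_lt_top _
      · rw [hterm j (by rw [Finset.mem_range] at hj; omega) h0]
        have : j₀ < j := lt_of_le_of_ne (not_lt.mp fun h => h0 (hlt j h)) hne.symm
        have := Nat.mul_lt_mul_of_pos_left this he
        exact_mod_cast (by omega)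

end PrimeDivisor

lemma ord_exceptional_comb (k : Fin 3) (t : ℂ × ℂ) (ht : t ≠ 0) :
    (PrimeDivisor.exceptional k).ord (t.1 • coord (k + 1) + t.2 • coord (k + 2)) = 1 := by
  have hk : k + 1 ≠ k := by fin_cases k <;> decide
  have hk' : k + 2 ≠ k := by fin_cases k <;> decide
  have hk2 : k + 1 ≠ k + 2 := by fin_cases k <;> decide
  have hmem : t.1 • coord (k + 1) + t.2 • coord (k + 2) ∈ centerForms k := by
    simp only [smul_eq_C_mul]
    exact ⟨((coord_isHomogeneous _).C_mul _).add ((coord_isHomogeneous _).C_mul _), by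
      simp [eval_coord_center_ne hk, eval_coord_center_ne hk']⟩
  refine PrimeDivisor.ord_exceptional_of_mem hmem fun h0 => ht ?_
  have h1 := congrArg (eval (center (k + 1))) h0
  have h2 := congrArg (eval (center (k + 2))) h0
  simp only [smul_eq_C_mul, map_add, map_mul, eval_C, eval_coord_center_ne hk2,
    eval_coord_center_ne hk2.symm, mul_zero, add_zero, zero_add, map_zero, mul_eq_zero,
    eval_coord_center_self, or_false] at h1 h2
  exact Prod.ext h1 h2

/-- The multiplicity of Q at the center and the order of its pullback along B are read off the same
lowest nonzero term. That every combination of the two local parameters has the same order means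
that B is mapped onto E_k and not to a point of it. -/
lemma RatMap.transports_exceptional (g : RatMap) (B : PrimeDivisor) (k : Fin 3) {r e : ℕ}
    (he : 0 < e) (hbase : g.baseOrd B = r) (hz : B.ord (g.pull (coord k)) = r)
    (hxy : ∀ t : ℂ × ℂ, t ≠ 0 →
      B.ord (t.1 • g.pull (coord (k + 1)) + t.2 • g.pull (coord (k + 2))) = r + e) :
    g.Transports B (.exceptional k) e := by
  intro n Q hQ
  by_cases hQ0 : Q = 0
  · rw [hQ0, pull, map_zero, PrimeDivisor.ord_zero, PrimeDivisor.ord_zero, ENat.mul_top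
      (by exact_mod_cast he.ne'), top_add]
  obtain ⟨p, hp, h⟩ := exists_expansion_at_center k hQ
  have hex : ∃ j, j ≤ n ∧ p j ≠ 0 := by
    by_contra! hall
    apply hQ0
    have := h Poly (AlgHom.id ℂ Poly)
    rw [AlgHom.id_apply] at this
    rw [this]
    refine Finset.sum_eq_zero fun j hj => ?_
    rw [hall j (by rw [Finset.mem_range] at hj; omega), map_zero, mul_zero]
  classical
  obtain ⟨hj₀, hpj⟩ := Nat.find_spec hex
  have hlt : ∀ j < Nat.find hex, p j = 0 := fun j hj => by
    by_contra hne
    exact Nat.find_min hex hj ⟨by omega, hne⟩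
  have h1 := h Poly (AlgHom.id ℂ Poly)
  have h2 := h Poly (bind₁ g.form)
  have hu : (PrimeDivisor.exceptional k).ord (coord k) = (0 : ℕ) :=
    PrimeDivisor.ord_exceptional_eq_zero (coord_isHomogeneous k) (eval_coord_center_self k)
  have o1 := PrimeDivisor.ord_expansion (.exceptional k) one_pos hu
    (fun t ht => by simpa using ord_exceptional_comb k t ht) hp hj₀ hpj hlt
  have o2 := PrimeDivisor.ord_expansion B he hz hxy hp hj₀ hpj hlt
  simp only [AlgHom.id_apply] at h1
  rw [← h1] at o1
  change g.pull Q = _ at h2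
  rw [h2, hbase, o1]
  simp only [pull] at o2
  rw [o2]
  simp

/-! ### The forms of the map in diagonal coordinates -/

section Forms

variable {R S : Type*} [CommRing R] [CommRing S]

/-- The coordinates of the vertex `v'₁` for `v₂ = c`. -/
def lineForm (i : R) (c : Fin 3 → R) (j : Fin 3) : R :=
  2 * (1 + i) * c j - ((1 + i) * c 0 + i * c 1 + c 2)

/-- The coordinates of the vertex `v'₂` for `v₂ = c`, divided by those of `c`. -/
def conicForm (i : R) (c : Fin 3 → R) : Fin 3 → R :=
  ![c 1 * c 0 - i * (c 2 * c 0) + (1 - i) * (c 2 * c 1) + 2 * (i - 1) * (c 2 * c 1),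
    c 1 * c 0 - i * (c 2 * c 0) + (1 - i) * (c 2 * c 1) + 2 * (1 + i) * (c 2 * c 0),
    c 1 * c 0 - i * (c 2 * c 0) + (1 - i) * (c 2 * c 1) - 2 * (1 + i) * (c 1 * c 0)]

/-- The forms of the map. -/
def mapForm (i : R) (c : Fin 3 → R) (j : Fin 3) : R :=
  c j * conicForm i c j * lineForm i c (j + 1) * lineForm i c (j + 2)

/-- The determinant of `(1, 1, 1)`, `(i, 1, -1)` and `g`. -/
def tauForm (i : R) (g : Fin 3 → R) : R := -2 * g 0 + (1 + i) * g 1 + (1 - i) * g 2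

/-- The determinant of `b`, `(i, 1, -1)` and `g`. -/
def sigmaForm (i : R) (b g : Fin 3 → R) : R :=
  b 0 * (g 2 + g 1) - b 1 * (i * g 2 + g 0) + b 2 * (i * g 1 - g 0)

/-- The quadratic condition on `v` for `v` to be mapped to a multiple of `g` by `v ↦ v * Q(v)`. -/
def incidenceForm (i : R) (g v : Fin 3 → R) : R :=
  (1 + i) * g 0 * (v 1 * v 2) + i * g 1 * (v 0 * v 2) + g 2 * (v 0 * v 1)

/-- The coefficients of the binary quintic whose roots parametrize the fibre over `q`. -/
def fibreCoeff (i : R) (q : Fin 3 → R) : Fin 6 → R :=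
  ![-q 1 ^ 3 + q 1 ^ 2 * q 2 + q 1 * q 2 ^ 2 - q 2 ^ 3,
    (3 - i) * (q 0 * q 1 ^ 2) - (2 + 2 * i) * (q 0 * q 1 * q 2) + (3 * i - 1) * (q 0 * q 2 ^ 2) +
      (4 * i - 2) * q 1 ^ 3 + (3 - 5 * i) * (q 1 ^ 2 * q 2) - 2 * i * (q 1 * q 2 ^ 2) +
      (3 * i - 1) * q 2 ^ 3,
    (2 * i - 4) * (q 0 ^ 2 * q 1) + (4 + 2 * i) * (q 0 ^ 2 * q 2) -
      (2 + 6 * i) * (q 0 * q 1 ^ 2) - (8 + 4 * i) * (q 0 * q 1 * q 2) +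
      (10 + 10 * i) * (q 0 * q 2 ^ 2) + (3 + 4 * i) * q 1 ^ 3 - (5 + 10 * i) * (q 1 ^ 2 * q 2) +
      (2 * i - 3) * (q 1 * q 2 ^ 2) + 5 * q 2 ^ 3,
    (2 - 2 * i) * q 0 ^ 3 - 4 * (q 0 ^ 2 * q 1) + (18 - 2 * i) * (q 0 ^ 2 * q 2) +
      (7 * i - 1) * (q 0 * q 1 ^ 2) + (6 - 18 * i) * (q 0 * q 1 * q 2) +
      (17 - 11 * i) * (q 0 * q 2 ^ 2) - (7 + i) * (q 1 ^ 2 * q 2) +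
      (2 + 2 * i) * (q 1 * q 2 ^ 2) - (1 + 7 * i) * q 2 ^ 3,
    (4 - 4 * i) * q 0 ^ 3 - 2 * i * (q 0 ^ 2 * q 1) + (20 - 14 * i) * (q 0 ^ 2 * q 2) -
      (4 + 32 * i) * (q 0 * q 1 * q 2) - (16 + 12 * i) * (q 0 * q 2 ^ 2) -
      2 * i * (q 1 * q 2 ^ 2) + (2 * i - 4) * q 2 ^ 3,
    (2 - 2 * i) * q 0 ^ 3 + (6 - 10 * i) * (q 0 ^ 2 * q 2) + (10 * i - 10) * (q 0 * q 2 ^ 2) +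
      (2 + 2 * i) * q 2 ^ 3]

lemma map_lineForm (φ : R →+* S) (i : R) (c : Fin 3 → R) (j : Fin 3) :
    φ (lineForm i c j) = lineForm (φ i) (fun k => φ (c k)) j := by
  simp [lineForm, map_ofNat]

lemma map_conicForm (φ : R →+* S) (i : R) (c : Fin 3 → R) (j : Fin 3) :
    φ (conicForm i c j) = conicForm (φ i) (fun k => φ (c k)) j := by
  fin_cases j <;> simp [conicForm, map_ofNat]

lemma map_mapForm (φ : R →+* S) (i : R) (c : Fin 3 → R) (j : Fin 3) :
    φ (mapForm i c j) = mapForm (φ i) (fun k => φ (c k)) j := by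
  simp only [mapForm, map_mul, map_lineForm, map_conicForm]

lemma map_fibreCoeff (φ : R →+* S) (i : R) (q : Fin 3 → R) (k : Fin 6) :
    φ (fibreCoeff i q k) = fibreCoeff (φ i) (fun k => φ (q k)) k := by
  fin_cases k <;> simp [fibreCoeff, map_ofNat]

/-- The vertex v'₁ lies on the fixed line v₁v₃. -/
lemma lineForm_relation (i : R) (c : Fin 3 → R) :
    (1 + i) * lineForm i c 0 + i * lineForm i c 1 + lineForm i c 2 = 0 := by
  simp only [lineForm]; ring

/-- The vertex v'₂ lies on v₂v₄; dividing coordinates by those of v₂ makes this line fixed as well.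
-/
lemma conicForm_relation (i : R) (c : Fin 3 → R) :
    (1 + i) * conicForm i c 0 + i * conicForm i c 1 + conicForm i c 2 = 0 := by
  simp [conicForm]
  ring

/-- The vertex v'₂ lies on v₃v₆: after the sign change (-1,1,1), the vector (i,1,-1) represents v₃
and c represents v₆. -/
lemma sigmaForm_mul_conicForm {i : R} (hi : i ^ 2 = -1) (c : Fin 3 → R) :
    sigmaForm i c (fun j => c j * conicForm i c j) = 0 := by
  simp [sigmaForm, conicForm]
  grind

/-- This is the elimination of the point from the fibre equations. On the line containing b, the
vector g = q b is linear and τ b - σ (1,1,1) is quadratic in b, so the incidence condition becomes a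
binary quintic with coefficients cubic in q. -/
lemma incidenceForm_eq_sum {i : R} (hi : i ^ 2 = -1) (q b : Fin 3 → R)
    (hb : (1 + i) * b 0 + i * b 1 + b 2 = 0) :
    incidenceForm i (fun j => q j * b j) (fun j => tauForm i (fun j => q j * b j) * b j -
      sigmaForm i b (fun j => q j * b j)) =
      ∑ k : Fin 6, fibreCoeff i q k * (b 0 ^ (k : ℕ) * b 1 ^ (5 - (k : ℕ))) := by
  obtain hb2 : b 2 = -(1 + i) * b 0 - i * b 1 := by linear_combination hb
  simp only [incidenceForm, tauForm, sigmaForm, hb2, Fin.sum_univ_succ, fibreCoeff]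
  simp
  -- The identity holds only modulo i² + 1; the cofactor is the quotient of the difference of both
  -- sides by i² + 1.
  linear_combination ((q 2 ^ 3 + (-1) * q 1 * q 2 ^ 2 + (-1) * q 1 ^ 2 * q 2 + q 1 ^ 3) * b 1 ^ 5 + ((q 2 ^ 3 +
      (-3) * q 1 ^ 2 * q 2 + 2 * q 1 ^ 3 + q 0 * q 2 ^ 2 + 2 * q 0 * q 1 * q 2 + (-3) * q 0 * q 1
      ^ 2) * b 1 ^ 4) * b 0 + (((-5) * q 2 ^ 3 + 3 * q 1 * q 2 ^ 2 + 5 * q 1 ^ 2 * q 2 + (-3) * q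
      1 ^ 3 + (-10) * q 0 * q 2 ^ 2 + 7 * q 0 * q 1 * q 2 + (-4) * q 0 ^ 2 * q 2 + 5 * q 0 ^ 2 * q
      1) * b 1 ^ 3) * b 0 ^ 2 + ((q 2 ^ 3 + (-2) * q 1 * q 2 ^ 2 + 7 * q 1 ^ 2 * q 2 + (-16) * q 0
      * q 2 ^ 2 + 2 * q 0 * q 1 * q 2 + 3 * q 0 * q 1 ^ 2 + (-18) * q 0 ^ 2 * q 2 + 6 * q 0 ^ 2 *
      q 1 + (-3) * q 0 ^ 3) * b 1 ^ 2) * b 0 ^ 3 + ((4 * q 2 ^ 3 + 10 * q 0 * q 2 ^ 2 + (-3) * q 0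
      * q 1 * q 2 + (-24) * q 0 ^ 2 * q 2 + q 0 ^ 2 * q 1 + (-6) * q 0 ^ 3) * b 1) * b 0 ^ 4 +
      ((-2) * q 2 ^ 3 + 15 * q 0 * q 2 ^ 2 + (-10) * q 0 ^ 2 * q 2 + (-3) * q 0 ^ 3) * b 0 ^ 5 +
      ((((-3) * q 2 ^ 3 + 2 * q 1 * q 2 ^ 2 + 5 * q 1 ^ 2 * q 2 + (-4) * q 1 ^ 3 + (-3) * q 0 * q
      2 ^ 2 + q 0 * q 1 * q 2) * b 1 ^ 4) * b 0 + (((-1) * q 1 * q 2 ^ 2 + 8 * q 1 ^ 2 * q 2 +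
      (-4) * q 1 ^ 3 + (-8) * q 0 * q 2 ^ 2 + 12 * q 0 * q 1 * q 2 + (-2) * q 0 ^ 2 * q 2 + 3 * q
      0 ^ 2 * q 1) * b 1 ^ 3) * b 0 ^ 2 + ((6 * q 2 ^ 3 + (-2) * q 1 * q 2 ^ 2 + 3 * q 1 ^ 2 * q 2
      + (-1) * q 0 * q 2 ^ 2 + 31 * q 0 * q 1 * q 2 + (-4) * q 0 ^ 2 * q 2 + 6 * q 0 ^ 2 * q 1 +
      (-1) * q 0 ^ 3) * b 1 ^ 2) * b 0 ^ 3 + ((q 1 * q 2 ^ 2 + 8 * q 0 * q 2 ^ 2 + 20 * q 0 * q 1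
      * q 2 + (-2) * q 0 ^ 2 * q 2 + 3 * q 0 ^ 2 * q 1 + (-2) * q 0 ^ 3) * b 1) * b 0 ^ 4 + ((-3)
      * q 2 ^ 3 + 4 * q 0 * q 2 ^ 2 + (-1) * q 0 ^ 3) * b 0 ^ 5) * i + (((-1) * q 2 ^ 3 + q 1 * q
      2 ^ 2 + q 1 ^ 2 * q 2 + (-1) * q 1 ^ 3) * b 1 ^ 5 + (((-1) * q 2 ^ 3 + 2 * q 1 * q 2 ^ 2 +
      (-2) * q 1 ^ 3 + (-1) * q 0 * q 1 * q 2) * b 1 ^ 4) * b 0 + ((2 * q 2 ^ 3 + q 1 * q 2 ^ 2 +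
      (-5) * q 1 ^ 2 * q 2 + (-1) * q 1 ^ 3 + 2 * q 0 * q 2 ^ 2 + 6 * q 0 * q 1 * q 2 + 2 * q 0 ^
      2 * q 2 + q 0 ^ 2 * q 1) * b 1 ^ 3) * b 0 ^ 2 + ((2 * q 2 ^ 3 + (-2) * q 1 * q 2 ^ 2 + (-4)
      * q 1 ^ 2 * q 2 + 2 * q 0 * q 2 ^ 2 + 15 * q 0 * q 1 * q 2 + 7 * q 0 ^ 2 * q 2 + 2 * q 0 ^ 2
      * q 1) * b 1 ^ 2) * b 0 ^ 3 + (((-1) * q 2 ^ 3 + (-2) * q 1 * q 2 ^ 2 + (-2) * q 0 * q 2 ^ 2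
      + 8 * q 0 * q 1 * q 2 + 8 * q 0 ^ 2 * q 2 + q 0 ^ 2 * q 1) * b 1) * b 0 ^ 4 + ((-1) * q 2 ^
      3 + (-2) * q 0 * q 2 ^ 2 + 3 * q 0 ^ 2 * q 2) * b 0 ^ 5) * i ^ 2 + ((q 1 * q 2 ^ 2 + (-1) *
      q 1 ^ 2 * q 2) * b 1 ^ 5 + ((4 * q 1 * q 2 ^ 2 + (-6) * q 1 ^ 2 * q 2 + q 0 * q 2 ^ 2 + (-1)
      * q 0 * q 1 * q 2) * b 1 ^ 4) * b 0 + ((2 * q 1 * q 2 ^ 2 + (-9) * q 1 ^ 2 * q 2 + 2 * q 0 *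
      q 2 ^ 2 + (-4) * q 0 * q 1 * q 2 + q 0 ^ 2 * q 2) * b 1 ^ 3) * b 0 ^ 2 + (((-4) * q 1 * q 2
      ^ 2 + (-4) * q 1 ^ 2 * q 2 + (-5) * q 0 * q 1 * q 2 + 3 * q 0 ^ 2 * q 2) * b 1 ^ 2) * b 0 ^
      3 + (((-3) * q 1 * q 2 ^ 2 + (-2) * q 0 * q 2 ^ 2 + (-2) * q 0 * q 1 * q 2 + 3 * q 0 ^ 2 * q
      2) * b 1) * b 0 ^ 4 + ((-1) * q 0 * q 2 ^ 2 + q 0 ^ 2 * q 2) * b 0 ^ 5) * i ^ 3 + ((q 1 * q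
      2 ^ 2 + (-1) * q 1 ^ 2 * q 2) * b 1 ^ 5 + ((2 * q 1 * q 2 ^ 2 + (-3) * q 1 ^ 2 * q 2 + (-1)
      * q 0 * q 1 * q 2) * b 1 ^ 4) * b 0 + (((-3) * q 1 ^ 2 * q 2 + (-3) * q 0 * q 1 * q 2) * b 1
      ^ 3) * b 0 ^ 2 + (((-2) * q 1 * q 2 ^ 2 + (-1) * q 1 ^ 2 * q 2 + (-3) * q 0 * q 1 * q 2) * b
      1 ^ 2) * b 0 ^ 3 + (((-1) * q 1 * q 2 ^ 2 + (-1) * q 0 * q 1 * q 2) * b 1) * b 0 ^ 4) * i ^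
      4) * hi

end Forms

/-! ### Points over extension fields -/

lemma exists_linear_relation {K : Type} [Field K] [Algebra ℂ K] {m : ℕ} {x y : K}
    {p : Polynomial ℂ} (hp : p ≠ 0) (hd : p.natDegree ≤ m) (h : binaryForm m x y p = 0) :
    ∃ t : ℂ × ℂ, t ≠ 0 ∧ t.1 • x + t.2 • y = 0 := by
  obtain ⟨c, s, hc, -, hs, hprod⟩ := exists_binaryForm_eq_prod m p hp hd
  rw [hprod, smul_eq_zero_iff_right hc, Multiset.prod_eq_zero_iff, Multiset.mem_map] at h
  obtain ⟨t, ht, h⟩ := h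
  exact ⟨t, hs t ht, h⟩

lemma exists_linear_relation_of_quadratic {K : Type} [Field K] [Algebra ℂ K] {x y : K}
    (a b c : ℂ) (h0 : a ≠ 0 ∨ b ≠ 0 ∨ c ≠ 0)
    (h : algebraMap ℂ K a * x ^ 2 + algebraMap ℂ K b * (x * y) + algebraMap ℂ K c * y ^ 2 = 0) :
    ∃ t : ℂ × ℂ, t ≠ 0 ∧ t.1 • x + t.2 • y = 0 := by
  have hp : Polynomial.C a * Polynomial.X ^ 2 + Polynomial.C b * Polynomial.X +
      Polynomial.C c ≠ 0 := by
    intro hp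
    have h2 := congrArg (fun p => p.coeff 2) hp
    have h1 := congrArg (fun p => p.coeff 1) hp
    have h0 := congrArg (fun p => p.coeff 0) hp
    simp [Polynomial.coeff_X, Polynomial.coeff_C] at h0 h1 h2
    tauto
  refine exists_linear_relation (m := 2) hp Polynomial.natDegree_quadratic_le ?_
  rw [binaryForm_apply, Finset.sum_range_succ, Finset.sum_range_succ, Finset.sum_range_one]
  simp [Polynomial.coeff_X, Polynomial.coeff_C, Algebra.smul_def]
  linear_combination h

/-- The vector `v` is proportional to a vector with entries in `ℂ`. -/
def IsConstant {K : Type} [Field K] [Algebra ℂ K] (v : Fin 3 → K) : Prop :=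
  ∃ c : Fin 3 → ℂ, c ≠ 0 ∧ ∃ r : K, ∀ j, v j = algebraMap ℂ K (c j) * r

/-- Two independent linear relations over ℂ determine v up to a factor, as the cross product of
their coefficient vectors. -/
lemma isConstant_of_relations {K : Type} [Field K] [Algebra ℂ K] {v : Fin 3 → K}
    (l m : Fin 3 → ℂ) (hl : ∑ j, algebraMap ℂ K (l j) * v j = 0)
    (hm : ∑ j, algebraMap ℂ K (m j) * v j = 0)
    (hlm : ∃ j, l (j + 1) * m (j + 2) - l (j + 2) * m (j + 1) ≠ 0) : IsConstant v := by
  obtain ⟨k, hk⟩ := hlm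
  rw [Fin.sum_univ_three] at hl hm
  set c : Fin 3 → ℂ := fun j => l (j + 1) * m (j + 2) - l (j + 2) * m (j + 1) with hc
  have hk' : algebraMap ℂ K (c k) ≠ 0 := by simpa using hk
  refine ⟨c, fun h => hk (congrFun h k), (algebraMap ℂ K (c k))⁻¹ * v k, fun j => ?_⟩
  rw [← mul_assoc, mul_comm (algebraMap ℂ K (c j)), mul_assoc, eq_inv_mul_iff_mul_eq₀ hk']
  fin_cases k <;> fin_cases j <;> simp only [hc, map_sub, map_mul] <;> simp <;> grind

/-- The diagonal coordinates of a point of a plane curve in general position on it. -/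
lemma exists_genericPoint {H : Poly} (hH : Prime H) :
    ∃ (K : Type) (_ : Field K) (_ : Algebra ℂ K) (φ : Poly →ₐ[ℂ] K),
      (∀ F, φ F = 0 ↔ H ∣ F) ∧ ¬ IsConstant fun j => φ (coord j) := by
  have : (Ideal.span {H}).IsPrime := (Ideal.span_singleton_prime hH.ne_zero).mpr hH
  set A := Poly ⧸ Ideal.span {H}
  let φ : Poly →ₐ[ℂ] FractionRing A :=
    (IsScalarTower.toAlgHom ℂ A (FractionRing A)).comp (Ideal.Quotient.mkₐ ℂ (Ideal.span {H}))
  have hφ : ∀ F, φ F = 0 ↔ H ∣ F := fun F => by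
    rw [← Ideal.mem_span_singleton, ← Ideal.Quotient.eq_zero_iff_mem]
    exact map_eq_zero_iff _ (FaithfulSMul.algebraMap_injective A (FractionRing A))
  refine ⟨FractionRing A, inferInstance, inferInstance, φ, hφ, ?_⟩
  rintro ⟨c, hc, r, hr⟩
  simp only at hr
  have hdvd : ∀ j k, H ∣ C (c j) * coord k - C (c k) * coord j := fun j k => by
    rw [← hφ, map_sub, map_mul, map_mul, hr j, hr k, ← algebraMap_eq, AlgHom.commutes,
      AlgHom.commutes]
    ring
  obtain ⟨k, hk⟩ := Function.ne_iff.mp hc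
  rw [Pi.zero_apply] at hk
  have h1 : k + 1 ≠ k := by fin_cases k <;> decide
  have h2 : k + 2 ≠ k := by fin_cases k <;> decide
  have h12 : k + 1 ≠ k + 2 := by fin_cases k <;> decide
  have hhom : ∀ a b, (C (c a) * coord b - C (c b) * coord a).IsHomogeneous 1 := fun a b =>
    ((coord_isHomogeneous _).C_mul _).sub ((coord_isHomogeneous _).C_mul _)
  have hne : ∀ a, a ≠ k → eval (center a) (C (c k) * coord a - C (c a) * coord k) ≠ 0 := by
    intro a ha
    simp [eval_coord_center_ne ha.symm, hk, eval_coord_center_self]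
  -- A constant generic point would put H = 0 into two lines, but these are distinct: one of them
  -- contains the center k + 2 and the other does not.
  have hass := hH.irreducible.associated_of_dvd (irreducible_of_isHomogeneous_one (hhom k (k + 1))
    (fun h => hne _ h1 (by rw [h, map_zero]))) (hdvd k (k + 1))
  obtain ⟨s, hs⟩ := hass.symm.dvd.trans (hdvd k (k + 2))
  have h3 := congrArg (eval (center (k + 2))) hs
  rw [map_mul] at h3
  refine hne (k + 2) h2 (h3.trans ?_)
  simp [eval_coord_center_ne h12, eval_coord_center_ne h2.symm]

section Field

variable {K : Type} [Field K] [Algebra ℂ K]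

local notation "𝐢" => algebraMap ℂ K Complex.I

lemma algebraMap_I_sq : 𝐢 ^ 2 = -1 := by
  rw [← map_pow, Complex.I_sq]; simp

lemma two_ne_zero_of_algebra : (2 : K) ≠ 0 := by
  rw [← map_ofNat (algebraMap ℂ K) 2, Ne, map_eq_zero]
  exact two_ne_zero

lemma one_add_I_ne_zero : 1 + 𝐢 ≠ 0 := by
  intro h
  apply two_ne_zero_of_algebra (K := K)
  linear_combination (1 - 𝐢) * h + algebraMap_I_sq (K := K)

/-- The base points of v ↦ v Q(v) are the three coordinate points and (i,1,-1). When no coordinate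
vanishes, the differences of the conics factor: Q₁ - Q₂ = 2(1+i) v₀ (v₁ + v₂), and similarly for Q₁
- Q₀. -/
lemma eq_zero_or_eq_zero_of_mul_conicForm_eq_zero {F : Type*} [Field F] {i : F}
    (hi : i ^ 2 = -1) (h2 : (2 : F) ≠ 0) {v : Fin 3 → F} (h : ∀ j, v j * conicForm i v j = 0) :
    (v 0 = 0 ∧ v 1 = 0) ∨ (v 0 = 0 ∧ v 2 = 0) ∨ (v 1 = 0 ∧ v 2 = 0) ∨
      (v 1 + v 2 = 0 ∧ v 0 - i * v 1 = 0) := by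
  have i0 : i ≠ 0 := by
    rintro rfl
    simp at hi
  have h1i : 1 + i ≠ 0 := fun h => h2 (by linear_combination (1 - i) * h + hi)
  have hi1 : 1 - i ≠ 0 := fun h => h2 (by linear_combination (1 + i) * h + hi)
  have e0 := h 0
  have e1 := h 1
  have e2 := h 2
  have hQ0 : conicForm i v 0 = v 1 * v 0 - i * (v 2 * v 0) + (i - 1) * (v 2 * v 1) := by
    simp [conicForm]; ring
  have hQ1 : conicForm i v 1 = v 1 * v 0 + (2 + i) * (v 2 * v 0) + (1 - i) * (v 2 * v 1) := by
    simp [conicForm]; ring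
  have hQ2 : conicForm i v 2 = -(1 + 2 * i) * (v 1 * v 0) - i * (v 2 * v 0) +
      (1 - i) * (v 2 * v 1) := by
    simp [conicForm]; ring
  by_cases hv0 : v 0 = 0
  · by_cases hv1 : v 1 = 0
    · exact Or.inl ⟨hv0, hv1⟩
    · have := (mul_eq_zero.mp e1).resolve_left hv1
      rw [hQ1, hv0] at this
      simp only [mul_zero, zero_add, add_zero, mul_eq_zero, hi1, hv1, false_or, or_false] at this
      exact Or.inr (Or.inl ⟨hv0, this⟩)
  by_cases hv1 : v 1 = 0
  · have := (mul_eq_zero.mp e0).resolve_left hv0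
    rw [hQ0, hv1] at this
    simp only [mul_zero, zero_mul, zero_sub, add_zero, neg_eq_zero, mul_eq_zero, i0, hv0, false_or,
      or_false] at this
    exact Or.inr (Or.inr (Or.inl ⟨hv1, this⟩))
  by_cases hv2 : v 2 = 0
  · have := (mul_eq_zero.mp e0).resolve_left hv0
    rw [hQ0, hv2] at this
    simp only [mul_zero, zero_mul, sub_zero, add_zero, mul_eq_zero, hv1, hv0, or_false] at this
  replace e0 := (mul_eq_zero.mp e0).resolve_left hv0
  replace e1 := (mul_eq_zero.mp e1).resolve_left hv1
  replace e2 := (mul_eq_zero.mp e2).resolve_left hv2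
  refine Or.inr (Or.inr (Or.inr ⟨?_, ?_⟩))
  · have : (2 * (1 + i) * v 0) * (v 1 + v 2) = 0 := by linear_combination e1 - e2 - hQ1 + hQ2
    exact (mul_eq_zero.mp this).resolve_left (mul_ne_zero (mul_ne_zero h2 h1i) hv0)
  · have : (2 * (1 + i) * v 2) * (v 0 - i * v 1) = 0 := by
      linear_combination e1 - e0 - hQ1 + hQ0 - 2 * v 2 * v 1 * hi
    exact (mul_eq_zero.mp this).resolve_left (mul_ne_zero (mul_ne_zero h2 h1i) hv2)

/-- The map is undefined only at finitely many points. -/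
lemma isConstant_of_mapForm_eq_zero {v : Fin 3 → K} (h : ∀ j, mapForm 𝐢 v j = 0) :
    IsConstant v := by
  have hi := algebraMap_I_sq (K := K)
  have h2 := two_ne_zero_of_algebra (K := K)
  have h1i := one_add_I_ne_zero (K := K)
  have hrel := lineForm_relation 𝐢 v
  have I0 := Complex.I_ne_zero
  have i0 : 𝐢 ≠ 0 := by simp
  have h1I : (1 + Complex.I) ≠ 0 := one_add_I_ne_zero (K := ℂ)
  have hi1 : 1 - 𝐢 ≠ 0 := fun h => h2 (by linear_combination (1 + 𝐢) * h + hi)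
  have lin : ∀ a b c a' b' c' : ℂ,
      algebraMap ℂ K a * v 0 + algebraMap ℂ K b * v 1 + algebraMap ℂ K c * v 2 = 0 →
      algebraMap ℂ K a' * v 0 + algebraMap ℂ K b' * v 1 + algebraMap ℂ K c' * v 2 = 0 →
      (b * c' - c * b' ≠ 0 ∨ c * a' - a * c' ≠ 0 ∨ a * b' - b * a' ≠ 0) → IsConstant v := by
    intro a b c a' b' c' e1 e2 hne
    refine isConstant_of_relations ![a, b, c] ![a', b', c'] ?_ ?_ ?_
    · rw [Fin.sum_univ_three]; simpa using e1
    · rw [Fin.sum_univ_three]; simpa using e2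
    · rcases hne with h | h | h
      · exact ⟨0, h⟩
      · exact ⟨1, h⟩
      · exact ⟨2, h⟩
  have e0 : v 0 * conicForm 𝐢 v 0 * lineForm 𝐢 v 1 * lineForm 𝐢 v 2 = 0 := h 0
  have e1 : v 1 * conicForm 𝐢 v 1 * lineForm 𝐢 v 2 * lineForm 𝐢 v 0 = 0 := h 1
  have e2 : v 2 * conicForm 𝐢 v 2 * lineForm 𝐢 v 0 * lineForm 𝐢 v 1 = 0 := h 2
  have hQ0 : conicForm 𝐢 v 0 = v 1 * v 0 - 𝐢 * (v 2 * v 0) + (𝐢 - 1) * (v 2 * v 1) := by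
    simp [conicForm]; ring
  have hQ1 : conicForm 𝐢 v 1 = v 1 * v 0 + (2 + 𝐢) * (v 2 * v 0) + (1 - 𝐢) * (v 2 * v 1) := by
    simp [conicForm]; ring
  have hQ2 : conicForm 𝐢 v 2 = -(1 + 2 * 𝐢) * (v 1 * v 0) - 𝐢 * (v 2 * v 0) +
      (1 - 𝐢) * (v 2 * v 1) := by
    simp [conicForm]; ring
  have z01 : v 0 = 0 → v 1 = 0 → IsConstant v := fun a b =>
    lin 1 0 0 0 1 0 (by simp [a]) (by simp [b]) (by norm_num)
  have z02 : v 0 = 0 → v 2 = 0 → IsConstant v := fun a b =>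
    lin 1 0 0 0 0 1 (by simp [a]) (by simp [b]) (by norm_num)
  have z12 : v 1 = 0 → v 2 = 0 → IsConstant v := fun a b =>
    lin 0 1 0 0 0 1 (by simp [a]) (by simp [b]) (by norm_num)
  have b0 : lineForm 𝐢 v 0 = (1 + 𝐢) * v 0 - 𝐢 * v 1 - v 2 := by simp only [lineForm]; ring
  have b1 : lineForm 𝐢 v 1 = -(1 + 𝐢) * v 0 + (2 + 𝐢) * v 1 - v 2 := by
    simp only [lineForm]; ring
  have b2 : lineForm 𝐢 v 2 = -(1 + 𝐢) * v 0 - 𝐢 * v 1 + (1 + 2 * 𝐢) * v 2 := by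
    simp only [lineForm]; ring
  -- In every case v satisfies two independent linear relations over ℂ. If two of the L_j vanish,
  -- these are the relations; if exactly one vanishes, the surviving condition v_j Q_j = 0,
  -- restricted to that line, splits into linear ones. If none vanishes, v is a base point of v ↦ v
  -- Q(v).
  by_cases hB0 : lineForm 𝐢 v 0 = 0
  · have r0 : algebraMap ℂ K (1 + Complex.I) * v 0 + algebraMap ℂ K (-Complex.I) * v 1 +
        algebraMap ℂ K (-1) * v 2 = 0 := by
      simp only [map_add, map_neg, map_one]; linear_combination hB0 - b0
    by_cases hB1 : lineForm 𝐢 v 1 = 0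
    · refine lin _ _ _ (-(1 + Complex.I)) (2 + Complex.I) (-1) r0 ?_ (Or.inl fun h => h1I ?_)
      · simp only [map_add, map_neg, map_one, map_ofNat]; linear_combination hB1 - b1
      · linear_combination h / 2
    have hB2 : lineForm 𝐢 v 2 ≠ 0 := fun hB2 => by
      rw [hB0, hB2, mul_zero, zero_add, add_zero] at hrel
      exact (mul_ne_zero i0 hB1) hrel
    rcases mul_eq_zero.mp ((mul_eq_zero.mp ((mul_eq_zero.mp e0).resolve_right hB2)).resolve_right
      hB1) with hv | hq
    · exact lin _ _ _ 1 0 0 r0 (by simp [hv]) (by norm_num)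
    · have hv2 : v 2 = (1 + 𝐢) * v 0 - 𝐢 * v 1 := by linear_combination b0 - hB0
      have : (1 - 𝐢) * ((v 0 - 𝐢 * v 1) * (v 0 - v 1)) = 0 := by
        rw [hQ0, hv2] at hq
        rw [← hq]
        grind
      rcases mul_eq_zero.mp ((mul_eq_zero.mp this).resolve_left hi1) with hv | hv
      · refine lin _ _ _ 1 (-Complex.I) 0 r0 ?_ (Or.inr (Or.inl ?_))
        · simp only [map_one, map_neg, map_zero]; linear_combination hv
        · norm_num
      · refine lin _ _ _ 1 (-1) 0 r0 ?_ (Or.inr (Or.inl ?_))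
        · simp only [map_one, map_neg, map_zero]; linear_combination hv
        · norm_num
  by_cases hB1 : lineForm 𝐢 v 1 = 0
  · have r1 : algebraMap ℂ K (-(1 + Complex.I)) * v 0 + algebraMap ℂ K (2 + Complex.I) * v 1 +
        algebraMap ℂ K (-1) * v 2 = 0 := by
      simp only [map_add, map_neg, map_one, map_ofNat]; linear_combination hB1 - b1
    have hB2 : lineForm 𝐢 v 2 ≠ 0 := fun hB2 => by
      rw [hB1, hB2, mul_zero, add_zero, add_zero] at hrel
      exact (mul_ne_zero h1i hB0) hrel
    rcases mul_eq_zero.mp ((mul_eq_zero.mp ((mul_eq_zero.mp e1).resolve_right hB0)).resolve_right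
      hB2) with hv | hq
    · exact lin _ _ _ 0 1 0 r1 (by simp [hv]) (by norm_num)
    · have hv2 : v 2 = -(1 + 𝐢) * v 0 + (2 + 𝐢) * v 1 := by linear_combination b1 - hB1
      obtain ⟨t, ht, hv⟩ := exists_linear_relation_of_quadratic (x := v 0) (y := v 1)
        (-(1 + 3 * Complex.I)) (2 + 4 * Complex.I) (3 - Complex.I)
        (Or.inr (Or.inl fun h => by simpa using congrArg Complex.re h))
        (by
          rw [hQ1, hv2] at hq
          simp only [map_add, map_neg, map_mul, map_sub, map_one, map_ofNat]
          rw [← hq]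
          grind)
      refine lin _ _ _ t.1 t.2 0 r1 (by simpa [Algebra.smul_def] using hv) ?_
      by_contra! hne
      exact ht (Prod.ext (by simpa using hne.2.1) (by simpa using hne.1))
  by_cases hB2 : lineForm 𝐢 v 2 = 0
  · have r2 : algebraMap ℂ K (-(1 + Complex.I)) * v 0 + algebraMap ℂ K (-Complex.I) * v 1 +
        algebraMap ℂ K (1 + 2 * Complex.I) * v 2 = 0 := by
      simp only [map_add, map_neg, map_one, map_ofNat, map_mul]; linear_combination hB2 - b2
    rcases mul_eq_zero.mp ((mul_eq_zero.mp ((mul_eq_zero.mp e2).resolve_right hB1)).resolve_right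
      hB0) with hv | hq
    · exact lin _ _ _ 0 0 1 r2 (by simp [hv]) (by simp)
    · have hv2 : (1 + 2 * 𝐢) * v 2 = (1 + 𝐢) * v 0 + 𝐢 * v 1 := by linear_combination hB2 - b2
      obtain ⟨t, ht, hv⟩ := exists_linear_relation_of_quadratic (x := v 0) (y := v 1)
        (1 - Complex.I) (6 - 4 * Complex.I) (1 + Complex.I)
        (Or.inr (Or.inr h1I))
        (by
          rw [hQ2] at hq
          simp only [map_add, map_mul, map_sub, map_one, map_ofNat]
          linear_combination (1 + 2 * 𝐢) * hq - (-𝐢 * v 0 + (1 - 𝐢) * v 1) * hv2 +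
            (6 * v 0 * v 1 + v 0 ^ 2 + v 1 ^ 2) * hi)
      refine lin _ _ _ t.1 t.2 0 r2 (by simpa [Algebra.smul_def] using hv) ?_
      by_contra! hne
      have h5 : (1 + 2 * Complex.I) ≠ 0 := fun h => by simpa using congrArg Complex.re h
      simp only [mul_zero, zero_sub, sub_zero, neg_eq_zero, mul_eq_zero, h5, false_or] at hne
      exact ht (Prod.ext hne.2.1 hne.1)
  replace e0 := (mul_eq_zero.mp ((mul_eq_zero.mp e0).resolve_right hB2)).resolve_right hB1
  replace e1 := (mul_eq_zero.mp ((mul_eq_zero.mp e1).resolve_right hB0)).resolve_right hB2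
  replace e2 := (mul_eq_zero.mp ((mul_eq_zero.mp e2).resolve_right hB1)).resolve_right hB0
  rcases eq_zero_or_eq_zero_of_mul_conicForm_eq_zero hi h2
      (fun j => by fin_cases j <;> assumption) with h | h | h | ⟨f1, f2⟩
  · exact z01 h.1 h.2
  · exact z02 h.1 h.2
  · exact z12 h.1 h.2
  refine lin 0 1 1 1 (-Complex.I) 0 ?_ ?_ (Or.inl (by simp))
  · simp only [map_one, map_zero]; linear_combination f1
  · simp only [map_one, map_zero, map_neg]; linear_combination f2

end Field

/-! ### Fibres -/

/-- The polynomial whose roots parametrize the fibre over `q`. -/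
noncomputable def fibrePoly {R : Type*} [CommRing R] (i : R) (q : Fin 3 → R) : Polynomial R :=
  ∑ k : Fin 6, Polynomial.C (fibreCoeff i q k) * Polynomial.X ^ (k : ℕ)

lemma coeff_fibrePoly {R : Type*} [CommRing R] (i : R) (q : Fin 3 → R) (k : Fin 6) :
    (fibrePoly i q).coeff k = fibreCoeff i q k := by
  rw [fibrePoly, Polynomial.finsetSum_coeff, Finset.sum_eq_single k]
  · simp
  · intro j _ hj
    rw [Polynomial.coeff_C_mul_X_pow, if_neg (fun h => hj (Fin.ext h.symm))]
  · simp

lemma natDegree_fibrePoly_le {R : Type*} [CommRing R] (i : R) (q : Fin 3 → R) :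
    (fibrePoly i q).natDegree ≤ 5 :=
  Polynomial.natDegree_sum_le_of_forall_le _ _ fun k _ =>
    (Polynomial.natDegree_C_mul_X_pow_le _ _).trans (by omega)

/-- Non-contraction needs a nontrivial quintic for every q, not only for a general one. The lowest
coefficient is -(q₁ - q₂)²(q₁ + q₂), and on either of its components the other coefficients force q
= 0. -/
lemma fibrePoly_ne_zero {q : Fin 3 → ℂ} (hq : q ≠ 0) : fibrePoly Complex.I q ≠ 0 := by
  intro h
  have hc : ∀ k, fibreCoeff Complex.I q k = 0 := fun k => by
    rw [← coeff_fibrePoly, h, Polynomial.coeff_zero]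
  have hi := Complex.I_sq
  have h1i : (1 + Complex.I) ≠ 0 := one_add_I_ne_zero (K := ℂ)
  have h1i' : (1 - Complex.I) ≠ 0 := fun h => by simpa using congrArg Complex.re h
  have c0 := hc 0
  have c1 := hc 1
  have c2 := hc 2
  have c3 := hc 3
  have c5 := hc 5
  simp only [fibreCoeff, Matrix.cons_val] at c0 c1 c2 c3 c5
  have hzero : q 2 = 0 → q 1 = 0 → False := fun h2 h1 => by
    rw [h2] at c5
    have : (2 * (1 - Complex.I)) * q 0 ^ 3 = 0 := by linear_combination c5
    have h0 : q 0 = 0 := by simpa [h1i'] using this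
    exact hq (funext fun j => by fin_cases j <;> assumption)
  have hfac : (q 1 - q 2) ^ 2 * (q 1 + q 2) = 0 := by linear_combination -c0
  rcases mul_eq_zero.mp hfac with h12 | h12
  · have h12 : q 1 = q 2 := sub_eq_zero.mp (pow_eq_zero_iff two_ne_zero |>.mp h12)
    rw [h12] at c2 c3
    have e2 : (4 * Complex.I) * (q 2 * ((q 0 - q 2) * (q 0 + q 2))) = 0 := by
      linear_combination c2
    have e2' := (mul_eq_zero.mp e2).resolve_left (by simp)
    rcases mul_eq_zero.mp e2' with h2 | h2
    · exact hzero h2 (h12.trans h2)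
    rcases mul_eq_zero.mp h2 with h0 | h0
    · have h0 : q 0 = q 2 := sub_eq_zero.mp h0
      rw [h0] at c3
      have : (32 * (1 - Complex.I)) * q 2 ^ 3 = 0 := by linear_combination c3
      have h2 : q 2 = 0 := by simpa [h1i'] using this
      exact hzero h2 (h12.trans h2)
    · have h0 : q 0 = -q 2 := by linear_combination h0
      rw [h0] at c3
      have : (16 * (1 - Complex.I)) * q 2 ^ 3 = 0 := by linear_combination -c3
      have h2 : q 2 = 0 := by simpa [h1i'] using this
      exact hzero h2 (h12.trans h2)
  · have h12 : q 1 = -q 2 := by linear_combination h12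
    rw [h12] at c1 c2
    have e1 : (4 * (1 + Complex.I)) * (q 2 ^ 2 * (q 0 - Complex.I * q 2)) = 0 := by
      linear_combination c1 - 4 * q 2 ^ 3 * hi
    have e1' := (mul_eq_zero.mp e1).resolve_left (mul_ne_zero (by norm_num) h1i)
    rcases mul_eq_zero.mp e1' with h2 | h2
    · have h2 : q 2 = 0 := (pow_eq_zero_iff two_ne_zero).mp h2
      exact hzero h2 (by rw [h12, h2, neg_zero])
    · have h0 : q 0 = Complex.I * q 2 := by linear_combination h2
      rw [h0] at c2
      have : (-(16 : ℂ)) * q 2 ^ 3 = 0 := by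
        linear_combination c2 - 16 * q 2 ^ 3 * hi
      have h2 : q 2 = 0 := by simpa using this
      exact hzero h2 (by rw [h12, h2, neg_zero])

section Field

variable {K : Type} [Field K] [Algebra ℂ K]

local notation "𝐢" => algebraMap ℂ K Complex.I

/-- With s = (1+i) v₀ + i v₁ + v₂ one has 2(1+i) v = L(v) + s (1,1,1). So v is constant up to a
factor once L(v) is a constant vector times β and s is proportional to β over ℂ. -/
lemma isConstant_of_lineForm_eq {v : Fin 3 → K} {b : Fin 3 → ℂ} {β : K} (hβ : β ≠ 0)
    (hb : ∀ j, lineForm 𝐢 v j = algebraMap ℂ K (b j) * β) (hb0 : b ≠ 0) {x y : ℂ}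
    (hxy : x ≠ 0 ∨ y ≠ 0) (h : algebraMap ℂ K x * ((1 + 𝐢) * v 0 + 𝐢 * v 1 + v 2) +
      algebraMap ℂ K y * β = 0) : IsConstant v := by
  have h2 := two_ne_zero_of_algebra (K := K)
  have h1i := one_add_I_ne_zero (K := K)
  have hx : x ≠ 0 := by
    rintro rfl
    simp [hβ] at h
    simp [h] at hxy
  have hx' : algebraMap ℂ K x ≠ 0 := by simpa using hx
  refine ⟨fun j => x * b j - y, fun hc => hb0 ?_, β / (algebraMap ℂ K x * (2 * (1 + 𝐢))),
    fun j => ?_⟩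
  · have hrel := lineForm_relation 𝐢 v
    simp only [hb] at hrel
    have hrel' : (1 + Complex.I) * b 0 + Complex.I * b 1 + b 2 = 0 := by
      refine (algebraMap ℂ K).injective ?_
      simp only [map_add, map_mul, map_one, map_zero]
      refine eq_zero_of_ne_zero_of_mul_right_eq_zero hβ ?_
      linear_combination hrel
    have h0 : x * b 0 = y := sub_eq_zero.mp (congrFun hc 0)
    have h1 : x * b 1 = y := sub_eq_zero.mp (congrFun hc 1)
    have h2 : x * b 2 = y := sub_eq_zero.mp (congrFun hc 2)
    -- The vector (1,1,1) is not on the line that contains b, so x b = y (1,1,1) is impossible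
    -- unless y = 0.
    have hy : (2 * (1 + Complex.I)) * y = 0 := by
      linear_combination x * hrel' - (1 + Complex.I) * h0 - Complex.I * h1 - h2
    have hy : y = 0 := (mul_eq_zero.mp hy).resolve_left
      (mul_ne_zero two_ne_zero (one_add_I_ne_zero (K := ℂ)))
    rw [hy] at h0 h1 h2
    funext j
    fin_cases j
    · exact (mul_eq_zero.mp h0).resolve_left hx
    · exact (mul_eq_zero.mp h1).resolve_left hx
    · exact (mul_eq_zero.mp h2).resolve_left hx
  · have := hb j
    rw [lineForm] at this
    simp only [map_sub, map_mul]
    field_simp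
    linear_combination algebraMap ℂ K x * this + h

lemma sum_fibreCoeff_mul_eq_binaryForm (q : Fin 3 → ℂ) (x y : K) :
    ∑ k : Fin 6, fibreCoeff 𝐢 (fun j => algebraMap ℂ K (q j)) k *
      (x ^ (k : ℕ) * y ^ (5 - (k : ℕ))) = binaryForm 5 x y (fibrePoly Complex.I q) := by
  rw [binaryForm_apply, Finset.sum_range]
  refine Finset.sum_congr rfl fun k _ => ?_
  rw [coeff_fibrePoly, Algebra.smul_def, map_fibreCoeff]

/-- The relations between a point `v`, the vertex `b` and the point `g = q * b` when `v` is mapped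
to `q`. -/
lemma relations_of_fibre {F : Type*} [Field F] {i : F} (hi : i ^ 2 = -1) {v q : Fin 3 → F}
    (hb : ∀ j, lineForm i v j ≠ 0) (hM : ∃ j, mapForm i v j ≠ 0)
    (h : ∀ j k, q j * mapForm i v k = q k * mapForm i v j) :
    incidenceForm i (fun j => q j * lineForm i v j) v = 0 ∧
      sigmaForm i (lineForm i v) (fun j => q j * lineForm i v j) +
        ((1 + i) * v 0 + i * v 1 + v 2) * tauForm i (fun j => q j * lineForm i v j) = 0 ∧
      ∑ k : Fin 6, fibreCoeff i q k *
        (lineForm i v 0 ^ (k : ℕ) * lineForm i v 1 ^ (5 - (k : ℕ))) = 0 := by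
  set b := lineForm i v with hbdef
  set g : Fin 3 → F := fun j => q j * b j with hg
  set A : Fin 3 → F := fun j => v j * conicForm i v j with hA
  -- Multiplying by b j completes the product of all three linear forms, so that f(v) ~ q turns into
  -- v Q(v) ~ q b.
  have hM' : ∀ j, mapForm i v j * b j = A j * (b 0 * b 1 * b 2) := fun j => by
    fin_cases j <;> simp [mapForm, hA] <;> ring
  have hB : b 0 * b 1 * b 2 ≠ 0 := mul_ne_zero (mul_ne_zero (hb 0) (hb 1)) (hb 2)
  have hgA : ∀ j k, g j * A k = g k * A j := fun j k => by
    refine mul_right_cancel₀ hB ?_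
    have ek := hM' k
    have ej := hM' j
    simp only [hg]
    linear_combination b j * b k * h j k - q j * b j * ek + q k * b k * ej
  obtain ⟨l, hl⟩ : ∃ l, A l ≠ 0 := by
    obtain ⟨l, hl⟩ := hM
    exact ⟨l, fun h0 => hl ((mul_eq_zero.mp ((hM' l).trans (by rw [h0, zero_mul]))).resolve_right
      (hb l))⟩
  have hinc : incidenceForm i g v = 0 := by
    refine eq_zero_of_ne_zero_of_mul_right_eq_zero hl ?_
    have e0 := hgA 0 l
    have e1 := hgA 1 l
    have e2 := hgA 2 l
    have hrel := conicForm_relation i v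
    simp only [incidenceForm]
    rw [show ((1 + i) * g 0 * (v 1 * v 2) + i * g 1 * (v 0 * v 2) + g 2 * (v 0 * v 1)) * A l =
      (1 + i) * (v 1 * v 2) * (g 0 * A l) + i * (v 0 * v 2) * (g 1 * A l) +
        v 0 * v 1 * (g 2 * A l) by ring, e0, e1, e2]
    simp only [hA]
    linear_combination g l * (v 0 * v 1 * v 2) * hrel
  have hsig : sigmaForm i v g = 0 := by
    refine eq_zero_of_ne_zero_of_mul_right_eq_zero hl ?_
    have hrel : sigmaForm i v A = 0 := sigmaForm_mul_conicForm hi v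
    simp only [sigmaForm] at hrel ⊢
    linear_combination (v 0 - v 1 * i) * hgA 2 l + (v 0 + v 2 * i) * hgA 1 l -
      (v 1 + v 2) * hgA 0 l + g l * hrel
  -- Linearity of the determinant in its first column, applied to b = 2(1+i) v - s (1,1,1).
  have hst : sigmaForm i b g + ((1 + i) * v 0 + i * v 1 + v 2) * tauForm i g = 0 := by
    have : sigmaForm i b g + ((1 + i) * v 0 + i * v 1 + v 2) * tauForm i g =
        2 * (1 + i) * sigmaForm i v g := by
      simp only [sigmaForm, tauForm, hbdef, lineForm]; ring
    rw [this, hsig, mul_zero]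
  refine ⟨hinc, hst, ?_⟩
  rw [← incidenceForm_eq_sum hi q b (lineForm_relation i v)]
  have hV : (fun j => tauForm i g * b j - sigmaForm i b g) =
      fun j => (tauForm i g * (2 * (1 + i))) * v j := by
    funext j
    have : b j = 2 * (1 + i) * v j - ((1 + i) * v 0 + i * v 1 + v 2) := rfl
    linear_combination tauForm i g * this - hst
  change incidenceForm i g (fun j => tauForm i g * b j - sigmaForm i b g) = 0
  rw [hV]
  simp only [incidenceForm] at hinc ⊢
  linear_combination (tauForm i g * (2 * (1 + i))) ^ 2 * hinc

/-- The map contracts no curve other than the lines on which a coordinate of `lineForm`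
vanishes. -/
lemma isConstant_of_fibre {v : Fin 3 → K} (hb : ∀ j, lineForm 𝐢 v j ≠ 0)
    (hM : ∃ j, mapForm 𝐢 v j ≠ 0) {q : Fin 3 → ℂ} (hq : q ≠ 0)
    (h : ∀ j k, q j • mapForm 𝐢 v k = q k • mapForm 𝐢 v j) : IsConstant v := by
  simp only [Algebra.smul_def] at h
  have hi := algebraMap_I_sq (K := K)
  have hI := Complex.I_sq
  obtain ⟨hinc, hst, hsum⟩ := relations_of_fibre hi (q := fun j => algebraMap ℂ K (q j)) hb hM h
  rw [sum_fibreCoeff_mul_eq_binaryForm] at hsum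
  -- The quintic has coefficients in ℂ and therefore splits: b is a constant vector times a scalar
  -- β.
  obtain ⟨t, ht, hrel⟩ := exists_linear_relation (fibrePoly_ne_zero hq)
    (natDegree_fibrePoly_le _ _) hsum
  have hbrel := lineForm_relation 𝐢 v
  set b : Fin 3 → ℂ := ![t.2, -t.1, -(1 + Complex.I) * t.2 + Complex.I * t.1] with hbdef
  obtain ⟨β, hβ⟩ : ∃ β : K, ∀ j, lineForm 𝐢 v j = algebraMap ℂ K (b j) * β := by
    simp only [Algebra.smul_def] at hrel
    suffices ∃ β : K, lineForm 𝐢 v 0 = algebraMap ℂ K t.2 * β ∧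
        lineForm 𝐢 v 1 = -algebraMap ℂ K t.1 * β by
      obtain ⟨β, h0, h1⟩ := this
      refine ⟨β, fun j => ?_⟩
      fin_cases j <;> simp [hbdef]
      · exact h0
      · linear_combination h1
      · linear_combination hbrel - (1 + 𝐢) * h0 - 𝐢 * h1
    by_cases ht1 : t.1 = 0
    · have ht2 : algebraMap ℂ K t.2 ≠ 0 := by
        simpa using fun h2 => ht (Prod.ext ht1 h2)
      refine ⟨(algebraMap ℂ K t.2)⁻¹ * lineForm 𝐢 v 0, by field_simp, ?_⟩
      simp [ht1] at hrel ⊢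
      exact hrel.resolve_left (by simpa using ht2)
    · have ht1 : algebraMap ℂ K t.1 ≠ 0 := by simpa using ht1
      refine ⟨-(algebraMap ℂ K t.1)⁻¹ * lineForm 𝐢 v 1, ?_, by field_simp⟩
      field_simp
      linear_combination hrel
  have hβ0 : β ≠ 0 := fun h0 => hb 0 (by rw [hβ, h0, mul_zero])
  have hb0 : ∀ j, b j ≠ 0 := fun j h0 => hb j (by rw [hβ, h0, map_zero, zero_mul])
  have hbne : b ≠ 0 := fun h0 => hb0 0 (congrFun h0 0)
  have hbrel' : (1 + Complex.I) * b 0 + Complex.I * b 1 + b 2 = 0 := by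
    simp [hbdef]; ring
  set g : Fin 3 → ℂ := fun j => q j * b j with hg
  set s := (1 + 𝐢) * v 0 + 𝐢 * v 1 + v 2 with hs
  have hlin : algebraMap ℂ K (tauForm Complex.I g) * s +
      algebraMap ℂ K (sigmaForm Complex.I b g) * β = 0 := by
    refine eq_zero_of_ne_zero_of_mul_right_eq_zero hβ0 ?_
    rw [← hst]
    simp only [hβ, sigmaForm, tauForm, hg, map_add, map_sub, map_mul, map_neg, map_one, map_ofNat]
    ring
  -- If τ and σ are not both zero, the relation τ s + σ β = 0 fixes the ratio of s and β. Otherwise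
  -- the incidence condition is a quadratic equation for that ratio.
  by_cases hτσ : tauForm Complex.I g ≠ 0 ∨ sigmaForm Complex.I b g ≠ 0
  · exact isConstant_of_lineForm_eq hβ0 hβ hbne hτσ hlin
  push Not at hτσ
  obtain ⟨hτ, hσ⟩ := hτσ
  have hv : ∀ j, 2 * (1 + 𝐢) * v j = algebraMap ℂ K (b j) * β + s := fun j => by
    rw [← hβ, lineForm]; ring
  have hquad := exists_linear_relation_of_quadratic (x := s) (y := β)
    ((1 + Complex.I) * g 0 + Complex.I * g 1 + g 2)
    ((1 + Complex.I) * g 0 * (b 1 + b 2) + Complex.I * g 1 * (b 0 + b 2) + g 2 * (b 0 + b 1))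
    (incidenceForm Complex.I g b) ?_ ?_
  · obtain ⟨u, hu, hsβ⟩ := hquad
    refine isConstant_of_lineForm_eq (x := u.1) (y := u.2) hβ0 hβ hbne ?_
      (by simpa [Algebra.smul_def] using hsβ)
    by_contra! h0
    exact hu (Prod.ext h0.1 h0.2)
  -- If the first two coefficients of the quadratic vanish together with τ and σ, then g = 0, hence
  -- q = 0.
  · by_contra! h0
    obtain ⟨hα, hγ, -⟩ := h0
    simp only [tauForm, sigmaForm] at hτ hσ
    have g0 : g 0 = 0 := by
      linear_combination (1 / 4) * ((1 - Complex.I) * hα - hτ - (-g 0 - g 1) * hI)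
    have g2 : g 2 = -Complex.I * g 1 := by linear_combination hα - (1 + Complex.I) * g0
    rw [g0, g2] at hγ hσ
    have h1 : g 1 * (b 2 - b 1) = 0 := by
      refine eq_zero_of_ne_zero_of_mul_left_eq_zero Complex.I_ne_zero ?_
      linear_combination hγ
    rcases mul_eq_zero.mp h1 with h1 | h1
    · apply hq
      rw [h1, mul_zero] at g2
      funext j
      have hgj : g j = 0 := by fin_cases j <;> assumption
      exact (mul_eq_zero.mp hgj).resolve_right (hb0 j)
    · have hb1 : b 2 = b 1 := by linear_combination h1
      have hb2 : b 0 = -b 1 := by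
        refine mul_left_cancel₀ (one_add_I_ne_zero (K := ℂ)) ?_
        simp only [Algebra.algebraMap_self, RingHom.id_apply]
        linear_combination hbrel' - hb1
      rw [hb1, hb2] at hσ
      have hfin : (2 * (Complex.I - 1)) * (b 1 * g 1) = 0 := by
        linear_combination hσ - b 1 * g 1 * hI
      have hI1 : Complex.I - 1 ≠ 0 := fun h => by simpa using congrArg Complex.re h
      have hg1 : g 1 = 0 := by
        simpa [hI1, hb0 1] using hfin
      apply hq
      rw [hg1, mul_zero] at g2
      funext j
      have hgj : g j = 0 := by fin_cases j <;> assumption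
      exact (mul_eq_zero.mp hgj).resolve_right (hb0 j)
  · have hinc' : (2 * (1 + 𝐢)) ^ 2 * incidenceForm 𝐢
        (fun j => algebraMap ℂ K (q j) * lineForm 𝐢 v j) v = 0 := by rw [hinc, mul_zero]
    refine eq_zero_of_ne_zero_of_mul_right_eq_zero hβ0 ?_
    rw [← hinc']
    simp only [incidenceForm, hβ, hg, map_add, map_mul, map_one]
    have e0 := hv 0
    have e1 := hv 1
    have e2 := hv 2
    generalize 2 * (1 + 𝐢) = w at e0 e1 e2
    rw [show w ^ 2 * ((1 + 𝐢) * (algebraMap ℂ K (q 0) * (algebraMap ℂ K (b 0) * β)) *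
      (v 1 * v 2) + 𝐢 * (algebraMap ℂ K (q 1) * (algebraMap ℂ K (b 1) * β)) * (v 0 * v 2) +
      algebraMap ℂ K (q 2) * (algebraMap ℂ K (b 2) * β) * (v 0 * v 1)) =
      (1 + 𝐢) * (algebraMap ℂ K (q 0) * (algebraMap ℂ K (b 0) * β)) *
      ((w * v 1) * (w * v 2)) + 𝐢 * (algebraMap ℂ K (q 1) * (algebraMap ℂ K (b 1) * β)) *
      ((w * v 0) * (w * v 2)) +
      algebraMap ℂ K (q 2) * (algebraMap ℂ K (b 2) * β) * ((w * v 0) * (w * v 1)) by ring,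
      e0, e1, e2]
    ring

end Field

/-! ### The rational map -/

/-- The coefficients of `lineForm`. -/
noncomputable def lineCoeff : Fin 3 → Fin 3 → ℂ :=
  ![![1 + Complex.I, -Complex.I, -1], ![-(1 + Complex.I), 2 + Complex.I, -1],
    ![-(1 + Complex.I), -Complex.I, 1 + 2 * Complex.I]]

/-- The coefficients of `conicForm`; the `m`-th one belongs to the product of the two coordinates
other than the `m`-th. -/
noncomputable def conicCoeff : Fin 3 → Fin 3 → ℂ :=
  ![![Complex.I - 1, -Complex.I, 1], ![1 - Complex.I, 2 + Complex.I, 1],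
    ![1 - Complex.I, -Complex.I, -(1 + 2 * Complex.I)]]

/-- Equivalently, no line L_j = 0 passes through a center. -/
lemma lineCoeff_ne_zero (j k : Fin 3) : lineCoeff j k ≠ 0 := by
  intro h
  have hr := congrArg Complex.re h
  have him := congrArg Complex.im h
  fin_cases j <;> fin_cases k <;> simp [lineCoeff] at hr him

/-- The conics have no square terms, so they pass through all centers; nonzero coefficients say that
their tangents there are not coordinate lines. -/
lemma conicCoeff_ne_zero (j k : Fin 3) : conicCoeff j k ≠ 0 := by
  intro h
  have hr := congrArg Complex.re h
  have him := congrArg Complex.im h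
  fin_cases j <;> fin_cases k <;> simp [conicCoeff] at hr him

lemma lineForm_eq {A : Type} [CommRing A] [Algebra ℂ A] (c : Fin 3 → A) (j k : Fin 3) :
    lineForm (algebraMap ℂ A Complex.I) c j = lineCoeff j k • c k +
      lineCoeff j (k + 1) • c (k + 1) + lineCoeff j (k + 2) • c (k + 2) := by
  simp only [Algebra.smul_def]
  fin_cases j <;> fin_cases k <;> simp [lineForm, lineCoeff, map_ofNat] <;> ring

lemma conicForm_eq {A : Type} [CommRing A] [Algebra ℂ A] (c : Fin 3 → A) (j k : Fin 3) :
    conicForm (algebraMap ℂ A Complex.I) c j = conicCoeff j (k + 2) • (c k * c (k + 1)) +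
      conicCoeff j (k + 1) • (c k * c (k + 2)) + conicCoeff j k • (c (k + 1) * c (k + 2)) := by
  simp only [Algebra.smul_def]
  fin_cases j <;> fin_cases k <;> simp [conicForm, conicCoeff, map_ofNat] <;> ring

lemma aeval_fromCoord_coord {A : Type} [CommRing A] [Algebra ℂ A] (c : Fin 3 → A) (j : Fin 3) :
    aeval (fromCoord c) (coord j) = c j := by
  have hI : algebraMap ℂ A Complex.I * algebraMap ℂ A (Complex.I / 2) = -algebraMap ℂ A (1 / 2) := by
    rw [← map_mul, ← map_neg]
    congr 1
    linear_combination Complex.I_sq / 2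
  have h2 : algebraMap ℂ A (1 / 2) * 2 = 1 := by
    rw [← map_ofNat (algebraMap ℂ A) 2, ← map_mul]; simp
  fin_cases j
  · simp [coord, fromCoord]
  · simp only [coord, fromCoord, Fin.mk_one, Matrix.cons_val, map_sub, map_mul, aeval_X, aeval_C,
      Algebra.smul_def]
    linear_combination c 1 * h2 - (c 1 - c 2) * hI
  · simp only [coord, fromCoord, Fin.reduceFinMk, Matrix.cons_val, map_add, map_mul, aeval_X,
      aeval_C, Algebra.smul_def]
    linear_combination c 2 * h2 + (c 1 - c 2) * hI

lemma lineForm_isHomogeneous (j : Fin 3) :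
    (lineForm (C Complex.I) coord j).IsHomogeneous 1 := by
  have := lineForm_eq coord j 0
  rw [algebraMap_eq] at this
  rw [this]
  simp only [smul_eq_C_mul]
  exact (((coord_isHomogeneous _).C_mul _).add ((coord_isHomogeneous _).C_mul _)).add
    ((coord_isHomogeneous _).C_mul _)

lemma conicForm_isHomogeneous (j : Fin 3) :
    (conicForm (C Complex.I) coord j).IsHomogeneous 2 := by
  have := conicForm_eq coord j 0
  rw [algebraMap_eq] at this
  rw [this]
  simp only [smul_eq_C_mul]
  have h : ∀ a b, (coord a * coord b).IsHomogeneous 2 := fun a b =>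
    (coord_isHomogeneous a).mul (coord_isHomogeneous b)
  exact (((h _ _).C_mul _).add ((h _ _).C_mul _)).add ((h _ _).C_mul _)

lemma mapForm_isHomogeneous (j : Fin 3) :
    (mapForm (C Complex.I) coord j).IsHomogeneous 5 :=
  (((coord_isHomogeneous j).mul (conicForm_isHomogeneous j)).mul (lineForm_isHomogeneous _)).mul
    (lineForm_isHomogeneous _)

/-- A common component would consist of points where all three forms vanish, and its generic point
is not constant. -/
lemma isUnit_of_forall_dvd_mapForm {h : Poly} (hh : ∀ j, h ∣ mapForm (C Complex.I) coord j) :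
    IsUnit h := by
  by_contra hu
  obtain ⟨p, hp, hph⟩ : ∃ p : Poly, Irreducible p ∧ p ∣ h := by
    by_cases h0 : h = 0
    · exact ⟨coord 0, irreducible_of_isHomogeneous_one (coord_isHomogeneous 0) (coord_ne_zero 0),
        h0 ▸ dvd_zero _⟩
    · exact WfDvdMonoid.exists_irreducible_factor hu h0
  obtain ⟨K, _, _, φ, hφ, hc⟩ := exists_genericPoint hp.prime
  refine hc (isConstant_of_mapForm_eq_zero fun j => ?_)
  have := (hφ _).mpr (hph.trans (hh j))
  rw [← AlgHom.coe_toRingHom, map_mapForm] at this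
  rw [← this]
  congr 1
  exact (φ.commutes _).symm

/-- The rational map that describes the skew pentagram map on rotationally symmetric octagons. -/
noncomputable def octagonMap : RatMap where
  form := fromCoord (mapForm (C Complex.I) coord)
  degree := 5
  isHomogeneous := fun i => by
    fin_cases i <;> simp only [fromCoord, smul_eq_C_mul]
    · exact ((mapForm_isHomogeneous _).add (mapForm_isHomogeneous _)).C_mul _
    · exact ((mapForm_isHomogeneous _).sub (mapForm_isHomogeneous _)).C_mul _
    · exact (mapForm_isHomogeneous _).neg
  coprime := fun h hh => isUnit_of_forall_dvd_mapForm fun j => by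
    rw [← aeval_fromCoord_coord (mapForm (C Complex.I) coord) j]
    fin_cases j
    · simpa [coord] using hh 2
    · simp only [coord, Fin.mk_one, Matrix.cons_val, map_sub, map_mul, aeval_X, aeval_C]
      exact dvd_sub (hh 0) ((hh 1).mul_left _)
    · simp only [coord, Fin.reduceFinMk, Matrix.cons_val, map_add, map_mul, aeval_X, aeval_C]
      exact dvd_add (hh 0) ((hh 1).mul_left _)

lemma octagonMap_pull_coord (j : Fin 3) :
    octagonMap.pull (coord j) = mapForm (C Complex.I) coord j :=
  aeval_fromCoord_coord _ j

lemma RatMap.form_eq_fromCoord (g : RatMap) :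
    g.form = fromCoord fun j => g.pull (coord j) := by
  funext i
  simp only [RatMap.pull]
  rw [← fromCoord_map (bind₁ g.form) coord i, fromCoord_coord, bind₁_X_right]

lemma RatMap.baseOrd_eq_iInf_coord (g : RatMap) (B : PrimeDivisor) :
    g.baseOrd B = ⨅ j, B.ord (g.pull (coord j)) := by
  have hs : ∀ (c : ℂ) (P : Poly), B.ord P ≤ B.ord (c • P) := fun c P => by
    by_cases hc : c = 0
    · rw [hc, zero_smul, PrimeDivisor.ord_zero]; exact le_top
    · rw [B.ord_smul hc]
  have ha : ∀ (a : ℕ∞) (P Q : Poly), a ≤ B.ord P → a ≤ B.ord Q → a ≤ B.ord (P + Q) :=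
    fun a P Q hP hQ => (le_min hP hQ).trans (B.min_le_ord_add P Q)
  apply le_antisymm
  · refine le_iInf fun j => ?_
    have h : ∀ i, g.baseOrd B ≤ B.ord (g.form i) := fun i => iInf_le _ i
    have hI : g.baseOrd B ≤ B.ord (C Complex.I * g.form 1) := by
      rw [← smul_eq_C_mul]; exact (h 1).trans (hs _ _)
    fin_cases j
    · simp [coord, pull, PrimeDivisor.ord_neg, h]
    · simp only [coord, pull, Fin.mk_one, Matrix.cons_val, map_sub, map_mul, bind₁_X_right,
        bind₁_C_right]
      rw [sub_eq_add_neg]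
      exact ha _ _ _ (h 0) (by rw [PrimeDivisor.ord_neg]; exact hI)
    · simp only [coord, pull, Fin.reduceFinMk, Matrix.cons_val, map_add, map_mul, bind₁_X_right,
        bind₁_C_right]
      exact ha _ _ _ (h 0) hI
  · refine le_iInf fun i => ?_
    have h : ∀ j, ⨅ j, B.ord (g.pull (coord j)) ≤ B.ord (g.pull (coord j)) := fun j => iInf_le _ j
    rw [g.form_eq_fromCoord]
    fin_cases i
    · exact (ha _ _ _ (h 1) (h 2)).trans (hs _ _)
    · refine le_trans ?_ (hs _ _)
      rw [sub_eq_add_neg]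
      exact ha _ _ _ (h 1) (by rw [PrimeDivisor.ord_neg]; exact h 2)
    · change _ ≤ B.ord (-g.pull (coord 0))
      rw [PrimeDivisor.ord_neg]; exact h 0

/-! ### Leading forms at a center -/

/-- Along the `k`-th exceptional curve, `P` has the leading form `A` of order `m`. -/
def HasLead (k : Fin 3) (P : Poly) (m : ℕ) (A : Poly) : Prop :=
  ∃ R : Polynomial Poly, contractHom k P = Polynomial.X ^ m * (Polynomial.C A + Polynomial.X * R)

namespace HasLead

variable {k : Fin 3} {P Q A B : Poly} {m n : ℕ}

lemma ord_eq (h : HasLead k P m A) (hA : A ≠ 0) : (PrimeDivisor.exceptional k).ord P = m := by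
  obtain ⟨R, hR⟩ := h
  rw [PrimeDivisor.ord_exceptional, hR, emultiplicity_mul Polynomial.prime_X,
    emultiplicity_pow_self_of_prime Polynomial.prime_X, emultiplicity_eq_zero.mpr, add_zero]
  rw [Polynomial.X_dvd_iff]
  simpa using hA

lemma mul (hP : HasLead k P m A) (hQ : HasLead k Q n B) : HasLead k (P * Q) (m + n) (A * B) := by
  obtain ⟨R, hR⟩ := hP
  obtain ⟨S, hS⟩ := hQ
  refine ⟨Polynomial.C A * S + R * Polynomial.C B + Polynomial.X * R * S, ?_⟩
  rw [map_mul, hR, hS, Polynomial.C_mul]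
  ring

lemma add (hP : HasLead k P m A) (hQ : HasLead k Q m B) : HasLead k (P + Q) m (A + B) := by
  obtain ⟨R, hR⟩ := hP
  obtain ⟨S, hS⟩ := hQ
  refine ⟨R + S, ?_⟩
  rw [map_add, hR, hS, Polynomial.C_add]
  ring

lemma smul (hP : HasLead k P m A) (c : ℂ) : HasLead k (c • P) m (c • A) := by
  obtain ⟨R, hR⟩ := hP
  refine ⟨c • R, ?_⟩
  rw [map_smul, hR, ← Polynomial.smul_C, mul_smul_comm, ← smul_add, mul_smul_comm]

lemma add_of_lt (hP : HasLead k P m A) (hQ : HasLead k Q (m + 1) B) : HasLead k (P + Q) m A := by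
  obtain ⟨R, hR⟩ := hP
  obtain ⟨S, hS⟩ := hQ
  refine ⟨R + (Polynomial.C B + Polynomial.X * S), ?_⟩
  rw [map_add, hR, hS]
  ring

lemma coord_of_ne {j : Fin 3} (h : j ≠ k) : HasLead k (coord j) 1 (coord j) :=
  ⟨0, by rw [contractHom_of_mem_centerForms (coord_mem_centerForms h)]; ring⟩

lemma coord_self (k : Fin 3) : ∃ u : Poly, u ≠ 0 ∧ HasLead k (coord k) 0 u := by
  refine ⟨(contractHom k (coord k)).coeff 0, ?_, (contractHom k (coord k)).divX, ?_⟩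
  · rw [coeff_zero_contractHom (coord_isHomogeneous k)]
    exact mul_ne_zero (pow_ne_zero _ (X_ne_zero _)) (by simpa using eval_coord_center_self k)
  · rw [pow_zero, one_mul, add_comm, Polynomial.X_mul_divX_add]

end HasLead

lemma succ_ne_self (k : Fin 3) : k + 1 ≠ k := by fin_cases k <;> decide

lemma add_two_ne_self (k : Fin 3) : k + 2 ≠ k := by fin_cases k <;> decide

lemma succ_ne_add_two (k : Fin 3) : k + 1 ≠ k + 2 := by fin_cases k <;> decide

lemma hasLead_lineForm {k : Fin 3} {u : Poly} (hu : HasLead k (coord k) 0 u) (j : Fin 3) :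
    HasLead k (lineForm (C Complex.I) coord j) 0 (lineCoeff j k • u) := by
  have := lineForm_eq coord j k
  rw [algebraMap_eq] at this
  rw [this]
  exact ((hu.smul _).add_of_lt ((HasLead.coord_of_ne (succ_ne_self k)).smul _)).add_of_lt
    ((HasLead.coord_of_ne (add_two_ne_self k)).smul _)

lemma hasLead_conicForm {k : Fin 3} {u : Poly} (hu : HasLead k (coord k) 0 u) (j : Fin 3) :
    HasLead k (conicForm (C Complex.I) coord j) 1 (u * (conicCoeff j (k + 2) • coord (k + 1) +
      conicCoeff j (k + 1) • coord (k + 2))) := by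
  have := conicForm_eq coord j k
  rw [algebraMap_eq] at this
  rw [this, mul_add, mul_smul_comm, mul_smul_comm]
  have h1 := HasLead.coord_of_ne (succ_ne_self k)
  have h2 := HasLead.coord_of_ne (add_two_ne_self k)
  have h01 := hu.mul h1
  have h02 := hu.mul h2
  rw [zero_add] at h01 h02
  exact ((h01.smul _).add (h02.smul _)).add_of_lt ((h1.mul h2).smul _)

/-- At the k-th center neither `coord k` nor the linear forms vanish, so only the conic contributes.
-/
lemma ord_exceptional_mapForm_self (k : Fin 3) :
    (PrimeDivisor.exceptional k).ord (mapForm (C Complex.I) coord k) = 1 := by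
  obtain ⟨u, hu0, hu⟩ := HasLead.coord_self k
  have h := ((hu.mul (hasLead_conicForm hu k)).mul (hasLead_lineForm hu (k + 1))).mul
    (hasLead_lineForm hu (k + 2))
  refine h.ord_eq (mul_ne_zero (mul_ne_zero (mul_ne_zero hu0 (mul_ne_zero hu0 ?_))
    (smul_ne_zero (lineCoeff_ne_zero _ _) hu0)) (smul_ne_zero (lineCoeff_ne_zero _ _) hu0))
  intro h0
  have := congrArg (eval (center (k + 1))) h0
  simp [smul_eq_C_mul, eval_coord_center_ne (succ_ne_add_two k).symm, eval_coord_center_self,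
    conicCoeff_ne_zero] at this

/-- One order comes from the coordinate and one from the conic. The two leading forms are `coord (k
+ 1)` and `coord (k + 2)` times a tangent; evaluation at the two other centers separates them, so no
combination cancels. -/
lemma ord_exceptional_mapForm_comb (k : Fin 3) {t : ℂ × ℂ} (ht : t ≠ 0) :
    (PrimeDivisor.exceptional k).ord (t.1 • mapForm (C Complex.I) coord (k + 1) +
      t.2 • mapForm (C Complex.I) coord (k + 2)) = 2 := by
  obtain ⟨u, hu0, hu⟩ := HasLead.coord_self k
  have e1 : k + 1 + 2 = k := by fin_cases k <;> decide
  have e2 : k + 1 + 1 = k + 2 := by fin_cases k <;> decide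
  have e3 : k + 2 + 1 = k := by fin_cases k <;> decide
  have e4 : k + 2 + 2 = k + 1 := by fin_cases k <;> decide
  have h1 := (((HasLead.coord_of_ne (succ_ne_self k)).mul (hasLead_conicForm hu (k + 1))).mul
    (hasLead_lineForm hu (k + 1 + 1))).mul (hasLead_lineForm hu (k + 1 + 2))
  have h2 := (((HasLead.coord_of_ne (add_two_ne_self k)).mul (hasLead_conicForm hu (k + 2))).mul
    (hasLead_lineForm hu (k + 2 + 1))).mul (hasLead_lineForm hu (k + 2 + 2))
  refine ((h1.smul t.1).add (h2.smul t.2)).ord_eq ?_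
  rw [e1, e2, e3, e4]
  have : ∀ x y a b : Poly, ∀ p q r : ℂ,
      t.1 • (x * (u * a) * (p • u) * (q • u)) + t.2 • (y * (u * b) * (q • u) * (r • u)) =
      (u ^ 3 * C q) * ((t.1 * p) • (x * a) + (t.2 * r) • (y * b)) := by
    intro x y a b p q r
    simp only [smul_eq_C_mul, C_mul]
    ring
  rw [this]
  refine mul_ne_zero (mul_ne_zero (pow_ne_zero _ hu0) ?_) fun h0 => ht ?_
  · simpa using lineCoeff_ne_zero k k
  · have c1 := congrArg (eval (center (k + 1))) h0
    have c2 := congrArg (eval (center (k + 2))) h0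
    simp [smul_eq_C_mul, eval_coord_center_ne (succ_ne_add_two k).symm, eval_coord_center_self,
      eval_coord_center_ne (succ_ne_add_two k), conicCoeff_ne_zero, lineCoeff_ne_zero] at c1 c2
    exact Prod.ext c1 c2

lemma octagonMap_baseOrd_exceptional (k : Fin 3) :
    octagonMap.baseOrd (.exceptional k) = 1 := by
  rw [RatMap.baseOrd_eq_iInf_coord]
  simp only [octagonMap_pull_coord]
  have h1 := ord_exceptional_mapForm_comb k (t := (1, 0)) (by simp)
  have h2 := ord_exceptional_mapForm_comb k (t := (0, 1)) (by simp)
  simp only [one_smul, zero_smul, add_zero, zero_add] at h1 h2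
  have h0 := ord_exceptional_mapForm_self k
  refine le_antisymm ((iInf_le _ k).trans h0.le) (le_iInf fun j => ?_)
  have hj : j = k ∨ j = k + 1 ∨ j = k + 2 := by
    clear h0 h1 h2; revert j k; decide
  rcases hj with rfl | rfl | rfl
  · exact h0.ge
  · rw [h1]; exact one_le_two
  · rw [h2]; exact one_le_two

/-- Along E_k the k-th coordinate of the image has order 1, and all combinations of the other two
have order 2; the difference 1 is the ramification index. -/
lemma octagonMap_transports_exceptional (k : Fin 3) :
    octagonMap.Transports (.exceptional k) (.exceptional k) 1 := by
  refine octagonMap.transports_exceptional _ k (r := 1) one_pos ?_ ?_ fun t ht => ?_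
  · rw [octagonMap_baseOrd_exceptional]; rfl
  · rw [octagonMap_pull_coord, ord_exceptional_mapForm_self]; rfl
  · rw [octagonMap_pull_coord, octagonMap_pull_coord, ord_exceptional_mapForm_comb k ht]; rfl

lemma RatMap.Transports.pull_ne_zero {g : RatMap} {B B' : PrimeDivisor} {e : ℕ}
    (h : g.Transports B B' e) {P : Poly} {n : ℕ} (hP : P.IsHomogeneous n) (h0 : P ≠ 0) :
    g.pull P ≠ 0 := by
  intro hz
  have := h n P hP
  rw [hz, PrimeDivisor.ord_zero] at this
  exact WithTop.add_ne_top.mpr ⟨natCast_mul_ne_top _ (B'.ord_ne_top h0),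
    natCast_mul_ne_top _ (g.baseOrd_ne_top B)⟩ this.symm

lemma RatMap.NonContracting.pull_ne_zero {g : RatMap} (h : g.NonContracting) (n : ℕ) (P : Poly)
    (hP : P.IsHomogeneous n) (h0 : P ≠ 0) : g.pull P ≠ 0 := by
  obtain ⟨B', e, ht⟩ := h (.exceptional 0)
  exact ht.pull_ne_zero hP h0

/-! ### The contracted lines -/

lemma eval_fromCoord_coord (c : Fin 3 → ℂ) (j : Fin 3) : eval (fromCoord c) (coord j) = c j :=
  aeval_fromCoord_coord c j

lemma fromCoord_eval_coord (x : Fin 3 → ℂ) : fromCoord (fun j => eval x (coord j)) = x := by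
  funext i
  have := fromCoord_map (aeval x : Poly →ₐ[ℂ] ℂ) coord i
  rw [fromCoord_coord] at this
  simpa using this.symm

lemma eval_lineForm (x : Fin 3 → ℂ) (j : Fin 3) : eval x (lineForm (C Complex.I) coord j) =
    lineForm Complex.I (fun j => eval x (coord j)) j := by
  rw [map_lineForm, eval_C]

lemma eval_conicForm (x : Fin 3 → ℂ) (j : Fin 3) : eval x (conicForm (C Complex.I) coord j) =
    conicForm Complex.I (fun j => eval x (coord j)) j := by
  rw [map_conicForm, eval_C]

lemma eval_mapForm (x : Fin 3 → ℂ) (j : Fin 3) : eval x (mapForm (C Complex.I) coord j) =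
    mapForm Complex.I (fun j => eval x (coord j)) j := by
  rw [map_mapForm, eval_C]

lemma eval_lineForm_center_ne_zero (j k : Fin 3) :
    eval (center k) (lineForm (C Complex.I) coord j) ≠ 0 := by
  have h := lineForm_eq (fun j => eval (center k) (coord j)) j k
  rw [Algebra.algebraMap_self_apply] at h
  rw [eval_lineForm, h]
  simp [eval_coord_center_ne (succ_ne_self k), eval_coord_center_ne (add_two_ne_self k),
    eval_coord_center_self, lineCoeff_ne_zero]

lemma irreducible_lineForm (k : Fin 3) : Irreducible (lineForm (C Complex.I) coord k) :=
  irreducible_of_isHomogeneous_one (lineForm_isHomogeneous k) fun h =>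
    eval_lineForm_center_ne_zero k 0 (by rw [h, map_zero])

/-- The line that is contracted to the `k`-th center. -/
noncomputable def contractedLine (k : Fin 3) : PlaneCurve :=
  .ofForm (lineForm_isHomogeneous k) (irreducible_lineForm k)

lemma associated_contractedLine (k : Fin 3) :
    Associated (contractedLine k).equation (lineForm (C Complex.I) coord k) :=
  PlaneCurve.associated_ofForm _ _

lemma numClass_contractedLine (k : Fin 3) :
    (PrimeDivisor.strict (contractedLine k)).numClass = ![1, 0, 0, 0] := by
  have hm : ∀ m, multAt m (contractedLine k).equation = 0 := fun m => by
    change (PrimeDivisor.exceptional m).ord _ = 0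
    rw [PrimeDivisor.ord_eq_of_associated _ (associated_contractedLine k)]
    exact PrimeDivisor.ord_exceptional_eq_zero (lineForm_isHomogeneous k)
      (eval_lineForm_center_ne_zero k m)
  have hd : (contractedLine k).degree = 1 := by
    obtain ⟨v, hv⟩ := (associated_contractedLine k).symm
    obtain ⟨a, ha, hva⟩ := isUnit_iff_exists_C.mp v.isUnit
    refine (contractedLine k).isHomogeneous.inj_right (n := 1) ?_
      (contractedLine k).prime_equation.ne_zero
    rw [← hv, hva, mul_comm]
    exact (lineForm_isHomogeneous k).C_mul a
  simp [PrimeDivisor.numClass, hm, hd]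

/-- The intersections of L_k = 0 with the two coordinate lines through the k-th center serve as test
points: a form that is nonzero at one of them is not divisible by L_k. -/
lemma exists_point_contractedLine (k : Fin 3) :
    ∃ c d : Fin 3 → ℂ, (lineForm Complex.I c k = 0 ∧ c (k + 2) = 0 ∧ c k ≠ 0 ∧ c (k + 1) ≠ 0 ∧
      lineForm Complex.I c (k + 1) ≠ 0 ∧ lineForm Complex.I c (k + 2) ≠ 0) ∧
      (lineForm Complex.I d k = 0 ∧ d (k + 1) = 0 ∧ d k ≠ 0 ∧ d (k + 2) ≠ 0 ∧
      lineForm Complex.I d (k + 1) ≠ 0 ∧ lineForm Complex.I d (k + 2) ≠ 0) := by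
  fin_cases k
  · refine ⟨![Complex.I, 1 + Complex.I, 0], ![1, 0, 1 + Complex.I], ?_⟩
    simp [lineForm, Complex.ext_iff]
    norm_num
  · refine ⟨![0, 1, 2 + Complex.I], ![2 + Complex.I, 1 + Complex.I, 0], ?_⟩
    simp [lineForm, Complex.ext_iff]
    norm_num
  · refine ⟨![1 + 2 * Complex.I, 0, 1 + Complex.I], ![0, 1 + 2 * Complex.I, Complex.I], ?_⟩
    simp [lineForm, Complex.ext_iff]
    norm_num

lemma ord_contractedLine_eq_zero {k : Fin 3} {P : Poly} {c : Fin 3 → ℂ}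
    (hc : lineForm Complex.I c k = 0) (hP : eval (fromCoord c) P ≠ 0) :
    (PrimeDivisor.strict (contractedLine k)).ord P = 0 := by
  rw [PrimeDivisor.ord_strict, emultiplicity_eq_zero, (associated_contractedLine k).dvd_iff_dvd_left]
  rintro ⟨R, rfl⟩
  apply hP
  rw [map_mul, eval_lineForm]
  simp only [eval_fromCoord_coord]
  rw [hc, zero_mul]

/-- The coordinates k + 1 and k + 2 of f contain the factor L_k, while the k-th one does not. After
division by L_k only the (k+1)-st summand survives at c and only the (k+2)-nd at d, so no
combination is divisible by L_k again. -/
lemma octagonMap_transports_contractedLine (k : Fin 3) :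
    octagonMap.Transports (.strict (contractedLine k)) (.exceptional k) 1 := by
  obtain ⟨c, d, ⟨c0, c1, c2, c3, c4, c5⟩, d0, d1, d2, d3, d4, d5⟩ := exists_point_contractedLine k
  have e1 : k + 1 + 2 = k := by fin_cases k <;> decide
  have e2 : k + 1 + 1 = k + 2 := by fin_cases k <;> decide
  have e3 : k + 2 + 1 = k := by fin_cases k <;> decide
  have e4 : k + 2 + 2 = k + 1 := by fin_cases k <;> decide
  have hQ : ∀ (c : Fin 3 → ℂ) (j : Fin 3), conicForm Complex.I c j =
      conicCoeff j (k + 2) * (c k * c (k + 1)) + conicCoeff j (k + 1) * (c k * c (k + 2)) +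
        conicCoeff j k * (c (k + 1) * c (k + 2)) := fun c j => conicForm_eq c j k
  refine octagonMap.transports_exceptional _ k (r := 0) one_pos ?_ ?_ fun t ht => ?_
  · rw [RatMap.baseOrd_strict]; rfl
  · rw [octagonMap_pull_coord]
    refine ord_contractedLine_eq_zero c0 ?_
    rw [eval_mapForm]
    simp only [eval_fromCoord_coord, mapForm]
    refine mul_ne_zero (mul_ne_zero (mul_ne_zero c2 ?_) c4) c5
    rw [hQ, c1]
    simp [c2, c3, conicCoeff_ne_zero]
  · have hfac : t.1 • mapForm (C Complex.I) coord (k + 1) +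
        t.2 • mapForm (C Complex.I) coord (k + 2) = lineForm (C Complex.I) coord k *
        (t.1 • (coord (k + 1) * conicForm (C Complex.I) coord (k + 1) *
          lineForm (C Complex.I) coord (k + 2)) +
        t.2 • (coord (k + 2) * conicForm (C Complex.I) coord (k + 2) *
          lineForm (C Complex.I) coord (k + 1))) := by
      simp only [mapForm, e1, e2, e3, e4, smul_eq_C_mul]
      ring
    have hself : (PrimeDivisor.strict (contractedLine k)).ord (lineForm (C Complex.I) coord k) =
        1 := by
      rw [← PrimeDivisor.ord_eq_of_associated _ (associated_contractedLine k)]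
      exact (FiniteMultiplicity.of_prime_left (contractedLine k).prime_equation
        (contractedLine k).prime_equation.ne_zero).emultiplicity_self
    rw [octagonMap_pull_coord, octagonMap_pull_coord, hfac, PrimeDivisor.ord_mul, hself]
    have hz : t.1 ≠ 0 ∨ t.2 ≠ 0 := by
      by_contra! h
      exact ht (Prod.ext h.1 h.2)
    rw [add_comm, Nat.cast_one, Nat.cast_zero]
    congr 1
    rcases hz with h | h
    · refine ord_contractedLine_eq_zero c0 ?_
      simp only [smul_eq_C_mul, map_add, map_mul, eval_C, eval_lineForm, eval_conicForm,
        eval_fromCoord_coord, c1, hQ]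
      simp [h, c2, c3, c5, conicCoeff_ne_zero]
    · refine ord_contractedLine_eq_zero d0 ?_
      simp only [smul_eq_C_mul, map_add, map_mul, eval_C, eval_lineForm, eval_conicForm,
        eval_fromCoord_coord, d1, hQ]
      simp [h, d2, d3, d4, conicCoeff_ne_zero]

/-- If D were contracted, its generic point would lie in the fibre over a constant q, and it is not
on any line L_j = 0; then it would be constant, by the quintic. -/
lemma octagonMap_transports_strict (D : PlaneCurve) (hD : ∀ k, D ≠ contractedLine k) :
    ∃ D' e, octagonMap.Transports (.strict D) (.strict D') e := by
  refine octagonMap.exists_transports_strict (show 0 < 5 by norm_num)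
    (fun n P hP h0 => (octagonMap_transports_exceptional 0).pull_ne_zero hP h0) D fun q hq => ?_
  by_contra! hall
  obtain ⟨K, _, _, φ, hφ, hc⟩ := exists_genericPoint D.prime_equation
  have hI : φ (C Complex.I) = algebraMap ℂ K Complex.I := φ.commutes _
  have hb : ∀ j, lineForm (algebraMap ℂ K Complex.I) (fun j => φ (coord j)) j ≠ 0 := by
    intro j hj
    rw [← hI] at hj
    have hj := (map_lineForm (φ : Poly →+* K) (C Complex.I) coord j).trans hj
    have hdvd := (hφ _).mp hj
    exact hD j (PlaneCurve.eq_of_dvd (hdvd.trans (associated_contractedLine j).symm.dvd))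
  have hmap : ∀ j, φ (octagonMap.pull (coord j)) =
      mapForm (algebraMap ℂ K Complex.I) (fun j => φ (coord j)) j := fun j => by
    rw [octagonMap_pull_coord, ← hI]
    exact map_mapForm (φ : Poly →+* K) (C Complex.I) coord j
  obtain ⟨i₀, hi₀⟩ := Function.ne_iff.mp hq
  rw [Pi.zero_apply] at hi₀
  have hi₀' : algebraMap ℂ K (q i₀) ≠ 0 := by simpa using hi₀
  set r : K := (algebraMap ℂ K (q i₀))⁻¹ * φ (octagonMap.form i₀) with hr
  have hform : ∀ i, φ (octagonMap.form i) = r * algebraMap ℂ K (q i) := fun i => by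
    have := (hφ _).mpr (hall i₀ i)
    rw [map_sub, map_smul, map_smul, Algebra.smul_def, Algebra.smul_def, sub_eq_zero] at this
    rw [hr, mul_assoc, eq_inv_mul_iff_mul_eq₀ hi₀', this, mul_comm]
  have hpull : ∀ j, φ (octagonMap.pull (coord j)) = r * algebraMap ℂ K (eval q (coord j)) := by
    intro j
    have h1 : φ (octagonMap.pull (coord j)) = aeval (fun i => φ (octagonMap.form i)) (coord j) :=
      comp_aeval_apply _ φ (coord j)
    rw [h1, funext hform, aeval_mul_of_isHomogeneous (coord_isHomogeneous j), pow_one]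
    congr 1
    exact aeval_algebraMap_apply K q (coord j)
  refine hc (isConstant_of_fibre hb ?_ (q := fun j => eval q (coord j)) (fun h0 => hq ?_)
    fun j k => ?_)
  · by_contra! h0
    exact hc (isConstant_of_mapForm_eq_zero h0)
  · rw [← fromCoord_eval_coord q, h0]
    funext i
    fin_cases i <;> simp [fromCoord]
  · rw [← hmap, ← hmap, hpull, hpull, Algebra.smul_def, Algebra.smul_def]
    ring

lemma octagonMap_nonContracting : octagonMap.NonContracting := by
  rintro (D | k)
  · by_cases h : ∃ k, D = contractedLine k
    · obtain ⟨k, rfl⟩ := h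
      exact ⟨_, _, octagonMap_transports_contractedLine k⟩
    · push Not at h
      obtain ⟨D', e, hD⟩ := octagonMap_transports_strict D h
      exact ⟨_, _, hD⟩
  · exact ⟨_, _, octagonMap_transports_exceptional k⟩

/-! ### The pullback on numerical classes -/

lemma RatMap.hasPullbackMatrix_of_prime {g : RatMap} {M : Matrix (Fin 4) (Fin 4) ℤ}
    (h : ∀ A : PrimeDivisor, ∃ D' : Divisor, (∀ B, D' B = g.pullbackMult A B) ∧
      numClass D' = M.mulVec A.numClass) : g.HasPullbackMatrix M := by
  intro D
  induction D using Finsupp.induction_linear with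
  | zero => exact ⟨0, fun B => by simp, by rw [numClass_zero, Matrix.mulVec_zero]⟩
  | add D E hD hE =>
    obtain ⟨D', hD, hD'⟩ := hD
    obtain ⟨E', hE, hE'⟩ := hE
    refine ⟨D' + E', fun B => ?_, ?_⟩
    · rw [Finsupp.add_apply, hD, hE, Finsupp.sum_add_index' (fun _ => zero_mul _)
        fun _ _ _ => add_mul _ _ _]
    · rw [numClass_add, numClass_add, hD', hE', Matrix.mulVec_add]
  | single A n =>
    obtain ⟨D', hD, hD'⟩ := h A
    refine ⟨n • D', fun B => ?_, ?_⟩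
    · rw [Finsupp.smul_apply, hD, Finsupp.sum_single_index (zero_mul _), smul_eq_mul]
    · rw [numClass_smul, hD', numClass_single, Matrix.mulVec_smul]

/-- The k-th line is carried to E_k, and a prime divisor has only one image. -/
lemma contractedLine_injective : Function.Injective contractedLine := by
  intro k l hkl
  have h1 := octagonMap_transports_contractedLine k
  rw [hkl] at h1
  have h2 := octagonMap_transports_contractedLine l
  by_contra hne
  have e1 := h1.exceptionalPullbackMult_eq k
  have e2 := h2.exceptionalPullbackMult_eq k
  rw [e1] at e2
  simp [hne] at e2

open Classical in
lemma octagonMap_exceptionalPullbackMult (k : Fin 3) (B : PrimeDivisor) :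
    octagonMap.exceptionalPullbackMult k B =
      (Finsupp.single (PrimeDivisor.exceptional k) 1 +
        Finsupp.single (PrimeDivisor.strict (contractedLine k)) 1 : Divisor) B := by
  rw [Finsupp.add_apply, Finsupp.single_apply, Finsupp.single_apply]
  cases B with
  | exceptional l =>
    rw [(octagonMap_transports_exceptional l).exceptionalPullbackMult_eq]
    simp
  | strict D =>
    by_cases h : ∃ l, D = contractedLine l
    · obtain ⟨l, rfl⟩ := h
      rw [(octagonMap_transports_contractedLine l).exceptionalPullbackMult_eq]
      simp [contractedLine_injective.eq_iff]
    · push Not at h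
      obtain ⟨D', e, hD⟩ := octagonMap_transports_strict D h
      rw [hD.exceptionalPullbackMult_eq]
      simp [(h k).symm]

open Classical in
lemma octagonMap_baseOrd (B : PrimeDivisor) : ((octagonMap.baseOrd B).toNat : ℤ) =
    (∑ k, Finsupp.single (PrimeDivisor.exceptional k) 1 : Divisor) B := by
  rw [Finsupp.finsetSum_apply]
  simp only [Finsupp.single_apply]
  cases B with
  | exceptional l =>
    rw [octagonMap_baseOrd_exceptional]
    simp
  | strict D =>
    rw [RatMap.baseOrd_strict]
    simp

/-- For a curve D of degree d, the divisor of its pulled back equation has class 5d H. The base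
orders remove d copies of E₁ + E₂ + E₃, and the passage to the strict transform removes mult_k(D)
copies of f̂^* E_k. -/
lemma octagonMap_hasPullbackMatrix : octagonMap.HasPullbackMatrix stableMatrix := by
  refine RatMap.hasPullbackMatrix_of_prime fun A => ?_
  set T : Fin 3 → Divisor := fun k => Finsupp.single (PrimeDivisor.exceptional k) 1 +
    Finsupp.single (PrimeDivisor.strict (contractedLine k)) 1 with hT
  have hTc : ∀ k, numClass (T k) = Pi.single k.succ 1 + ![1, 0, 0, 0] := fun k => by
    rw [hT, numClass_add, numClass_single, numClass_single, one_smul, one_smul,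
      numClass_contractedLine]
    rfl
  cases A with
  | exceptional k =>
    refine ⟨T k, fun B => (octagonMap_exceptionalPullbackMult k B).symm, ?_⟩
    rw [hTc]
    change _ = stableMatrix.mulVec (Pi.single k.succ 1)
    rw [Matrix.mulVec_single_one]
    funext j
    fin_cases k <;> fin_cases j <;> simp [stableMatrix]
  | strict D =>
    have h0 := octagonMap_nonContracting.pull_ne_zero _ _ D.isHomogeneous
      D.prime_equation.ne_zero
    obtain ⟨E, hE, hEc⟩ := exists_divisor_of_form _ h0 _
      (octagonMap.pull_isHomogeneous D.isHomogeneous)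
    refine ⟨E + -(D.degree : ℤ) • (∑ k, Finsupp.single (PrimeDivisor.exceptional k) 1 : Divisor) +
      ∑ k, (-((multAt k D.equation).toNat : ℤ)) • T k, fun B => ?_, ?_⟩
    · rw [Finsupp.add_apply, Finsupp.add_apply, Finsupp.smul_apply, ← octagonMap_baseOrd, hE,
        Finsupp.finsetSum_apply]
      simp only [Finsupp.smul_apply, hT, ← octagonMap_exceptionalPullbackMult, RatMap.pullbackMult,
        smul_eq_mul, neg_mul, Finset.sum_neg_distrib]
      ring
    · rw [numClass_add, numClass_add, numClass_smul, numClass_sum, numClass_sum, hEc]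
      have s1 : (Pi.single (Fin.succ 0) 1 : Fin 4 → ℤ) = ![0, 1, 0, 0] := by decide
      have s2 : (Pi.single (Fin.succ 1) 1 : Fin 4 → ℤ) = ![0, 0, 1, 0] := by decide
      have s3 : (Pi.single (Fin.succ 2) 1 : Fin 4 → ℤ) = ![0, 0, 0, 1] := by decide
      simp only [numClass_smul, numClass_single, hTc, one_smul, Fin.sum_univ_three,
        PrimeDivisor.numClass, s1, s2, s3]
      have h5 : octagonMap.degree = 5 := rfl
      rw [h5]
      funext j
      fin_cases j <;> simp [stableMatrix, Matrix.mulVec, dotProduct, Fin.sum_univ_succ]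
      ring

namespace RatMap

/-! ### Values and fibres of rational maps -/

lemma value_smul (f : RatMap) (a : ℂ) (x : Fin 3 → ℂ) :
    f.value (a • x) = a ^ f.degree • f.value x :=
  funext fun i => eval_smul_of_isHomogeneous (f.isHomogeneous i) a x

lemma eval_value (f : RatMap) (x : Fin 3 → ℂ) (P : Poly) :
    eval (f.value x) P = eval x (f.pull P) :=
  (eval₂Hom_bind₁ (RingHom.id ℂ) x f.form P).symm

lemma mapsTo_mk_iff (f : RatMap) {x y : Fin 3 → ℂ} (hx : x ≠ 0) (hy : y ≠ 0) :
    f.MapsTo (.mk ℂ x hx) (.mk ℂ y hy) ↔ ∃ a : ℂ, a ≠ 0 ∧ f.value x = a • y := by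
  obtain ⟨s, hs⟩ := Projectivization.exists_smul_eq_mk_rep ℂ x hx
  rw [Units.smul_def] at hs
  have hs0 : (s : ℂ) ^ f.degree ≠ 0 := pow_ne_zero _ s.ne_zero
  simp only [MapsTo, Projectivization.mk_eq_mk_iff', ← hs, value_smul]
  constructor
  · rintro ⟨h, a, ha⟩
    refine ⟨((s : ℂ) ^ f.degree)⁻¹ * a, mul_ne_zero (inv_ne_zero hs0) ?_, ?_⟩
    · rintro rfl
      exact h (by rw [← ha, zero_smul])
    · rw [mul_smul, ha, inv_smul_smul₀ hs0]
  · rintro ⟨a, ha, h⟩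
    refine ⟨smul_ne_zero hs0 (h ▸ smul_ne_zero ha hy), (s : ℂ) ^ f.degree * a, ?_⟩
    rw [h, mul_smul]

lemma mapsTo_iff (f : RatMap) (p q : Plane) :
    f.MapsTo p q ↔ ∃ a : ℂ, a ≠ 0 ∧ f.value p.rep = a • q.rep := by
  rw [← mapsTo_mk_iff f p.rep_nonzero q.rep_nonzero, Projectivization.mk_rep,
    Projectivization.mk_rep]

lemma MapsTo.unique {f : RatMap} {p q q' : Plane} (h : f.MapsTo p q) (h' : f.MapsTo p q') :
    q = q' := h.2.symm.trans h'.2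

/-- A genericity condition need not be homogeneous. If one homogeneous component of P is nonzero at
q, then P(tq) is a nonzero polynomial in t, so some representative t q with t ≠ 0 satisfies the
condition. -/
lemma hasTopologicalDegree_of_eval_ne_zero {f : RatMap} {n : ℕ} {P : Poly} (hP : P ≠ 0)
    (h : ∀ (y : Fin 3 → ℂ) (hy : y ≠ 0), eval y P ≠ 0 →
      {p | f.MapsTo p (.mk ℂ y hy)}.encard = n) : f.HasTopologicalDegree n := by
  obtain ⟨m, hm⟩ := exists_homogeneousComponent_ne_zero hP
  refine ⟨m, homogeneousComponent m P, homogeneousComponent_isHomogeneous m P, hm, fun q hq => ?_⟩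
  set R : Polynomial ℂ := ∑ k ∈ Finset.range (P.totalDegree + 1),
    Polynomial.C (eval q.rep (homogeneousComponent k P)) * Polynomial.X ^ k with hR
  have hm' : m < P.totalDegree + 1 := by
    by_contra! hlt
    exact hm (homogeneousComponent_eq_zero m P (by omega))
  have hR0 : R ≠ 0 := fun h0 => hq (by
    have := congrArg (fun r => Polynomial.coeff r m) h0
    simpa [hR, Polynomial.coeff_C_mul_X_pow, hm'] using this)
  obtain ⟨t, ht⟩ : ∃ t, (Polynomial.X * R).eval t ≠ 0 := by
    by_contra! hall
    exact mul_ne_zero Polynomial.X_ne_zero hR0 (Polynomial.funext (by simpa using hall))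
  rw [Polynomial.eval_mul, Polynomial.eval_X] at ht
  have ht0 := left_ne_zero_of_mul ht
  have hev : eval (t • q.rep) P = R.eval t := by
    conv_lhs => rw [← sum_homogeneousComponent P]
    rw [map_sum, hR, Polynomial.eval_finsetSum]
    refine Finset.sum_congr rfl fun k _ => ?_
    rw [eval_smul_of_isHomogeneous (homogeneousComponent_isHomogeneous k P)]
    rw [Polynomial.eval_mul, Polynomial.eval_C, Polynomial.eval_pow, Polynomial.eval_X, mul_comm]
  have := h (t • q.rep) (smul_ne_zero ht0 q.rep_nonzero) (hev ▸ right_ne_zero_of_mul ht)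
  have hq' : Projectivization.mk ℂ (t • q.rep) (smul_ne_zero ht0 q.rep_nonzero) = q := by
    conv_rhs => rw [← q.mk_rep]
    exact (Projectivization.mk_eq_mk_iff' ℂ _ _ _ _).mpr ⟨t, rfl⟩
  rwa [hq'] at this

/-- Over a general q, the fibre of h is the disjoint union of the fibres of f over the points of the
fibre of g. -/
lemma HasTopologicalDegree.comp {g f h : RatMap} (hc : IsComp g f h) {a b : ℕ}
    (hg : g.HasTopologicalDegree a) (hf : f.HasTopologicalDegree b) (hgd : 0 < g.degree)
    (hhd : 0 < h.degree) : h.HasTopologicalDegree (a * b) := by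
  obtain ⟨c, hc0, hfac⟩ := hc.exists_factor
  obtain ⟨m, hm⟩ : ∃ m, c.IsHomogeneous m := by
    obtain ⟨i, hi⟩ := hc.1
    exact isHomogeneous_of_dvd (f.pull_isHomogeneous (g.isHomogeneous i)) hi
      (Dvd.intro _ (hfac i).symm)
  obtain ⟨k, P, hP, hP0, hfib⟩ := hg
  obtain ⟨l, Q, hQ, hQ0, hfib'⟩ := hf
  -- G₁ contains the image under h of the curve c = 0, where h may be defined while g ∘ f is not. G₂
  -- contains the image under g of the bad locus Q = 0 of f.
  obtain ⟨n₁, G₁, hG₁, hG₁0, hd₁⟩ := h.exists_form_dvd_pull hhd c hc0 m hm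
  obtain ⟨n₂, G₂, hG₂, hG₂0, hd₂⟩ := g.exists_form_dvd_pull hgd Q hQ0 l hQ
  have hval : ∀ x, g.value (f.value x) = eval x c • h.value x := fun x => funext fun i => by
    change eval (f.value x) (g.form i) = _
    rw [eval_value, hfac, map_mul]
    rfl
  refine ⟨_, P * G₁ * G₂, (hP.mul hG₁).mul hG₂, mul_ne_zero (mul_ne_zero hP0 hG₁0) hG₂0,
    fun q hq => ?_⟩
  rw [map_mul, map_mul] at hq
  have hqP := left_ne_zero_of_mul (left_ne_zero_of_mul hq)
  have hqG₁ := right_ne_zero_of_mul (left_ne_zero_of_mul hq)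
  have hqG₂ := right_ne_zero_of_mul hq
  have key : ∀ {φ : RatMap} {H G : Poly} {n : ℕ} {p : Plane}, G.IsHomogeneous n →
      H ∣ φ.pull G → eval q.rep G ≠ 0 → φ.MapsTo p q → eval p.rep H ≠ 0 := by
    intro φ H G n p hG hd hne hpq h0
    obtain ⟨r, hr, hpq⟩ := (φ.mapsTo_iff p q).mp hpq
    obtain ⟨S, hS⟩ := hd
    have : eval (φ.value p.rep) G = 0 := by rw [eval_value, hS, map_mul, h0, zero_mul]
    rw [hpq, eval_smul_of_isHomogeneous hG] at this
    exact mul_ne_zero (pow_ne_zero _ hr) hne this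
  have hunion : {p | h.MapsTo p q} = ⋃ s ∈ {s | g.MapsTo s q}, {p | f.MapsTo p s} := by
    ext p
    simp only [Set.mem_ofPred_eq, Set.mem_iUnion, exists_prop]
    constructor
    · intro hp
      have hcp := key hG₁ hd₁ hqG₁ hp
      obtain ⟨r, hr, hp⟩ := (h.mapsTo_iff p q).mp hp
      have hv := hval p.rep
      rw [hp, smul_smul] at hv
      have hne : f.value p.rep ≠ 0 := by
        intro h0
        rw [h0, ← zero_smul ℂ (0 : Fin 3 → ℂ), value_smul, zero_pow hgd.ne', zero_smul] at hv
        exact smul_ne_zero (mul_ne_zero hcp hr) q.rep_nonzero hv.symm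
      refine ⟨.mk ℂ _ hne, ?_, ⟨hne, rfl⟩⟩
      conv_rhs => rw [← q.mk_rep]
      exact (g.mapsTo_mk_iff hne q.rep_nonzero).mpr ⟨_, mul_ne_zero hcp hr, hv⟩
    · rintro ⟨s, ⟨hs, hs'⟩, hp, rfl⟩
      have hs2 : g.MapsTo (.mk ℂ _ hp) q := ⟨hs, hs'⟩
      rw [← q.mk_rep, mapsTo_mk_iff] at hs2
      obtain ⟨r, hr, hs2⟩ := hs2
      rw [hval] at hs2
      have hcp : eval p.rep c ≠ 0 := by
        intro h0
        rw [h0, zero_smul] at hs2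
        exact smul_ne_zero hr q.rep_nonzero hs2.symm
      refine (h.mapsTo_iff p q).mpr ⟨(eval p.rep c)⁻¹ * r, mul_ne_zero (inv_ne_zero hcp) hr, ?_⟩
      rw [mul_smul, ← hs2, inv_smul_smul₀ hcp]
  have hcard := hfib q hqP
  have hfin : {s | g.MapsTo s q}.Finite := Set.finite_of_encard_eq_coe hcard
  rw [hunion, hfin.encard_biUnion, finsum_mem_congr rfl (g := fun _ => (b : ℕ∞)),
    finsum_mem_eq_finite_toFinset_sum _ hfin, Finset.sum_const, nsmul_eq_mul,
    ← Set.encard_coe_eq_coe_finsetCard, hfin.coe_toFinset, hcard]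
  · push_cast; rfl
  · exact fun s hs => hfib' s (key hG₂ hd₂ hqG₂ hs)
  · intro s _ s' _ hne
    exact Set.disjoint_left.mpr fun p hp hp' => hne (hp.unique hp')

end RatMap

/-! ### The general fibre -/

/-- The binary quintic whose zeros parametrize the fibre over `q`. -/
def quinticForm {R : Type*} [CommRing R] (i : R) (q : Fin 3 → R) (x y : R) : R :=
  ∑ k : Fin 6, fibreCoeff i q k * (x ^ (k : ℕ) * y ^ (5 - (k : ℕ)))

lemma map_quinticForm {R S : Type*} [CommRing R] [CommRing S] (φ : R →+* S) (i : R)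
    (q : Fin 3 → R) (x y : R) :
    φ (quinticForm i q x y) = quinticForm (φ i) (fun k => φ (q k)) (φ x) (φ y) := by
  simp [quinticForm, map_fibreCoeff]

lemma eval_fibrePoly {R : Type*} [CommRing R] (i : R) (q : Fin 3 → R) (t : R) :
    (fibrePoly i q).eval t = quinticForm i q t 1 := by
  simp [fibrePoly, quinticForm, Polynomial.eval_finsetSum]

lemma quinticForm_mul {R : Type*} [CommRing R] (i : R) (q : Fin 3 → R) (x y r : R) :
    quinticForm i q (r * x) (r * y) = r ^ 5 * quinticForm i q x y := by
  rw [quinticForm, quinticForm, Finset.mul_sum]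
  refine Finset.sum_congr rfl fun k _ => ?_
  have : r ^ 5 = r ^ (k : ℕ) * r ^ (5 - (k : ℕ)) := by rw [← pow_add]; congr 1; omega
  rw [mul_pow, mul_pow, this]
  ring

/-- The point with parameter `t` of the line that contains the vertices `v'₁`. -/
def vertexLine {R : Type*} [CommRing R] (i x y : R) : Fin 3 → R := ![x, y, -(1 + i) * x - i * y]

lemma vertexLine_relation {R : Type*} [CommRing R] (i x y : R) :
    (1 + i) * vertexLine i x y 0 + i * vertexLine i x y 1 + vertexLine i x y 2 = 0 := by
  simp [vertexLine]; ring

lemma tauForm_vertexLine {R : Type*} [CommRing R] {i : R} (hi : i ^ 2 = -1) (q : Fin 3 → R)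
    (x y : R) : tauForm i (fun j => q j * vertexLine i x y j) =
      (1 + i) * (q 1 - q 2) * y - 2 * (q 0 + q 2) * x := by
  simp [tauForm, vertexLine]
  linear_combination (q 2 * x + q 2 * y) * hi

/-- A form that vanishes at the points over which the parametrization of the fibre degenerates. -/
def degeneracyForm {R : Type*} [CommRing R] (i : R) (q : Fin 3 → R) : R :=
  -- The parameter used here is the zero of τ on the line containing b; the form is the value of σ
  -- at it.
  sigmaForm i (vertexLine i ((1 + i) * (q 1 - q 2)) (2 * (q 0 + q 2)))
    fun j => q j * vertexLine i ((1 + i) * (q 1 - q 2)) (2 * (q 0 + q 2)) j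

lemma map_degeneracyForm {R S : Type*} [CommRing R] [CommRing S] (φ : R →+* S) (i : R)
    (q : Fin 3 → R) : φ (degeneracyForm i q) = degeneracyForm (φ i) (fun k => φ (q k)) := by
  simp [degeneracyForm, sigmaForm, vertexLine, map_ofNat]

/-- The candidate for the point with parameter `t` of the fibre over `q`. -/
def fibrePoint {R : Type*} [CommRing R] (i : R) (q : Fin 3 → R) (t : R) (j : Fin 3) : R :=
  tauForm i (fun j => q j * vertexLine i t 1 j) * vertexLine i t 1 j -
    sigmaForm i (vertexLine i t 1) (fun j => q j * vertexLine i t 1 j)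

/-- Parameters of points of `ℙ¹` that do not belong to a point of a general fibre. -/
noncomputable def exceptionalParameter : Fin 6 → ℂ × ℂ :=
  -- The first three are the zeros of b₁, b₀ and b₂. The last three are b = L(c) at the base points
  -- c = (1,0,0), (0,0,1), (0,1,0) of c ↦ c Q(c); the fourth base point (i,1,-1) has b₀ = 0.
  ![(1, 0), (0, 1), (-Complex.I, 1 + Complex.I), (-1, 1), (1, 1), (-Complex.I, 2 + Complex.I)]

/-- The conditions under which the fibre over `q` has five points. -/
structure IsGeneric (q : Fin 3 → ℂ) : Prop where
  ne_zero : ∀ j, q j ≠ 0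
  quinticForm_ne_zero : ∀ k, quinticForm Complex.I q (exceptionalParameter k).1
    (exceptionalParameter k).2 ≠ 0
  degeneracyForm_ne_zero : degeneracyForm Complex.I q ≠ 0
  separable : (fibrePoly Complex.I q).Separable

/-- The linear map L kills (1,1,1) and acts as 2(1+i) on the line that contains b. -/
lemma lineForm_fibrePoint {R : Type*} [CommRing R] (i : R) (q : Fin 3 → R) (t : R) (j : Fin 3) :
    lineForm i (fibrePoint i q t) j =
      2 * (1 + i) * tauForm i (fun j => q j * vertexLine i t 1 j) * vertexLine i t 1 j := by
  have h := vertexLine_relation i t 1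
  simp only [lineForm, fibrePoint]
  linear_combination -tauForm i (fun j => q j * vertexLine i t 1 j) * h

namespace IsGeneric

variable {q : Fin 3 → ℂ} {t : ℂ}

lemma mul_ne (hq : IsGeneric q) (ht : quinticForm Complex.I q t 1 = 0) (k : Fin 6) :
    (exceptionalParameter k).2 * t ≠ (exceptionalParameter k).1 := by
  intro h
  apply hq.quinticForm_ne_zero k
  rw [← h]
  conv_lhs => rw [← mul_one (exceptionalParameter k).2]
  rw [mul_assoc, one_mul, quinticForm_mul, ht, mul_zero]

/-- If τ = 0, the candidate point is -σ (1,1,1) with σ ≠ 0, and the quintic says that g is on the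
line (1+i) g₀ + i g₁ + g₂ = 0. Together with τ = 0 this forces g₀ = 0, which is excluded. -/
lemma tauForm_ne_zero (hq : IsGeneric q) (ht : quinticForm Complex.I q t 1 = 0) :
    tauForm Complex.I (fun j => q j * vertexLine Complex.I t 1 j) ≠ 0 := by
  intro hτ
  have hI := Complex.I_sq
  have hsum := incidenceForm_eq_sum hI q (vertexLine Complex.I t 1) (vertexLine_relation _ _ _)
  have hsum' : incidenceForm Complex.I (fun j => q j * vertexLine Complex.I t 1 j)
      (fibrePoint Complex.I q t) = 0 := hsum.trans ht
  have hτ' := hτ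
  rw [tauForm_vertexLine hI] at hτ'
  have hy : (2 * (q 0 + q 2)) ^ 2 * sigmaForm Complex.I (vertexLine Complex.I t 1)
      (fun j => q j * vertexLine Complex.I t 1 j) = degeneracyForm Complex.I q := by
    have hx : (1 + Complex.I) * (q 1 - q 2) = 2 * (q 0 + q 2) * t := by linear_combination hτ'
    rw [degeneracyForm, hx]
    simp [sigmaForm, vertexLine]
    ring
  have hσ : sigmaForm Complex.I (vertexLine Complex.I t 1)
      (fun j => q j * vertexLine Complex.I t 1 j) ≠ 0 := by
    intro h0
    rw [h0, mul_zero] at hy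
    exact hq.degeneracyForm_ne_zero hy.symm
  set g : Fin 3 → ℂ := fun j => q j * vertexLine Complex.I t 1 j with hg
  have hα : (1 + Complex.I) * g 0 + Complex.I * g 1 + g 2 = 0 := by
    refine eq_zero_of_ne_zero_of_mul_right_eq_zero (pow_ne_zero 2 hσ) ?_
    rw [← hsum']
    simp only [incidenceForm, fibrePoint, ← hg, hτ]
    ring
  have g0 : g 0 = 0 := by
    simp only [tauForm] at hτ
    linear_combination (1 / 4) * ((1 - Complex.I) * hα - hτ - (-g 0 - g 1) * hI)
  rcases mul_eq_zero.mp g0 with h | h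
  · exact hq.ne_zero 0 h
  · refine hq.mul_ne ht 1 ?_
    simp [vertexLine] at h
    simp [exceptionalParameter, h]

lemma vertexLine_ne_zero (hq : IsGeneric q) (ht : quinticForm Complex.I q t 1 = 0) (j : Fin 3) :
    vertexLine Complex.I t 1 j ≠ 0 := by
  intro h
  fin_cases j
  · refine hq.mul_ne ht 1 ?_
    simp [vertexLine] at h
    simp [exceptionalParameter, h]
  · simp [vertexLine] at h
  · refine hq.mul_ne ht 2 ?_
    simp [vertexLine] at h
    simp [exceptionalParameter]
    linear_combination -h

/-- The candidate v satisfies both incidences, and these imply that v Q(v) and g are parallel. It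
remains that v Q(v) ≠ 0, and this holds because the base points have excluded parameters. -/
lemma exists_mapForm_fibrePoint (hq : IsGeneric q) (ht : quinticForm Complex.I q t 1 = 0) :
    ∃ a : ℂ, a ≠ 0 ∧ ∀ j, mapForm Complex.I (fibrePoint Complex.I q t) j = a * q j := by
  have hI := Complex.I_sq
  have h1I : (1 + Complex.I) ≠ 0 := one_add_I_ne_zero (K := ℂ)
  have hτ := hq.tauForm_ne_zero ht
  have hb := hq.vertexLine_ne_zero ht
  have hL := lineForm_fibrePoint Complex.I q t
  have hinc : incidenceForm Complex.I (fun j => q j * vertexLine Complex.I t 1 j)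
      (fibrePoint Complex.I q t) = 0 :=
    (incidenceForm_eq_sum hI q (vertexLine Complex.I t 1) (vertexLine_relation _ _ _)).trans ht
  set b := vertexLine Complex.I t 1 with hbdef
  set g : Fin 3 → ℂ := fun j => q j * b j with hg
  set v := fibrePoint Complex.I q t with hv
  have hsig : sigmaForm Complex.I v g = 0 := by
    have hvj : ∀ j, v j = tauForm Complex.I g * b j - sigmaForm Complex.I b g := fun j => rfl
    have h0 := hvj 0
    have h1 := hvj 1
    have h2 := hvj 2
    generalize hs : sigmaForm Complex.I b g = s at h0 h1 h2
    generalize hs' : tauForm Complex.I g = τ at h0 h1 h2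
    simp only [sigmaForm, tauForm] at hs hs' ⊢
    rw [h0, h1, h2]
    linear_combination τ * hs - s * hs'
  have hcross : ∀ j k, v j * conicForm Complex.I v j * g k = v k * conicForm Complex.I v k * g j := by
    simp only [sigmaForm, incidenceForm] at hsig hinc
    have e01 : v 0 * conicForm Complex.I v 0 * g 1 = v 1 * conicForm Complex.I v 1 * g 0 := by
      simp [conicForm]
      linear_combination v 0 * v 1 * hsig - (v 0 - Complex.I * v 1) * hinc -
        (v 0 * v 1 * v 2 * g 1 + v 1 ^ 2 * v 2 * g 0) * hI
    have e02 : v 0 * conicForm Complex.I v 0 * g 2 = v 2 * conicForm Complex.I v 2 * g 0 := by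
      simp [conicForm]
      linear_combination -(Complex.I * v 0 * v 2) * hsig + (v 0 + Complex.I * v 2) * hinc -
        (v 0 * v 1 * v 2 * g 2 + v 1 * v 2 ^ 2 * g 0) * hI
    have e12 : v 1 * conicForm Complex.I v 1 * g 2 = v 2 * conicForm Complex.I v 2 * g 1 := by
      simp [conicForm]
      linear_combination (1 + Complex.I) * v 1 * v 2 * hsig + (v 1 + v 2) * hinc +
        (v 1 ^ 2 * v 2 * g 2 - v 1 * v 2 ^ 2 * g 1) * hI
    intro j k
    fin_cases j <;> fin_cases k <;> first | rfl | assumption | (symm; assumption)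
  have hw : 2 * (1 + Complex.I) * tauForm Complex.I g ≠ 0 :=
    mul_ne_zero (mul_ne_zero two_ne_zero h1I) hτ
  set w := 2 * (1 + Complex.I) * tauForm Complex.I g
  have hLne : ∀ j, lineForm Complex.I v j ≠ 0 := fun j => by
    rw [hL]; exact mul_ne_zero hw (hb j)
  have hprop : ∀ j k, mapForm Complex.I v j * q k = mapForm Complex.I v k * q j := by
    intro j k
    have hbb : b 0 * b 1 * b 2 ≠ 0 := mul_ne_zero (mul_ne_zero (hb 0) (hb 1)) (hb 2)
    have hM : ∀ j, mapForm Complex.I v j * b j =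
        v j * conicForm Complex.I v j * (w ^ 2 * (b 0 * b 1 * b 2)) := fun j => by
      fin_cases j <;> simp [mapForm, hL] <;> ring
    refine mul_right_cancel₀ (mul_ne_zero (hb j) (hb k)) ?_
    linear_combination q k * b k * hM j - q j * b j * hM k +
      w ^ 2 * (b 0 * b 1 * b 2) * hcross j k
  obtain ⟨l, hl⟩ : ∃ l, v l * conicForm Complex.I v l ≠ 0 := by
    by_contra! hall
    have l0 : lineForm Complex.I v 0 = (1 + Complex.I) * v 0 - Complex.I * v 1 - v 2 := by
      simp only [lineForm]; ring
    have l1 : lineForm Complex.I v 1 =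
        -(1 + Complex.I) * v 0 + (2 + Complex.I) * v 1 - v 2 := by
      simp only [lineForm]; ring
    have hb0 : b 0 = t := rfl
    have hb1 : b 1 = 1 := rfl
    rw [hL, hb0] at l0
    rw [hL, hb1] at l1
    change w * _ = _ at l0 l1
    rcases eq_zero_or_eq_zero_of_mul_conicForm_eq_zero hI two_ne_zero hall with h | h | h | h
    · refine hq.mul_ne ht 4 (mul_left_cancel₀ hw ?_)
      simp [exceptionalParameter]
      rw [h.1, h.2] at l0 l1
      linear_combination l0 - l1
    · refine hq.mul_ne ht 5 (mul_left_cancel₀ hw ?_)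
      simp [exceptionalParameter]
      rw [h.1, h.2] at l0 l1
      linear_combination (2 + Complex.I) * l0 + Complex.I * l1
    · refine hq.mul_ne ht 3 (mul_left_cancel₀ hw ?_)
      simp [exceptionalParameter]
      rw [h.1, h.2] at l0 l1
      linear_combination l0 + l1
    · refine hq.mul_ne ht 1 (mul_left_cancel₀ hw ?_)
      simp [exceptionalParameter]
      have := hLne 0
      rw [hL, hb0] at this
      exact absurd (by
        change w * t = 0
        linear_combination l0 + (1 + Complex.I) * h.2 - h.1 + v 1 * hI) this
  have hMl : mapForm Complex.I v l ≠ 0 := mul_ne_zero (mul_ne_zero hl (hLne _)) (hLne _)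
  refine ⟨mapForm Complex.I v l / q l, div_ne_zero hMl (hq.ne_zero l), fun j => ?_⟩
  have := hprop l j
  field_simp [hq.ne_zero l]
  linear_combination -this

/-- A point of the fibre is recovered from the ratio L₀/L₁ alone, because 2(1+i) c = b + s (1,1,1)
and s is determined by τ s + σ = 0, up to the scale of b. -/
lemma eq_smul_fibrePoint (hq : IsGeneric q) {c : Fin 3 → ℂ} {a : ℂ} (ha : a ≠ 0)
    (hc : ∀ j, mapForm Complex.I c j = a * q j) :
    quinticForm Complex.I q (lineForm Complex.I c 0 / lineForm Complex.I c 1) 1 = 0 ∧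
      ∃ r : ℂ, ∀ j, c j = r *
        fibrePoint Complex.I q (lineForm Complex.I c 0 / lineForm Complex.I c 1) j := by
  have hI := Complex.I_sq
  have h1I : (1 + Complex.I) ≠ 0 := one_add_I_ne_zero (K := ℂ)
  have hM : ∀ j, mapForm Complex.I c j ≠ 0 := fun j => by
    rw [hc]; exact mul_ne_zero ha (hq.ne_zero j)
  have hb : ∀ j, lineForm Complex.I c j ≠ 0 := fun j h0 => by
    apply hM (j + 1)
    have : j + 1 + 2 = j := by fin_cases j <;> decide
    rw [mapForm, this, h0, mul_zero]
  obtain ⟨-, hst, hsum⟩ := relations_of_fibre hI (q := q) hb ⟨0, hM 0⟩ fun j k => by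
    rw [hc, hc]; ring
  set t := lineForm Complex.I c 0 / lineForm Complex.I c 1 with ht
  have hbt : lineForm Complex.I c = fun j => lineForm Complex.I c 1 * vertexLine Complex.I t 1 j := by
    have hrel := lineForm_relation Complex.I c
    have h0 : lineForm Complex.I c 0 = lineForm Complex.I c 1 * t := by
      rw [ht]; field_simp [hb 1]
    funext j
    fin_cases j <;> simp [vertexLine]
    · exact h0
    · linear_combination hrel - (1 + Complex.I) * h0
  have hroot : quinticForm Complex.I q t 1 = 0 := by
    have h : quinticForm Complex.I q (lineForm Complex.I c 0) (lineForm Complex.I c 1) = 0 := hsum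
    have h0 : lineForm Complex.I c 0 = lineForm Complex.I c 1 * t := by
      rw [ht]; field_simp [hb 1]
    rw [h0] at h
    nth_rewrite 2 [← mul_one (lineForm Complex.I c 1)] at h
    rw [quinticForm_mul] at h
    exact (mul_eq_zero.mp h).resolve_left (pow_ne_zero _ (hb 1))
  have hτ := hq.tauForm_ne_zero hroot
  refine ⟨hroot, lineForm Complex.I c 1 /
    (2 * (1 + Complex.I) * tauForm Complex.I fun j => q j * vertexLine Complex.I t 1 j),
    fun j => ?_⟩
  have hj := congrFun hbt j
  have hj' : lineForm Complex.I c j = 2 * (1 + Complex.I) * c j -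
    ((1 + Complex.I) * c 0 + Complex.I * c 1 + c 2) := rfl
  generalize (1 + Complex.I) * c 0 + Complex.I * c 1 + c 2 = s at hst hj'
  rw [hbt] at hst
  have hst' : lineForm Complex.I c 1 * sigmaForm Complex.I (vertexLine Complex.I t 1)
      (fun j => q j * vertexLine Complex.I t 1 j) +
      s * tauForm Complex.I (fun j => q j * vertexLine Complex.I t 1 j) = 0 := by
    refine eq_zero_of_ne_zero_of_mul_left_eq_zero (hb 1) ?_
    rw [← hst]
    simp only [sigmaForm, tauForm]
    ring
  simp only [fibrePoint]
  field_simp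
  linear_combination (tauForm Complex.I fun j => q j * vertexLine Complex.I t 1 j) * (hj - hj') + hst'

end IsGeneric

/-! ### The topological degree -/

/-- The diagonal coordinates of a vector. -/
noncomputable def coordVec (x : Fin 3 → ℂ) (j : Fin 3) : ℂ := eval x (coord j)

lemma coordVec_smul (a : ℂ) (x : Fin 3 → ℂ) : coordVec (a • x) = a • coordVec x := by
  funext j
  rw [coordVec, eval_smul_of_isHomogeneous (coord_isHomogeneous j), pow_one]
  rfl

lemma fromCoord_coordVec (x : Fin 3 → ℂ) : fromCoord (coordVec x) = x := fromCoord_eval_coord x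

lemma coordVec_fromCoord (c : Fin 3 → ℂ) : coordVec (fromCoord c) = c := by
  funext j
  rw [coordVec, eval_fromCoord_coord]

lemma coordVec_injective : Function.Injective coordVec := fun x y h => by
  rw [← fromCoord_coordVec x, h, fromCoord_coordVec]

lemma coordVec_zero : coordVec 0 = 0 := by
  rw [← zero_smul ℂ (0 : Fin 3 → ℂ), coordVec_smul, zero_smul, zero_smul]

lemma coordVec_octagonMap_value (x : Fin 3 → ℂ) :
    coordVec (octagonMap.value x) = mapForm Complex.I (coordVec x) := by
  funext j
  rw [coordVec, RatMap.eval_value, octagonMap_pull_coord, eval_mapForm]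
  rfl

lemma octagonMap_mapsTo_mk_iff {x y : Fin 3 → ℂ} (hx : x ≠ 0) (hy : y ≠ 0) :
    octagonMap.MapsTo (.mk ℂ x hx) (.mk ℂ y hy) ↔
      ∃ a : ℂ, a ≠ 0 ∧ ∀ j, mapForm Complex.I (coordVec x) j = a * coordVec y j := by
  rw [RatMap.mapsTo_mk_iff]
  refine exists_congr fun a => and_congr_right fun _ => ?_
  rw [← coordVec_injective.eq_iff, coordVec_octagonMap_value, coordVec_smul, funext_iff]
  rfl

/-- The ratio L₀/L₁ is a bijection from the fibre to the roots of the quintic. There are five,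
because the quintic is separable and the excluded parameter (1,0) makes its leading coefficient
nonzero. -/
lemma IsGeneric.encard_fibre {y : Fin 3 → ℂ} (hy : y ≠ 0) (hq : IsGeneric (coordVec y)) :
    {p | octagonMap.MapsTo p (.mk ℂ y hy)}.encard = 5 := by
  set q := coordVec y with hqdef
  set ratio : Plane → ℂ := fun p =>
    lineForm Complex.I (coordVec p.rep) 0 / lineForm Complex.I (coordVec p.rep) 1 with hratio
  have hmem : ∀ p, octagonMap.MapsTo p (.mk ℂ y hy) ↔ ∃ a : ℂ, a ≠ 0 ∧
      ∀ j, mapForm Complex.I (coordVec p.rep) j = a * q j := fun p => by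
    rw [← octagonMap_mapsTo_mk_iff p.rep_nonzero hy, Projectivization.mk_rep]
  have hinj : Set.InjOn ratio {p | octagonMap.MapsTo p (.mk ℂ y hy)} := by
    intro p hp p' hp' hpp
    obtain ⟨a, ha, hp⟩ := (hmem p).mp hp
    obtain ⟨a', ha', hp'⟩ := (hmem p').mp hp'
    obtain ⟨-, r, hr⟩ := hq.eq_smul_fibrePoint ha hp
    obtain ⟨-, r', hr'⟩ := hq.eq_smul_fibrePoint ha' hp'
    change ∀ j, _ = r * fibrePoint Complex.I q (ratio p) j at hr
    change ∀ j, _ = r' * fibrePoint Complex.I q (ratio p') j at hr'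
    rw [← hpp] at hr'
    have hr0 : r' ≠ 0 := by
      rintro rfl
      refine p'.rep_nonzero (coordVec_injective ?_)
      rw [coordVec_zero]
      funext j
      rw [hr', zero_mul]; rfl
    rw [← p.mk_rep, ← p'.mk_rep, Projectivization.mk_eq_mk_iff']
    refine ⟨r / r', coordVec_injective ?_⟩
    rw [coordVec_smul]
    funext j
    rw [Pi.smul_apply, hr, hr', smul_eq_mul]
    field_simp
  have himage : ratio '' {p | octagonMap.MapsTo p (.mk ℂ y hy)} =
      ((fibrePoly Complex.I q).roots.toFinset : Set ℂ) := by
    ext t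
    rw [Finset.mem_coe, Multiset.mem_toFinset, Polynomial.mem_roots hq.separable.ne_zero,
      Polynomial.IsRoot, eval_fibrePoly]
    constructor
    · rintro ⟨p, hp, rfl⟩
      obtain ⟨a, ha, hp⟩ := (hmem p).mp hp
      exact (hq.eq_smul_fibrePoint ha hp).1
    · intro ht
      obtain ⟨a, ha, hv⟩ := hq.exists_mapForm_fibrePoint ht
      have hv0 : fromCoord (fibrePoint Complex.I q t) ≠ 0 := by
        intro h0
        have h1 := coordVec_fromCoord (fibrePoint Complex.I q t)
        rw [h0, coordVec_zero] at h1
        have h2 := lineForm_fibrePoint Complex.I q t 1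
        rw [← h1] at h2
        simp only [lineForm, Pi.zero_apply, mul_zero, add_zero, sub_zero] at h2
        exact mul_ne_zero (mul_ne_zero (mul_ne_zero two_ne_zero (one_add_I_ne_zero (K := ℂ)))
          (hq.tauForm_ne_zero ht)) (hq.vertexLine_ne_zero ht 1) h2.symm
      refine ⟨.mk ℂ _ hv0, (octagonMap_mapsTo_mk_iff hv0 hy).mpr ⟨a, ha, ?_⟩, ?_⟩
      · rwa [coordVec_fromCoord]
      · obtain ⟨s, hs⟩ := Projectivization.exists_smul_eq_mk_rep ℂ _ hv0
        have hlin : ∀ j, lineForm Complex.I (coordVec (Projectivization.mk ℂ _ hv0).rep) j =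
            s * (2 * (1 + Complex.I) * tauForm Complex.I
              (fun j => q j * vertexLine Complex.I t 1 j)) * vertexLine Complex.I t 1 j := by
          intro j
          rw [← hs, Units.smul_def, coordVec_smul, coordVec_fromCoord, mul_assoc,
            ← lineForm_fibrePoint]
          simp only [lineForm, Pi.smul_apply, smul_eq_mul]
          ring
        have hne : (s : ℂ) * (2 * (1 + Complex.I) * tauForm Complex.I
            (fun j => q j * vertexLine Complex.I t 1 j)) ≠ 0 := mul_ne_zero s.ne_zero (mul_ne_zero (mul_ne_zero two_ne_zero
          (one_add_I_ne_zero (K := ℂ))) (hq.tauForm_ne_zero ht))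
        simp only [hratio, hlin]
        rw [mul_div_mul_left _ _ hne]
        simp [vertexLine]
  have h5 : (fibrePoly Complex.I q).natDegree = 5 := by
    refine le_antisymm (natDegree_fibrePoly_le _ _) (Polynomial.le_natDegree_of_ne_zero ?_)
    have h1 := coeff_fibrePoly Complex.I q 5
    have h2 := hq.quinticForm_ne_zero 0
    simp [quinticForm, exceptionalParameter, Fin.sum_univ_succ] at h2
    rw [show (5 : ℕ) = ((5 : Fin 6) : ℕ) from rfl, h1]
    exact h2
  rw [← hinj.encard_image, himage, Set.encard_coe_eq_coe_finsetCard,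
    Multiset.toFinset_card_of_nodup (Polynomial.nodup_roots hq.separable),
    ← (IsAlgClosed.splits _).natDegree_eq_card_roots, h5]
  rfl

lemma map_fibrePoly {R S : Type*} [CommRing R] [CommRing S] (φ : R →+* S) (i : R)
    (q : Fin 3 → R) :
    (fibrePoly i q).map φ = fibrePoly (φ i) (fun k => φ (q k)) := by
  simp only [fibrePoly, Polynomial.map_sum, Polynomial.map_mul, Polynomial.map_pow,
    Polynomial.map_C, Polynomial.map_X, map_fibreCoeff φ]

lemma natDegree_derivative_fibrePoly_le {R : Type*} [CommRing R] (i : R) (q : Fin 3 → R) :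
    (Polynomial.derivative (fibrePoly i q)).natDegree ≤ 4 :=
  (Polynomial.natDegree_derivative_le _).trans (by have := natDegree_fibrePoly_le i q; omega)

/-- The discriminant of the quintic that parametrizes the fibre. -/
noncomputable def fibreDiscriminant {R : Type*} [CommRing R] (i : R) (q : Fin 3 → R) : R :=
  -- The formal degrees 5 and 4 are prescribed, so the resultant commutes with specialization even
  -- if the degree drops.
  Polynomial.resultant (fibrePoly i q) (Polynomial.derivative (fibrePoly i q)) 5 4

lemma map_fibreDiscriminant {R S : Type*} [CommRing R] [CommRing S] (φ : R →+* S) (i : R)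
    (q : Fin 3 → R) :
    φ (fibreDiscriminant i q) = fibreDiscriminant (φ i) (fun k => φ (q k)) := by
  rw [fibreDiscriminant, ← Polynomial.resultant_map_map, ← Polynomial.derivative_map,
    map_fibrePoly]
  rfl

lemma separable_of_fibreDiscriminant_ne_zero {q : Fin 3 → ℂ}
    (h : fibreDiscriminant Complex.I q ≠ 0) : (fibrePoly Complex.I q).Separable := by
  obtain ⟨a, b, -, -, hab⟩ := Polynomial.exists_mul_add_mul_eq_C_resultant
    (fibrePoly Complex.I q) (Polynomial.derivative (fibrePoly Complex.I q))
    (natDegree_fibrePoly_le _ _) (natDegree_derivative_fibrePoly_le _ _) (m := 5) (n := 4)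
    (by norm_num)
  refine ⟨Polynomial.C (fibreDiscriminant Complex.I q)⁻¹ * a,
    Polynomial.C (fibreDiscriminant Complex.I q)⁻¹ * b, ?_⟩
  have hC : Polynomial.C (fibreDiscriminant Complex.I q)⁻¹ *
      Polynomial.C (fibreDiscriminant Complex.I q) = 1 := by
    rw [← Polynomial.C_mul, inv_mul_cancel₀ h, Polynomial.C_1]
  rw [fibreDiscriminant] at hC ⊢
  linear_combination Polynomial.C (Polynomial.resultant (fibrePoly Complex.I q)
    (Polynomial.derivative (fibrePoly Complex.I q)) 5 4)⁻¹ * hab + hC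

/-- One point suffices to see that the discriminant does not vanish identically. At this q the
quintic has few terms and still has degree 5. -/
lemma fibreDiscriminant_ne_zero : fibreDiscriminant Complex.I ![0, 1, -1] ≠ 0 := by
  have hI := Complex.I_sq
  set p := fibrePoly Complex.I ![0, 1, -1] with hp
  have hcoeff : fibreCoeff Complex.I ![0, 1, -1] = ![0, 4 * Complex.I - 4, 16 * Complex.I,
      10 + 10 * Complex.I, 4 - 4 * Complex.I, -2 - 2 * Complex.I] := by
    funext k
    fin_cases k <;> simp [fibreCoeff] <;> ring
  have hpe : p = Polynomial.C (4 * Complex.I - 4) * Polynomial.X +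
      Polynomial.C (16 * Complex.I) * Polynomial.X ^ 2 +
      Polynomial.C (10 + 10 * Complex.I) * Polynomial.X ^ 3 +
      Polynomial.C (4 - 4 * Complex.I) * Polynomial.X ^ 4 +
      Polynomial.C (-2 - 2 * Complex.I) * Polynomial.X ^ 5 := by
    rw [hp, fibrePoly, hcoeff, Fin.sum_univ_six]
    simp only [Matrix.cons_val, Polynomial.C_0, zero_mul, zero_add]
    simp [pow_succ]
  have h5 : p.natDegree = 5 := by
    rw [hpe]
    compute_degree!
    intro h
    simpa using congrArg Complex.re h
  have h4 : (Polynomial.derivative p).natDegree = 4 := by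
    rw [Polynomial.natDegree_derivative, h5]
  have hcop : IsCoprime p (Polynomial.derivative p) := by
    rw [Polynomial.isCoprime_iff_aeval_ne_zero_of_isAlgClosed ℂ ℂ]
    intro T
    by_contra! hT
    rw [hpe] at hT
    obtain ⟨h1, h2⟩ := hT
    rw [Polynomial.derivative_add, Polynomial.derivative_add, Polynomial.derivative_add,
      Polynomial.derivative_add] at h2
    simp only [Polynomial.derivative_C_mul, Polynomial.derivative_X,
      Polynomial.derivative_X_pow] at h2
    simp only [map_add, map_mul, Polynomial.aeval_X, Polynomial.aeval_C, map_pow,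
      Algebra.algebraMap_self, RingHom.id_apply, map_one, Nat.cast_ofNat] at h1 h2
    refine one_ne_zero (α := ℂ) ?_
    -- A Bézout identity for the quintic and its derivative, evaluated at T and valid modulo i² + 1.
    linear_combination ((221 / 112 + 93 / 112 * Complex.I) +
      (883 / 224 + 269 / 224 * Complex.I) * T + (6 / 7 - 99 / 56 * Complex.I) * T ^ 2 -
      (55 / 32 + 95 / 224 * Complex.I) * T ^ 3) * h1 + (-(1 / 8 + 1 / 8 * Complex.I) -
      (109 / 112 + 93 / 112 * Complex.I) * T - (313 / 224 + 95 / 224 * Complex.I) * T ^ 2 +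
      (55 / 112 * Complex.I - 23 / 112) * T ^ 3 + (11 / 32 + 19 / 224 * Complex.I) * T ^ 4) * h2 -
      (-1 / 2 - 4 * T - 195 / 14 * T ^ 2 - 197 / 14 * T ^ 3 - 24 / 7 * T ^ 4 + 45 / 28 * T ^ 5 -
        9 / 14 * T ^ 6 - 29 / 28 * T ^ 7) * hI
  intro h0
  rw [fibreDiscriminant, ← hp] at h0
  have := (Polynomial.resultant_eq_zero_iff (f := p) (g := Polynomial.derivative p)).mp
    (by rw [h5, h4]; exact h0)
  exact this.2 hcop

/-- A polynomial that vanishes at no point over which the fibre fails to have five points. -/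
noncomputable def genericityForm : Poly :=
  (∏ j, coord j) * (∏ k, quinticForm (C Complex.I) coord (C (exceptionalParameter k).1)
    (C (exceptionalParameter k).2)) * degeneracyForm (C Complex.I) coord *
    fibreDiscriminant (C Complex.I) coord

lemma isGeneric_of_eval_ne_zero {y : Fin 3 → ℂ} (h : eval y genericityForm ≠ 0) :
    IsGeneric (coordVec y) := by
  simp only [genericityForm, map_mul, map_prod, map_quinticForm, map_degeneracyForm,
    map_fibreDiscriminant, eval_C, mul_ne_zero_iff, Finset.prod_ne_zero_iff, Finset.mem_univ,
    forall_true_left] at h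
  obtain ⟨⟨⟨h1, h2⟩, h3⟩, h4⟩ := h
  exact ⟨h1, h2, h3, separable_of_fibreDiscriminant_ne_zero h4⟩

lemma quinticForm_ne_zero_of_exceptionalParameter (k : Fin 6) :
    ∃ q : Fin 3 → ℂ, quinticForm Complex.I q (exceptionalParameter k).1
      (exceptionalParameter k).2 ≠ 0 := by
  have h1 : ∀ x y : ℂ, quinticForm Complex.I ![1, 0, 0] x y =
      (2 - 2 * Complex.I) * (x ^ 3 * (x + y) ^ 2) := fun x y => by
    simp [quinticForm, Fin.sum_univ_succ, fibreCoeff]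
    ring
  have h2 : ∀ x y : ℂ, quinticForm Complex.I ![0, 1, 0] x y =
      y ^ 3 * (-y ^ 2 + (4 * Complex.I - 2) * x * y + (3 + 4 * Complex.I) * x ^ 2) := fun x y => by
    simp [quinticForm, Fin.sum_univ_succ, fibreCoeff]
    ring
  have hI : (2 - 2 * Complex.I) ≠ 0 := fun h => by simpa using congrArg Complex.re h
  have key : ∀ x y : ℂ, x ≠ 0 → x + y ≠ 0 → quinticForm Complex.I ![1, 0, 0] x y ≠ 0 :=
    fun x y hx hxy => by
      rw [h1]
      exact mul_ne_zero hI (mul_ne_zero (pow_ne_zero _ hx) (pow_ne_zero _ hxy))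
  fin_cases k
  · exact ⟨![1, 0, 0], key _ _ (by simp [exceptionalParameter]) (by simp [exceptionalParameter])⟩
  · refine ⟨![0, 1, 0], ?_⟩
    rw [h2]
    simp [exceptionalParameter]
  · exact ⟨![1, 0, 0], key _ _ (by simp [exceptionalParameter]) (by simp [exceptionalParameter])⟩
  · refine ⟨![0, 1, 0], ?_⟩
    rw [h2]
    simp [exceptionalParameter]
    intro h
    have := congrArg Complex.re h
    norm_num at this
  · refine ⟨![1, 0, 0], key _ _ (by simp [exceptionalParameter]) ?_⟩
    simp [exceptionalParameter]
  · exact ⟨![1, 0, 0], key _ _ (by simp [exceptionalParameter]) (by simp [exceptionalParameter])⟩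

lemma genericityForm_ne_zero : genericityForm ≠ 0 := by
  have hev : ∀ q : Fin 3 → ℂ, (fun j => eval (fromCoord q) (coord j)) = q := coordVec_fromCoord
  refine mul_ne_zero (mul_ne_zero (mul_ne_zero ?_ ?_) ?_) ?_
  · exact Finset.prod_ne_zero_iff.mpr fun j _ => coord_ne_zero j
  · refine Finset.prod_ne_zero_iff.mpr fun k _ h0 => ?_
    obtain ⟨q, hq⟩ := quinticForm_ne_zero_of_exceptionalParameter k
    have := congrArg (eval (fromCoord q)) h0
    rw [map_quinticForm, map_zero, eval_C, eval_C, eval_C, hev] at this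
    exact hq this
  · intro h0
    have := congrArg (eval (fromCoord ![1, 1, 0])) h0
    rw [map_degeneracyForm, map_zero, eval_C, hev] at this
    simp [degeneracyForm, sigmaForm, vertexLine] at this
    have := congrArg Complex.re this
    norm_num at this
  · intro h0
    have := congrArg (eval (fromCoord ![0, 1, -1])) h0
    rw [map_fibreDiscriminant, map_zero, eval_C, hev] at this
    exact fibreDiscriminant_ne_zero this

lemma octagonMap_hasTopologicalDegree : octagonMap.HasTopologicalDegree 5 :=
  RatMap.hasTopologicalDegree_of_eval_ne_zero genericityForm_ne_zero fun _ hy h =>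
    (isGeneric_of_eval_ne_zero h).encard_fibre hy

lemma RatMap.HasTopologicalDegree.dominant {f : RatMap} {n : ℕ} (hn : n ≠ 0)
    (h : f.HasTopologicalDegree n) : f.Dominant := by
  obtain ⟨k, P, hP, hP0, hfib⟩ := h
  intro m Q hQ hQ0
  -- The factor X 0 only ensures that x is not the zero vector.
  obtain ⟨x, hx⟩ : ∃ x, eval x (X 0 * (P * Q)) ≠ 0 := by
    by_contra! hall
    exact mul_ne_zero (X_ne_zero 0) (mul_ne_zero hP0 hQ0) (MvPolynomial.funext (by simpa using hall))
  rw [map_mul, map_mul, eval_X] at hx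
  have hx0 : x ≠ 0 := fun h => left_ne_zero_of_mul hx (by rw [h]; rfl)
  obtain ⟨s, hs⟩ := Projectivization.exists_smul_eq_mk_rep ℂ x hx0
  rw [Units.smul_def] at hs
  have hne : ∀ {R : Poly} {r : ℕ}, R.IsHomogeneous r → eval x R ≠ 0 →
      eval (Projectivization.mk ℂ x hx0).rep R ≠ 0 := fun hR h0 => by
    rw [← hs, eval_smul_of_isHomogeneous hR]
    exact mul_ne_zero (pow_ne_zero _ s.ne_zero) h0
  have hcard := hfib _ (hne hP (left_ne_zero_of_mul (right_ne_zero_of_mul hx)))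
  obtain ⟨p, hp⟩ : {p | f.MapsTo p (.mk ℂ x hx0)}.Nonempty := by
    rw [← Set.encard_ne_zero, hcard]
    exact_mod_cast hn
  exact ⟨p, _, hp, hne hQ (right_ne_zero_of_mul (right_ne_zero_of_mul hx))⟩

/-! ### Iterates -/

lemma identity_hasTopologicalDegree : RatMap.identity.HasTopologicalDegree 1 := by
  refine ⟨0, 1, isHomogeneous_one _ _, one_ne_zero, fun q _ => ?_⟩
  have : {p | RatMap.identity.MapsTo p q} = {q} := by
    have hv : ∀ x, RatMap.identity.value x = x := fun x => by
      funext i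
      simp [RatMap.value, RatMap.identity]
    ext p
    rw [Set.mem_ofPred_eq, Set.mem_singleton_iff, RatMap.mapsTo_iff, hv]
    constructor
    · rintro ⟨a, -, h⟩
      rw [← p.mk_rep, ← q.mk_rep, Projectivization.mk_eq_mk_iff']
      exact ⟨a, h.symm⟩
    · rintro rfl
      exact ⟨1, one_ne_zero, (one_smul _ _).symm⟩
  rw [this, Set.encard_singleton]
  rfl

/-- Row vectors of the shape (a, b, b, b) are preserved: they become (5a - 3b, a + b, a + b, a + b).
This action has eigenvalues 4 and 2, and doubling keeps the closed formulas integral. -/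
lemma stableMatrix_pow_zero_zero (m : ℕ) : 2 * (stableMatrix ^ m) 0 0 = 3 * 4 ^ m - 2 ^ m := by
  suffices h : ∀ m, 2 * (stableMatrix ^ m) 0 0 = 3 * 4 ^ m - 2 ^ m ∧
      ∀ k : Fin 3, 2 * (stableMatrix ^ m) 0 k.succ = 4 ^ m - 2 ^ m from (h m).1
  intro m
  induction m with
  | zero =>
    refine ⟨by simp, fun k => ?_⟩
    rw [pow_zero, Matrix.one_apply_ne (Fin.succ_ne_zero k).symm]
    simp
  | succ m ih =>
    obtain ⟨h0, hk⟩ := ih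
    have e1 := hk 0
    have e2 := hk 1
    have e3 := hk 2
    simp only [pow_succ, Matrix.mul_apply, Fin.sum_univ_four]
    simp only [Fin.succ_zero_eq_one, Fin.succ_one_eq_two] at e1 e2
    have e3 : 2 * (stableMatrix ^ m) 0 3 = 4 ^ m - 2 ^ m := e3
    refine ⟨?_, fun k => ?_⟩
    · simp [stableMatrix] at h0 e1 e2 e3 ⊢
      linarith
    · fin_cases k <;> simp [stableMatrix] at h0 e1 e2 e3 ⊢ <;> linarith

lemma octagonMap_isComp_of_nonContracting {g : RatMap} (hg : g.NonContracting) :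
    ∃ h, RatMap.IsComp octagonMap g h := by
  obtain ⟨i, hi⟩ := octagonMap.exists_form_ne_zero
  exact RatMap.exists_isComp _ _ ⟨i, hg.pull_ne_zero _ _ (octagonMap.isHomogeneous i) hi⟩

lemma identity_nonContracting : RatMap.identity.NonContracting := fun B =>
  ⟨B, 1, RatMap.identity_transports B⟩

/-- The iterates of the map, with the fact that they contract no curve on the blowup. -/
noncomputable def octagonIterateAux : ℕ → {g : RatMap // g.NonContracting}
  | 0 => ⟨RatMap.identity, identity_nonContracting⟩
  | m + 1 => ⟨(octagonMap_isComp_of_nonContracting (octagonIterateAux m).2).choose,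
      RatMap.NonContracting.comp
        (octagonMap_isComp_of_nonContracting (octagonIterateAux m).2).choose_spec
        (octagonIterateAux m).2 octagonMap_nonContracting⟩

/-- The iterates of the map. -/
noncomputable def octagonIterate (m : ℕ) : RatMap := (octagonIterateAux m).1

lemma octagonIterate_nonContracting (m : ℕ) : (octagonIterate m).NonContracting :=
  (octagonIterateAux m).2

lemma octagonIterate_isComp (m : ℕ) :
    RatMap.IsComp octagonMap (octagonIterate m) (octagonIterate (m + 1)) :=
  (octagonMap_isComp_of_nonContracting (octagonIterateAux m).2).choose_spec

lemma octagonIterate_isIterates : RatMap.IsIterates octagonMap octagonIterate :=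
  ⟨rfl, octagonIterate_isComp⟩

lemma octagonIterate_hasPullbackMatrix (m : ℕ) :
    (octagonIterate m).HasPullbackMatrix (stableMatrix ^ m) := by
  induction m with
  | zero => rw [pow_zero]; exact RatMap.identity_hasPullbackMatrix
  | succ m ih =>
    rw [pow_succ]
    exact RatMap.HasPullbackMatrix.comp (octagonIterate_isComp m) (octagonIterate_nonContracting m)
      octagonMap_nonContracting ih octagonMap_hasPullbackMatrix

lemma two_mul_degree_octagonIterate (m : ℕ) :
    (2 * (octagonIterate m).degree : ℤ) = 3 * 4 ^ m - 2 ^ m := by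
  rw [RatMap.degree_eq_of_hasPullbackMatrix (octagonIterate_nonContracting m).pull_ne_zero
    (octagonIterate_hasPullbackMatrix m), stableMatrix_pow_zero_zero]

lemma four_pow_le_degree_octagonIterate (m : ℕ) : 4 ^ m ≤ (octagonIterate m).degree := by
  have h := two_mul_degree_octagonIterate m
  have h2 : (2 : ℤ) ^ m ≤ 4 ^ m := pow_le_pow_left₀ (by norm_num) (by norm_num) m
  have : (4 ^ m : ℤ) ≤ (octagonIterate m).degree := by linarith
  exact_mod_cast this

lemma degree_octagonIterate_le (m : ℕ) : (octagonIterate m).degree ≤ 2 * 4 ^ m := by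
  have h := two_mul_degree_octagonIterate m
  have h2 : (0 : ℤ) < 2 ^ m := by positivity
  have h3 : (0 : ℤ) < 4 ^ m := by positivity
  have : ((octagonIterate m).degree : ℤ) ≤ 2 * 4 ^ m := by linarith
  exact_mod_cast this

lemma octagonIterate_hasTopologicalDegree (m : ℕ) :
    (octagonIterate m).HasTopologicalDegree (5 ^ m) := by
  induction m with
  | zero => rw [pow_zero]; exact identity_hasTopologicalDegree
  | succ m ih =>
    rw [pow_succ, mul_comm]
    exact RatMap.HasTopologicalDegree.comp (octagonIterate_isComp m)
      octagonMap_hasTopologicalDegree ih (show 0 < 5 by norm_num)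
      ((pow_pos four_pos _).trans_le (four_pow_le_degree_octagonIterate _))

lemma octagonMap_hasFirstDynamicalDegree : octagonMap.HasFirstDynamicalDegree 4 := by
  refine ⟨octagonIterate, octagonIterate_isIterates, ?_⟩
  have hroot : ∀ m : ℕ, m ≠ 0 → ((4 : ℝ) ^ m) ^ (1 / (m : ℝ)) = 4 := fun m hm => by
    rw [one_div, Real.pow_rpow_inv_natCast (by norm_num) hm]
  have hlim : Filter.Tendsto (fun m : ℕ => (2 : ℝ) ^ (1 / (m : ℝ)) * 4) Filter.atTop (nhds 4) := by
    have h1 : Filter.Tendsto (fun m : ℕ => (2 : ℝ) ^ (1 / (m : ℝ))) Filter.atTop (nhds 1) := by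
      have := (Real.continuousAt_const_rpow (a := 2) (b := 0) two_ne_zero).tendsto.comp
        tendsto_one_div_atTop_nhds_zero_nat
      simpa [Function.comp_def] using this
    simpa using h1.mul_const 4
  refine tendsto_of_tendsto_of_tendsto_of_le_of_le' tendsto_const_nhds hlim ?_ ?_
  · filter_upwards [Filter.eventually_ne_atTop 0] with m hm
    rw [← hroot m hm]
    refine Real.rpow_le_rpow (by positivity) ?_ (by positivity)
    exact_mod_cast four_pow_le_degree_octagonIterate m
  · filter_upwards [Filter.eventually_ne_atTop 0] with m hm
    rw [← hroot m hm, ← Real.mul_rpow (by norm_num) (by positivity)]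
    refine Real.rpow_le_rpow (by positivity) ?_ (by positivity)
    exact_mod_cast degree_octagonIterate_le m

lemma octagonMap_hasSecondDynamicalDegree : octagonMap.HasSecondDynamicalDegree 5 := by
  refine ⟨octagonIterate, fun m => 5 ^ m, octagonIterate_isIterates,
    octagonIterate_hasTopologicalDegree, ?_⟩
  refine tendsto_const_nhds.congr' ?_
  filter_upwards [Filter.eventually_ne_atTop 0] with m hm
  rw [Nat.cast_pow, one_div, Nat.cast_ofNat, Real.pow_rpow_inv_natCast (by norm_num) hm]

lemma octagonMap_algebraicallyStable : octagonMap.AlgebraicallyStableOnBlowup :=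
  ⟨octagonIterate, stableMatrix, octagonIterate_isIterates, octagonMap_hasPullbackMatrix,
    fun m _ => octagonIterate_hasPullbackMatrix m⟩

lemma roots_charpoly_stableMatrix : stableMatrix.charpoly.roots = {4, 2, 1, 1} := by
  have h : stableMatrix.charpoly = (({4, 2, 1, 1} : Multiset ℤ).map
      fun a => Polynomial.X - Polynomial.C a).prod := by
    rw [Matrix.charpoly, Matrix.det_succ_row_zero]
    simp [Matrix.det_fin_three, Fin.sum_univ_succ, stableMatrix, Matrix.charmatrix_apply,
      Matrix.submatrix_apply, Fin.succAbove]
    ring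
  rw [h, Polynomial.roots_multiset_prod_X_sub_C]

/-! ### Homogeneous coordinates of points and lines -/

/-- `x` is a vector of homogeneous coordinates of `p`. -/
def Represents (p : Plane) (x : Fin 3 → ℂ) : Prop := ∃ h : x ≠ 0, p = .mk ℂ x h

lemma represents_mk {x : Fin 3 → ℂ} (h : x ≠ 0) : Represents (.mk ℂ x h) x := ⟨h, rfl⟩

lemma exists_represents (p : Plane) : ∃ x, Represents p x :=
  ⟨p.rep, p.rep_nonzero, p.mk_rep.symm⟩

namespace Represents

variable {p q : Plane} {x y : Fin 3 → ℂ}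

lemma submodule_eq (h : Represents p x) : p.submodule = Submodule.span ℂ {x} := by
  obtain ⟨hx, rfl⟩ := h
  rfl

lemma eq (hp : Represents p x) (hq : Represents q x) : p = q := by
  obtain ⟨hx, rfl⟩ := hp
  obtain ⟨-, rfl⟩ := hq
  rfl

lemma of_smul {a : ℂ} (h : Represents p (a • x)) : Represents p x := by
  obtain ⟨hx, rfl⟩ := h
  refine ⟨(smul_ne_zero_iff.mp hx).2, ?_⟩
  rw [Projectivization.mk_eq_mk_iff']
  exact ⟨a, rfl⟩

lemma exists_eq_smul (hx : Represents p x) (hy : Represents p y) : ∃ a : ℂ, a ≠ 0 ∧ y = a • x := by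
  obtain ⟨hx, rfl⟩ := hx
  obtain ⟨hy, h⟩ := hy
  obtain ⟨a, ha⟩ := (Projectivization.mk_eq_mk_iff' ℂ _ _ hy hx).mp h.symm
  exact ⟨a, fun h0 => hy (by rw [← ha, h0, zero_smul]), ha.symm⟩

lemma mem_line_iff {z : Fin 3 → ℂ} (hp : Represents p x) (hq : Represents q y) :
    z ∈ line p q ↔ ∃ s t : ℂ, z = s • x + t • y := by
  rw [line, hp.submodule_eq, hq.submodule_eq, ← Submodule.span_union, Set.singleton_union,
    Submodule.mem_span_pair]
  exact exists_congr fun s => exists_congr fun t => eq_comm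

end Represents

/-- A projective transformation is induced by a linear automorphism. -/
lemma exists_linearEquiv (g : PGL3) : ∃ L : (Fin 3 → ℂ) ≃ₗ[ℂ] (Fin 3 → ℂ),
    ∀ p x, Represents p x → Represents (g • p) (L x) := by
  induction g using Matrix.ProjGenLinGroup.induction_on with | _ g =>
  refine ⟨DistribMulAction.toLinearEquiv ℂ _ g, ?_⟩
  rintro _ x ⟨hx, rfl⟩
  exact ⟨_, Projectivization.PGL.mk_smul_mk g hx⟩

/-- An invertible matrix induces a projective transformation. -/
lemma exists_projective_of_det_ne_zero {A : Matrix (Fin 3) (Fin 3) ℂ} (hA : A.det ≠ 0) :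
    ∃ g : PGL3, ∀ p x, Represents p x → Represents (g • p) (A.mulVec x) := by
  refine ⟨.mk (Matrix.GeneralLinearGroup.mkOfDetNeZero A hA), ?_⟩
  rintro _ x ⟨hx, rfl⟩
  exact ⟨_, Projectivization.PGL.mk_smul_mk _ hx⟩

/-! ### Equivariance of the skew pentagram map -/

lemma line_smul (g : PGL3) (L : (Fin 3 → ℂ) ≃ₗ[ℂ] (Fin 3 → ℂ))
    (hL : ∀ p x, Represents p x → Represents (g • p) (L x)) (p q : Plane) :
    line (g • p) (g • q) = (line p q).map (L : (Fin 3 → ℂ) →ₗ[ℂ] (Fin 3 → ℂ)) := by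
  obtain ⟨x, hx⟩ := exists_represents p
  obtain ⟨y, hy⟩ := exists_represents q
  rw [line, line, Submodule.map_sup, hx.submodule_eq, hy.submodule_eq, (hL _ _ hx).submodule_eq,
    (hL _ _ hy).submodule_eq, Submodule.map_span, Submodule.map_span, Set.image_singleton,
    Set.image_singleton]
  rfl

lemma IsSkewImage.smul {n : ℕ} {a b c d : ZMod n} {v v' : Polygon n}
    (h : IsSkewImage a b c d v v') (g : PGL3) : IsSkewImage a b c d (g • v) (g • v') := by
  obtain ⟨L, hL⟩ := exists_linearEquiv g
  intro i
  obtain ⟨h1, h2, h3, h4⟩ := h i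
  simp only [Pi.smul_apply]
  have hinj : Function.Injective (L : (Fin 3 → ℂ) →ₗ[ℂ] (Fin 3 → ℂ)) := L.injective
  refine ⟨(MulAction.injective g).ne h1, (MulAction.injective g).ne h2, ?_, ?_⟩
  · rw [line_smul g L hL, line_smul g L hL]
    exact (Submodule.map_injective_of_injective hinj).ne h3
  · obtain ⟨x, hx⟩ := exists_represents (v' i)
    rw [line_smul g L hL, line_smul g L hL, ← Submodule.map_inf _ hinj, ← h4,
      (hL _ _ hx).submodule_eq, hx.submodule_eq, Submodule.map_span, Set.image_singleton]
    rfl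

lemma RotationallySymmetric.smul {v : Polygon 8} (h : RotationallySymmetric v) (g : PGL3) :
    RotationallySymmetric (g • v) := by
  obtain ⟨R, hR⟩ := h
  refine ⟨g * R * g⁻¹, fun i => ?_⟩
  rw [Pi.smul_apply, Pi.smul_apply, hR, mul_smul, mul_smul, inv_smul_smul]

lemma exists_smul_eq_of_octagonClass_eq {v w : Polygon 8} (h : octagonClass v = octagonClass w) :
    ∃ g : PGL3, g • w = v :=
  MulAction.orbitRel_apply.mp (Quotient.exact h)

lemma octagonClass_smul (g : PGL3) (v : Polygon 8) : octagonClass (g • v) = octagonClass v :=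
  Quotient.sound (MulAction.orbitRel_apply.mpr ⟨g, rfl⟩)

/-- A common point of the two diagonals is the vertex of the image. -/
lemma represents_of_mem_lines {p a b c d : Plane} {x : Fin 3 → ℂ} (hx : x ≠ 0)
    (h : p.submodule = line a b ⊓ line c d) (h1 : x ∈ line a b) (h2 : x ∈ line c d) :
    Represents p x := by
  obtain ⟨y, hy⟩ := exists_represents p
  have hmem : x ∈ p.submodule := h ▸ ⟨h1, h2⟩
  rw [hy.submodule_eq, Submodule.mem_span_singleton] at hmem
  obtain ⟨a, rfl⟩ := hmem
  have ha := (smul_ne_zero_iff.mp hx).1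
  exact .of_smul (a := a⁻¹) (by rwa [inv_smul_smul₀ ha])

/-- In general linear position, the skew pentagram map is defined. -/
lemma GeneralLinearPosition.isSkewImage {w u : Polygon 8} (hw : GeneralLinearPosition w)
    (h1 : ∀ i, (u i).submodule ≤ line (w i) (w (i + 2)))
    (h2 : ∀ i, (u i).submodule ≤ line (w (i + 1)) (w (i + 4))) :
    IsSkewImage 0 2 1 4 w u := by
  intro i
  have hne : ∀ i : ZMod 8, i ≠ i + 2 ∧ i + 1 ≠ i + 4 ∧ i + 4 ≠ i ∧ i + 1 ≠ i := by decide
  obtain ⟨d1, d2, d3, d4⟩ := hne i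
  have hnot := hw.2 (i + 1) (i + 4) i d2 d3 d4
  have hle : (w i).submodule ≤ line (w i) (w (i + 2)) := le_sup_left
  rw [add_zero]
  refine ⟨hw.1 _ _ d1, hw.1 _ _ d2, fun h => hnot (h ▸ hle), ?_⟩
  refine Submodule.eq_of_le_of_finrank_le (le_inf (h1 i) (h2 i)) ?_
  rw [Projectivization.finrank_submodule]
  -- The vertex w i is on the first diagonal and not on the second, so the intersection is a proper
  -- subspace of a space of dimension at most two.
  have hlt : line (w i) (w (i + 2)) ⊓ line (w (i + 1)) (w (i + 4)) < line (w i) (w (i + 2)) :=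
    inf_le_left.lt_of_ne fun h => hnot (hle.trans (inf_eq_left.mp h))
  have hrank := Submodule.finrank_add_le_finrank_add_finrank (w i).submodule (w (i + 2)).submodule
  rw [Projectivization.finrank_submodule, Projectivization.finrank_submodule] at hrank
  exact Nat.lt_succ_iff.mp ((Submodule.finrank_lt_finrank_of_lt hlt).trans_le hrank)

/-! ### Explicit vertices of a normalized octagon and of its image -/

section Vertices

variable {R S : Type*} [CommRing R] [CommRing S]

/-- The rotation `[X : Y : Z] ↦ [-Y : X : Z]`. -/
def rot (x : Fin 3 → R) : Fin 3 → R := ![-x 1, x 0, x 2]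

/-- The vertices of the normalized octagon with `v₂ = x`. -/
def octVec (x : Fin 3 → R) : ZMod 8 → Fin 3 → R :=
  ![rot (rot (rot x)), ![1, 0, 1], x, ![0, 1, 1], rot x, ![-1, 0, 1], rot (rot x), ![0, -1, 1]]

/-- The intersection point of `v₁v₃` and `v₂v₅`. -/
def oddVertex (x : Fin 3 → R) : Fin 3 → R :=
  ![-x 0 + x 1 - x 2, -2 * x 1, -x 0 - x 1 - x 2]

/-- The intersection point of `v₂v₄` and `v₃v₆`. -/
def evenVertex (x : Fin 3 → R) : Fin 3 → R :=
  let α := 2 * x 2 * (x 0 ^ 2 + x 1 ^ 2)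
  let β := x 0 ^ 2 + x 1 ^ 2 - x 2 * x 0 - x 2 * x 1
  ![β * x 0, α + β * x 1, α - β * x 2]

/-- The vertices of the image of the normalized octagon with `v₂ = x`. -/
def imgVec (x : Fin 3 → R) : ZMod 8 → Fin 3 → R :=
  ![rot (rot (rot (evenVertex x))), oddVertex x, evenVertex x, rot (oddVertex x),
    rot (evenVertex x), rot (rot (oddVertex x)), rot (rot (evenVertex x)),
    rot (rot (rot (oddVertex x)))]

/-- The determinant of three vectors. -/
def det3 (a b c : Fin 3 → R) : R :=
  a 0 * (b 1 * c 2 - b 2 * c 1) - a 1 * (b 0 * c 2 - b 2 * c 0) + a 2 * (b 0 * c 1 - b 1 * c 0)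

lemma rot_rot_rot_rot (x : Fin 3 → R) : rot (rot (rot (rot x))) = x := by
  funext j
  fin_cases j <;> simp [rot]

lemma zmod_eight_induction {P : ZMod 8 → Prop} (h1 : P 1) (h2 : P 2)
    (h : ∀ i, P i → P (i + 2)) : ∀ i, P i := by
  intro i
  have hi : i = 1 ∨ i = 1 + 2 ∨ i = 1 + 2 + 2 ∨ i = 1 + 2 + 2 + 2 ∨
      i = 2 ∨ i = 2 + 2 ∨ i = 2 + 2 + 2 ∨ i = 2 + 2 + 2 + 2 := by
    revert i
    decide
  rcases hi with rfl | rfl | rfl | rfl | rfl | rfl | rfl | rfl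
  exacts [h1, h _ h1, h _ (h _ h1), h _ (h _ (h _ h1)), h2, h _ h2, h _ (h _ h2),
    h _ (h _ (h _ h2))]

lemma zmod_eight_cases (i : ZMod 8) : i = 0 ∨ i = 1 ∨ i = 2 ∨ i = 3 ∨ i = 4 ∨ i = 5 ∨ i = 6 ∨
    i = 7 := by
  revert i
  decide

lemma octVec_add_two (x : Fin 3 → R) (i : ZMod 8) : octVec x (i + 2) = rot (octVec x i) := by
  rcases zmod_eight_cases i with rfl | rfl | rfl | rfl | rfl | rfl | rfl | rfl
  · exact (rot_rot_rot_rot x).symm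
  · change ![(0 : R), 1, 1] = rot ![1, 0, 1]
    simp [rot]
  · rfl
  · change ![(-1 : R), 0, 1] = rot ![0, 1, 1]
    simp [rot]
  · rfl
  · change ![(0 : R), -1, 1] = rot ![-1, 0, 1]
    simp [rot]
  · rfl
  · change ![(1 : R), 0, 1] = rot ![0, -1, 1]
    simp [rot]

lemma imgVec_add_two (x : Fin 3 → R) (i : ZMod 8) : imgVec x (i + 2) = rot (imgVec x i) := by
  rcases zmod_eight_cases i with rfl | rfl | rfl | rfl | rfl | rfl | rfl | rfl
  · exact (rot_rot_rot_rot _).symm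
  · rfl
  · rfl
  · rfl
  · rfl
  · rfl
  · rfl
  · exact (rot_rot_rot_rot _).symm

lemma rot_smul_add_smul (s t : R) (x y : Fin 3 → R) :
    rot (s • x + t • y) = s • rot x + t • rot y := by
  funext j
  fin_cases j <;> simp [rot]
  ring

lemma exists_imgVec_eq_first (x : Fin 3 → R) (i : ZMod 8) :
    ∃ s t : R, imgVec x i = s • octVec x i + t • octVec x (i + 2) := by
  revert i
  -- Only v'₁ and v'₂ need coefficients; the rotation carries them to all other vertices.
  refine zmod_eight_induction ⟨-x 0 + x 1 - x 2, -2 * x 1, ?_⟩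
    ⟨x 0 ^ 2 + x 1 ^ 2 + x 2 * x 1 - x 2 * x 0, 2 * x 2 * x 0, ?_⟩ fun i ⟨s, t, h⟩ => ⟨s, t, ?_⟩
  · change oddVertex x = _ • ![(1 : R), 0, 1] + _ • ![(0 : R), 1, 1]
    funext j
    fin_cases j <;> simp [oddVertex]
    ring
  · change evenVertex x = _ • x + _ • rot x
    funext j
    fin_cases j <;> simp [evenVertex, rot] <;> ring
  · rw [imgVec_add_two, octVec_add_two, octVec_add_two, h, octVec_add_two, rot_smul_add_smul]

lemma exists_imgVec_eq_second (x : Fin 3 → R) (i : ZMod 8) :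
    ∃ s t : R, imgVec x i = s • octVec x (i + 1) + t • octVec x (i + 4) := by
  revert i
  refine zmod_eight_induction ⟨-2, -(x 0 + x 1 - x 2), ?_⟩
    ⟨2 * x 2 * (x 0 ^ 2 + x 1 ^ 2), -(x 0 ^ 2 + x 1 ^ 2 - x 2 * x 0 - x 2 * x 1), ?_⟩
    fun i ⟨s, t, h⟩ => ⟨s, t, ?_⟩
  · change oddVertex x = _ • x + _ • ![(-1 : R), 0, 1]
    funext j
    fin_cases j <;> simp [oddVertex] <;> ring
  · change evenVertex x = _ • ![(0 : R), 1, 1] + _ • rot (rot x)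
    funext j
    fin_cases j <;> simp [evenVertex, rot] <;> ring
  · rw [imgVec_add_two, add_right_comm, add_right_comm i 2 4, octVec_add_two, octVec_add_two, h,
      rot_smul_add_smul]

lemma map_rot (φ : R →+* S) (x : Fin 3 → R) : φ ∘ rot x = rot (φ ∘ x) := by
  funext j
  fin_cases j <;> simp [rot]

lemma map_octVec (φ : R →+* S) (x : Fin 3 → R) (i : ZMod 8) :
    φ ∘ octVec x i = octVec (φ ∘ x) i := by
  revert i
  refine zmod_eight_induction ?_ rfl fun i h => ?_
  · change φ ∘ ![1, 0, 1] = ![1, 0, 1]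
    funext j
    fin_cases j <;> simp
  · rw [octVec_add_two, octVec_add_two, map_rot, h]

lemma map_imgVec (φ : R →+* S) (x : Fin 3 → R) (i : ZMod 8) :
    φ ∘ imgVec x i = imgVec (φ ∘ x) i := by
  revert i
  refine zmod_eight_induction ?_ ?_ fun i h => ?_
  · change φ ∘ oddVertex x = oddVertex (φ ∘ x)
    funext j
    fin_cases j <;> simp [oddVertex, map_ofNat]
  · change φ ∘ evenVertex x = evenVertex (φ ∘ x)
    funext j
    fin_cases j <;> simp [evenVertex, map_ofNat]
  · rw [imgVec_add_two, imgVec_add_two, map_rot, h]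

lemma map_det3 (φ : R →+* S) (a b c : Fin 3 → R) :
    φ (det3 a b c) = det3 (φ ∘ a) (φ ∘ b) (φ ∘ c) := by
  simp [det3]

lemma det3_smul_add_smul (a b : Fin 3 → R) (s t : R) : det3 a b (s • a + t • b) = 0 := by
  simp only [det3, Pi.add_apply, Pi.smul_apply, smul_eq_mul]
  ring

end Vertices

lemma generalLinearPosition_of_det3 {w : Polygon 8} {V : ZMod 8 → Fin 3 → ℂ}
    (hw : ∀ i, Represents (w i) (V i))
    (hV : ∀ i j k, i ≠ j → j ≠ k → i ≠ k → det3 (V i) (V j) (V k) ≠ 0) :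
    GeneralLinearPosition w := by
  have h : ∀ i j k, i ≠ j → j ≠ k → i ≠ k → ¬ (w k).submodule ≤ line (w i) (w j) := by
    intro i j k hij hjk hik hle
    have hmem : V k ∈ line (w i) (w j) :=
      hle ((hw k).submodule_eq ▸ Submodule.mem_span_singleton_self _)
    obtain ⟨s, t, hst⟩ := ((hw i).mem_line_iff (hw j)).mp hmem
    exact hV i j k hij hjk hik (hst ▸ det3_smul_add_smul _ _ _ _)
  refine ⟨fun i j hij heq => ?_, h⟩
  obtain ⟨k, hki, hkj⟩ : ∃ k : ZMod 8, k ≠ i ∧ k ≠ j := by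
    clear hij heq
    revert i j
    decide
  refine h k i j hki hij hkj ?_
  rw [← heq]
  exact le_sup_right

/-! ### Rigidity of the frame formed by the odd vertices -/

lemma coordVec_eq (x : Fin 3 → ℂ) :
    coordVec x = ![-x 2, x 0 - Complex.I * x 1, x 0 + Complex.I * x 1] := by
  funext j
  fin_cases j <;> simp [coordVec, coord]

/-- The coordinates of the first vertex of a normalized octagon. -/
lemma coordVec_firstVertex : coordVec ![1, 0, 1] = ![-1, 1, 1] := by
  rw [coordVec_eq]
  simp

/-- A linear map that takes a square `u, r u, r² u, r³ u` to the standard one, up to factors, is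
diagonal in the coordinates that diagonalize the rotation `r`. -/
lemma coordVec_of_frame (L : (Fin 3 → ℂ) →ₗ[ℂ] (Fin 3 → ℂ)) {u : Fin 3 → ℂ} {b₀ b₁ b₂ b₃ : ℂ}
    (hb : b₀ ≠ 0) (h₀ : L u = b₀ • ![1, 0, 1]) (h₁ : L (rot u) = b₁ • ![0, 1, 1])
    (h₂ : L (rot (rot u)) = b₂ • ![-1, 0, 1]) (h₃ : L (rot (rot (rot u))) = b₃ • ![0, -1, 1]) :
    (∀ j, coordVec u j ≠ 0) ∧ ∀ y j,
      coordVec (L y) j * coordVec u j = b₀ * coordVec ![1, 0, 1] j * coordVec y j := by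
  obtain ⟨C, D, E, hL⟩ : ∃ C D E : Fin 3 → ℂ, ∀ y, L y = y 0 • C + y 1 • D + y 2 • E :=
    ⟨L (Pi.single 0 1), L (Pi.single 1 1), L (Pi.single 2 1), fun y => by
      have hy : y = y 0 • Pi.single 0 1 + y 1 • Pi.single 1 1 + y 2 • Pi.single 2 1 := by
        funext j
        fin_cases j <;> simp
      conv_lhs => rw [hy]
      simp only [map_add, map_smul]⟩
  have key : ∀ j, L u j = (b₀ • ![(1 : ℂ), 0, 1]) j ∧ L (rot u) j = (b₁ • ![(0 : ℂ), 1, 1]) j ∧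
      L (rot (rot u)) j = (b₂ • ![(-1 : ℂ), 0, 1]) j ∧
      L (rot (rot (rot u))) j = (b₃ • ![(0 : ℂ), -1, 1]) j := fun j => by
    rw [h₀, h₁, h₂, h₃]
    exact ⟨rfl, rfl, rfl, rfl⟩
  obtain ⟨k00, k01, k02, k03⟩ := key 0
  obtain ⟨k10, k11, k12, k13⟩ := key 1
  obtain ⟨k20, k21, k22, k23⟩ := key 2
  rw [coordVec_firstVertex]
  clear key h₀ h₁ h₂ h₃
  simp only [hL, rot, Matrix.cons_val, Pi.smul_apply, Pi.add_apply, smul_eq_mul, mul_one, mul_zero,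
    mul_neg, neg_mul] at k00 k01 k02 k03 k10 k11 k12 k13 k20 k21 k22 k23
  -- Both u + r²u and ru + r³u equal 2 u₂ times the third basis vector. Comparing their images
  -- determines the third column E and shows that the factors b₀, b₁ and b₃ agree.
  have hE0 : u 2 * E 0 = 0 := by linear_combination (k01 + k03) / 2
  have hE1 : u 2 * E 1 = 0 := by linear_combination (k10 + k12) / 2
  have hE2 : u 2 * E 2 = b₀ := by
    linear_combination (k20 + k22) / 2 + (k00 + k02) / 2 - (k01 + k03) / 2
  have h13 : b₁ = b₃ := by linear_combination k10 + k12 - k11 - k13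
  have h01 : b₀ = b₁ := by
    linear_combination -hE2 + (k21 + k23) / 2 - h13 / 2
  have hz : u 2 ≠ 0 := fun h => hb (by rw [← hE2, h, zero_mul])
  replace hE0 : E 0 = 0 := (mul_eq_zero.mp hE0).resolve_left hz
  replace hE1 : E 1 = 0 := (mul_eq_zero.mp hE1).resolve_left hz
  have f0 : u 0 * C 0 + u 1 * D 0 = b₀ := by linear_combination k00 - u 2 * hE0
  have f1 : u 0 * C 1 + u 1 * D 1 = 0 := by linear_combination k10 - u 2 * hE1
  have f2 : u 0 * C 2 + u 1 * D 2 = 0 := by linear_combination k20 - hE2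
  have g0 : u 0 * D 0 - u 1 * C 0 = 0 := by linear_combination k01 - u 2 * hE0
  have g1 : u 0 * D 1 - u 1 * C 1 = b₀ := by linear_combination k11 - u 2 * hE1 - h01
  have g2 : u 0 * D 2 - u 1 * C 2 = 0 := by linear_combination k21 - hE2 - h01
  have hn : u 0 ^ 2 + u 1 ^ 2 ≠ 0 := fun h => by
    have e0 : b₀ * u 0 = 0 := by linear_combination -u 0 * f0 + u 1 * g0 + C 0 * h
    have e1 : b₀ * u 1 = 0 := by linear_combination -u 1 * f0 - u 0 * g0 + D 0 * h
    rw [(mul_eq_zero.mp e0).resolve_left hb, (mul_eq_zero.mp e1).resolve_left hb] at f0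
    exact hb (by rw [← f0]; ring)
  have hC2 : C 2 = 0 := (mul_eq_zero.mp (show (u 0 ^ 2 + u 1 ^ 2) * C 2 = 0 by
    linear_combination u 0 * f2 - u 1 * g2)).resolve_left hn
  have hD2 : D 2 = 0 := (mul_eq_zero.mp (show (u 0 ^ 2 + u 1 ^ 2) * D 2 = 0 by
    linear_combination u 1 * f2 + u 0 * g2)).resolve_left hn
  have hD1 : D 1 = C 0 := mul_left_cancel₀ hn (by
    linear_combination u 1 * f1 + u 0 * g1 - u 0 * f0 + u 1 * g0)
  have hC1 : C 1 = -D 0 := mul_left_cancel₀ hn (by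
    linear_combination u 0 * f1 - u 1 * g1 + u 1 * f0 + u 0 * g0)
  have hi : Complex.I ^ 2 = -1 := Complex.I_sq
  simp only [coordVec_eq, hL]
  clear k00 k01 k02 k03 k10 k11 k12 k13 k20 k21 k22 k23
  refine ⟨fun j => ?_, fun y j => ?_⟩
  · have hprod : (u 0 - Complex.I * u 1) * (u 0 + Complex.I * u 1) ≠ 0 := by
      convert hn using 1
      linear_combination -u 1 ^ 2 * hi
    fin_cases j
    exacts [neg_ne_zero.mpr hz, left_ne_zero_of_mul hprod, right_ne_zero_of_mul hprod]
  · fin_cases j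
    · simp [hC2, hD2]
      linear_combination y 2 * hE2
    · simp [hE0, hE1, hD1, hC1]
      linear_combination (y 0 - Complex.I * y 1) * (f0 + Complex.I * g0)
        + ((y 0 - Complex.I * y 1) * (-(u 1 * D 0)) + y 1 * D 0 * (u 0 - Complex.I * u 1)) * hi
    · simp [hE0, hE1, hD1, hC1]
      linear_combination (y 0 + Complex.I * y 1) * (f0 - Complex.I * g0)
        + ((y 0 + Complex.I * y 1) * (-(u 1 * D 0)) + y 1 * D 0 * (u 0 + Complex.I * u 1)) * hi

lemma coordVec_oddVertex (x : Fin 3 → ℂ) (j : Fin 3) :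
    2 * coordVec (oddVertex x) j = (Complex.I - 1) * lineForm Complex.I (coordVec x) j := by
  have hi : Complex.I ^ 2 = -1 := Complex.I_sq
  simp only [coordVec_eq, lineForm, oddVertex]
  fin_cases j <;> simp [Matrix.cons_val] <;> grind

/-- The signs are the coordinates of v₁; renormalizing multiplies by them once more, so they
disappear from the map. -/
lemma coordVec_evenVertex (x : Fin 3 → ℂ) (j : Fin 3) :
    2 * coordVec (evenVertex x) j = (1 + Complex.I) * coordVec ![1, 0, 1] j *
      (coordVec x j * conicForm Complex.I (coordVec x) j) := by
  have hi : Complex.I ^ 2 = -1 := Complex.I_sq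
  rw [coordVec_firstVertex]
  simp only [coordVec_eq, conicForm, evenVertex]
  fin_cases j <;> simp [Matrix.cons_val] <;> grind

lemma rot_ne_zero {x : Fin 3 → ℂ} (hx : x ≠ 0) : rot x ≠ 0 := fun h => hx (by
  rw [← rot_rot_rot_rot x, h]
  funext j
  fin_cases j <;> simp [rot])

lemma affinePoint_represents (a b : ℂ) : Represents (affinePoint a b) ![a, b, 1] := ⟨_, rfl⟩

/-- A rotationally symmetric normalized octagon is determined by `v₂`, explicitly. -/
lemma Normalized.represents_octVec {w : Polygon 8} (hw : Normalized w)
    (hs : RotationallySymmetric w) {x : Fin 3 → ℂ} (hx : Represents (w 2) x) (i : ZMod 8) :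
    Represents (w i) (octVec x i) := by
  obtain ⟨h1, h3, h5, h7⟩ := hw
  obtain ⟨R, hR⟩ := hs
  obtain ⟨L, hL⟩ := exists_linearEquiv R
  have r1 : Represents (w 1) ![1, 0, 1] := h1 ▸ affinePoint_represents _ _
  have r3 : Represents (w 3) ![0, 1, 1] := h3 ▸ affinePoint_represents _ _
  have r5 : Represents (w 5) ![-1, 0, 1] := h5 ▸ affinePoint_represents _ _
  have r7 : Represents (w 7) ![0, -1, 1] := h7 ▸ affinePoint_represents _ _
  have step : ∀ i {y}, Represents (w i) y → Represents (w (i + 2)) (L y) := fun i y hy => by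
    rw [hR]
    exact hL _ _ hy
  obtain ⟨b₀, hb, e₀⟩ := r3.exists_eq_smul (step 1 r1)
  obtain ⟨b₁, -, e₁⟩ := r5.exists_eq_smul (step 3 r3)
  obtain ⟨b₂, -, e₂⟩ := r7.exists_eq_smul (step 5 r5)
  obtain ⟨b₃, -, e₃⟩ := r1.exists_eq_smul (step 7 r7)
  let ρ : (Fin 3 → ℂ) →ₗ[ℂ] (Fin 3 → ℂ) :=
    { toFun := rot
      map_add' := fun y z => by simpa using rot_smul_add_smul 1 1 y z
      map_smul' := fun a y => by simpa using rot_smul_add_smul a 0 y 0 }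
  have hρ : ∀ (a : ℂ) y, rot (a • y) = a • rot y := ρ.map_smul
  have q1 : rot ![(1 : ℂ), 0, 1] = ![0, 1, 1] := by simp [rot]
  have q3 : rot ![(0 : ℂ), 1, 1] = ![-1, 0, 1] := by simp [rot]
  have q5 : rot ![(-1 : ℂ), 0, 1] = ![0, -1, 1] := by simp [rot]
  have q7 : rot ![(0 : ℂ), -1, 1] = ![1, 0, 1] := by simp [rot]
  -- The symmetry followed by the inverse rotation fixes the four odd vertices, so it is a scalar.
  have frame := (coordVec_of_frame (ρ ∘ₗ ρ ∘ₗ ρ ∘ₗ (L : (Fin 3 → ℂ) →ₗ[ℂ] (Fin 3 → ℂ)))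
    (u := ![1, 0, 1]) (b₁ := b₁) (b₂ := b₂) (b₃ := b₃) hb
    (show rot (rot (rot (L _))) = _ by rw [e₀, hρ, hρ, hρ, q3, q5, q7])
    (show rot (rot (rot (L _))) = _ by rw [q1, e₁, hρ, hρ, hρ, q5, q7, q1])
    (show rot (rot (rot (L _))) = _ by rw [q1, q3, e₂, hρ, hρ, hρ, q7, q1, q3])
    (show rot (rot (rot (L _))) = _ by rw [q1, q3, q5, e₃, hρ, hρ, hρ, q1, q3, q5]))
  have hLrot : ∀ y, L y = b₀ • rot y := fun y => by
    have h : rot (rot (rot (L y))) = b₀ • y := by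
      apply coordVec_injective
      funext j
      rw [coordVec_smul]
      refine mul_right_cancel₀ (frame.1 j) ((frame.2 y j).trans ?_)
      rw [Pi.smul_apply, smul_eq_mul]
      ring
    rw [← hρ, ← h, rot_rot_rot_rot]
  revert i
  refine zmod_eight_induction r1 hx fun i hi => ?_
  rw [octVec_add_two]
  exact .of_smul (a := b₀) (hLrot _ ▸ step i hi)

/-- The vertices of the image of a normalized octagon. -/
lemma IsSkewImage.represents_imgVec {w u : Polygon 8} (h : IsSkewImage 0 2 1 4 w u)
    {x : Fin 3 → ℂ} (hw : ∀ i, Represents (w i) (octVec x i)) {i : ZMod 8} (hi : imgVec x i ≠ 0) :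
    Represents (u i) (imgVec x i) := by
  obtain ⟨-, -, -, h4⟩ := h i
  rw [add_zero] at h4
  exact represents_of_mem_lines hi h4
    (((hw _).mem_line_iff (hw _)).mpr (exists_imgVec_eq_first x i))
    (((hw _).mem_line_iff (hw _)).mpr (exists_imgVec_eq_second x i))

/-! ### Agreement with the induced map -/

lemma octagonMap_isProjectivization : octagonMap.IsProjectivization := by
  rintro c c' ⟨v, hv, v', hv', hT, rfl, rfl⟩ p p' ⟨-, w, hwv, hw, rfl⟩ ⟨-, w', hwv', hw', rfl⟩ q hq
  obtain ⟨g, rfl⟩ := exists_smul_eq_of_octagonClass_eq hwv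
  have hTg := hT.smul g
  -- This h renormalizes the image of the normalized octagon; it will turn out to be diagonal.
  obtain ⟨h, hh⟩ : ∃ h : PGL3, h • (g • v') = w' :=
    exists_smul_eq_of_octagonClass_eq (hwv'.trans (octagonClass_smul g v').symm)
  obtain ⟨L, hL⟩ := exists_linearEquiv h
  obtain ⟨x, hx⟩ := exists_represents ((g • v) 2)
  have hoct := hw.represents_octVec (hv.2.smul g) hx
  obtain ⟨hx0, hpx⟩ := hx
  obtain ⟨y, hy0, rfl⟩ := exists_represents q
  obtain ⟨a, ha, hmap⟩ := (octagonMap_mapsTo_mk_iff hx0 hy0).mp (hpx ▸ hq)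
  obtain ⟨j, hj⟩ : ∃ j, coordVec y j ≠ 0 := by
    by_contra! hcon
    exact hy0 (coordVec_injective ((funext hcon).trans coordVec_zero.symm))
  -- Outside the indeterminacy locus some coordinate of the value is nonzero; its factors show that
  -- the formulas for v'₁ and v'₂ do not give the zero vector.
  have hmapj : mapForm Complex.I (coordVec x) j ≠ 0 := hmap j ▸ mul_ne_zero ha hj
  rw [mapForm] at hmapj
  have hI : (1 + Complex.I) ≠ 0 := one_add_I_ne_zero (K := ℂ)
  have hi : Complex.I ^ 2 = -1 := Complex.I_sq
  have hI' : Complex.I - 1 ≠ 0 := fun h => hI (by linear_combination hi - Complex.I * h)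
  have hε : ∀ j, coordVec ![1, 0, 1] j * coordVec ![1, 0, 1] j = 1 := fun j => by
    rw [coordVec_firstVertex]
    fin_cases j <;> simp
  have hodd : oddVertex x ≠ 0 := fun h0 => by
    have hodd := coordVec_oddVertex x (j + 2)
    rw [h0, coordVec_zero, Pi.zero_apply, mul_zero] at hodd
    exact mul_ne_zero hI' (right_ne_zero_of_mul hmapj) hodd.symm
  have heven : evenVertex x ≠ 0 := fun h0 => by
    have heven := coordVec_evenVertex x j
    rw [h0, coordVec_zero, Pi.zero_apply, mul_zero] at heven
    exact mul_ne_zero (mul_ne_zero hI (right_ne_zero_of_mul (hε j ▸ one_ne_zero)))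
      (left_ne_zero_of_mul (left_ne_zero_of_mul hmapj)) heven.symm
  have hU : ∀ i {z}, imgVec x i = z → z ≠ 0 → Represents (w' i) (L z) := by
    rintro i _ rfl hz
    rw [← hh]
    exact hL _ _ (hTg.represents_imgVec hoct hz)
  have s1 := hU 1 (z := oddVertex x) rfl hodd
  have s3 := hU 3 (z := rot _) rfl (rot_ne_zero hodd)
  have s5 := hU 5 (z := rot (rot _)) rfl (rot_ne_zero (rot_ne_zero hodd))
  have s7 := hU 7 (z := rot (rot (rot _))) rfl (rot_ne_zero (rot_ne_zero (rot_ne_zero hodd)))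
  obtain ⟨h1, h3, h5, h7⟩ := hw'
  obtain ⟨b₀, hb, e₀⟩ := (h1 ▸ affinePoint_represents _ _ : Represents (w' 1) _).exists_eq_smul s1
  obtain ⟨b₁, -, e₁⟩ := (h3 ▸ affinePoint_represents _ _ : Represents (w' 3) _).exists_eq_smul s3
  obtain ⟨b₂, -, e₂⟩ := (h5 ▸ affinePoint_represents _ _ : Represents (w' 5) _).exists_eq_smul s5
  obtain ⟨b₃, -, e₃⟩ := (h7 ▸ affinePoint_represents _ _ : Represents (w' 7) _).exists_eq_smul s7
  obtain ⟨hne, hframe⟩ := coordVec_of_frame (L : (Fin 3 → ℂ) →ₗ[ℂ] (Fin 3 → ℂ)) hb e₀ e₁ e₂ e₃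
  obtain ⟨hz, h2⟩ := hU 2 (z := evenVertex x) rfl heven
  refine RatMap.MapsTo.unique hq ?_
  rw [h2, hpx, octagonMap_mapsTo_mk_iff]
  have hline : ∀ j, lineForm Complex.I (coordVec x) j ≠ 0 := fun j h0 => by
    have h2 := coordVec_oddVertex x j
    rw [h0, mul_zero] at h2
    exact mul_ne_zero two_ne_zero (hne j) h2
  -- Renormalizing gives b₀ (1+i)/(i-1) c_j Q_j / L_j = -i b₀ c_j Q_j / L_j. Clearing the
  -- denominators L_j yields this factor.
  refine ⟨Complex.I * (lineForm Complex.I (coordVec x) 0 * lineForm Complex.I (coordVec x) 1 *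
    lineForm Complex.I (coordVec x) 2) / b₀, div_ne_zero (mul_ne_zero Complex.I_ne_zero
    (mul_ne_zero (mul_ne_zero (hline 0) (hline 1)) (hline 2))) hb, fun j => ?_⟩
  rw [div_mul_eq_mul_div, eq_div_iff hb]
  have hprod : lineForm Complex.I (coordVec x) 0 * lineForm Complex.I (coordVec x) 1 *
      lineForm Complex.I (coordVec x) 2 = lineForm Complex.I (coordVec x) j *
      lineForm Complex.I (coordVec x) (j + 1) * lineForm Complex.I (coordVec x) (j + 2) := by
    fin_cases j
    exacts [rfl, by simp; ring, by simp; ring]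
  have hf := hframe (evenVertex x) j
  have ho := coordVec_oddVertex x j
  have he := coordVec_evenVertex x j
  have hε := hε j
  rw [mapForm, hprod]
  refine mul_left_cancel₀ hI ?_
  linear_combination lineForm Complex.I (coordVec x) (j + 1) *
    lineForm Complex.I (coordVec x) (j + 2) * (-2 * hf - b₀ * coordVec ![1, 0, 1] j * he
      - b₀ * (1 + Complex.I) * (coordVec x j * conicForm Complex.I (coordVec x) j) * hε
      + coordVec (L (evenVertex x)) j * ho
      - coordVec (L (evenVertex x)) j * lineForm Complex.I (coordVec x) j * hi)

/-! ### Uniqueness of the projectivization -/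

/-- The product of the determinants of the triples of distinct vertices. -/
noncomputable def positionForm (V : ZMod 8 → Fin 3 → Poly) : Poly :=
  ∏ t : ZMod 8 × ZMod 8 × ZMod 8,
    if t.1 ≠ t.2.1 ∧ t.2.1 ≠ t.2.2 ∧ t.1 ≠ t.2.2 then det3 (V t.1) (V t.2.1) (V t.2.2) else 1

lemma det3_ne_zero_of_eval_positionForm {V : ZMod 8 → Fin 3 → Poly} {x : Fin 3 → ℂ}
    (h : eval x (positionForm V) ≠ 0) {i j k : ZMod 8} (hij : i ≠ j) (hjk : j ≠ k) (hik : i ≠ k) :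
    det3 (eval x ∘ V i) (eval x ∘ V j) (eval x ∘ V k) ≠ 0 := by
  rw [positionForm, map_prod, Finset.prod_ne_zero_iff] at h
  have := h (i, j, k) (Finset.mem_univ _)
  rwa [if_pos ⟨hij, hjk, hik⟩, map_det3] at this

lemma positionForm_ne_zero {V : ZMod 8 → Fin 3 → Poly} {x : Fin 3 → ℂ}
    {W : ZMod 8 → Fin 3 → ℤ} (hVW : ∀ i, eval x ∘ V i = Int.castRingHom ℂ ∘ W i)
    (hW : ∀ i j k, i ≠ j → j ≠ k → i ≠ k → det3 (W i) (W j) (W k) ≠ 0) :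
    positionForm V ≠ 0 := by
  rw [positionForm, Finset.prod_ne_zero_iff]
  rintro ⟨i, j, k⟩ -
  split_ifs with h
  · intro h0
    have := congrArg (eval x) h0
    rw [map_det3, hVW, hVW, hVW, ← map_det3, map_zero, eq_intCast, Int.cast_eq_zero] at this
    exact hW i j k h.1 h.2.1 h.2.2 this
  · exact one_ne_zero

/-- A single octagon with integral coordinates shows that general position is a nonempty open
condition on v₂; the check over ℤ is finite. -/
lemma det3_octVec_ne_zero : ∀ i j k : ZMod 8, i ≠ j → j ≠ k → i ≠ k →
    det3 (octVec ![(3 : ℤ), 5, 7] i) (octVec ![(3 : ℤ), 5, 7] j) (octVec ![(3 : ℤ), 5, 7] k) ≠ 0 := by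
  decide +kernel

lemma det3_imgVec_ne_zero : ∀ i j k : ZMod 8, i ≠ j → j ≠ k → i ≠ k →
    det3 (imgVec ![(3 : ℤ), 5, 7] i) (imgVec ![(3 : ℤ), 5, 7] j) (imgVec ![(3 : ℤ), 5, 7] k) ≠ 0 := by
  decide +kernel

lemma eval_comp_X (x : Fin 3 → ℂ) : eval x ∘ (X : Fin 3 → Poly) = x := by
  funext i
  simp

lemma positionForm_octVec_ne_zero : positionForm (octVec X) ≠ 0 :=
  positionForm_ne_zero (x := Int.castRingHom ℂ ∘ ![3, 5, 7])
    (fun i => by rw [map_octVec, eval_comp_X, map_octVec]) det3_octVec_ne_zero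

lemma positionForm_imgVec_ne_zero : positionForm (imgVec X) ≠ 0 :=
  positionForm_ne_zero (x := Int.castRingHom ℂ ∘ ![3, 5, 7])
    (fun i => by rw [map_imgVec, eval_comp_X, map_imgVec]) det3_imgVec_ne_zero

/-- The polygon with given homogeneous coordinates of the vertices. -/
lemma exists_polygon {V : ZMod 8 → Fin 3 → ℂ}
    (hV : ∀ i j k, i ≠ j → j ≠ k → i ≠ k → det3 (V i) (V j) (V k) ≠ 0)
    (hrot : ∀ i, V (i + 2) = rot (V i)) :
    ∃ w ∈ RSOctagon, ∀ i, Represents (w i) (V i) := by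
  have hne : ∀ i, V i ≠ 0 := fun i h0 => by
    have hd : ∀ i : ZMod 8, i ≠ i + 1 ∧ i + 1 ≠ i + 2 ∧ i ≠ i + 2 := by decide
    refine hV i (i + 1) (i + 2) (hd i).1 (hd i).2.1 (hd i).2.2 ?_
    rw [h0]
    simp [det3]
  have hw : ∀ i, Represents (.mk ℂ (V i) (hne i)) (V i) := fun i => represents_mk _
  refine ⟨fun i => .mk ℂ (V i) (hne i), ⟨generalLinearPosition_of_det3 hw hV, ?_⟩, hw⟩
  obtain ⟨R, hR⟩ := exists_projective_of_det_ne_zero (A := !![0, -1, 0; 1, 0, 0; 0, 0, 1])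
    (by simp [Matrix.det_fin_three])
  refine ⟨R, fun i => (hw (i + 2)).eq ?_⟩
  convert hR _ _ (hw i) using 1
  rw [hrot]
  funext j
  fin_cases j <;> simp [rot, Matrix.mulVec, dotProduct, Fin.sum_univ_three]

/-- A square with vertices in general position is taken to the standard one by a projective
transformation. -/
lemma exists_normalized {V : ZMod 8 → Fin 3 → ℂ} {u : Polygon 8}
    (hu : ∀ i, Represents (u i) (V i)) (hrot : ∀ i, V (i + 2) = rot (V i))
    (hV : det3 (V 1) (V 3) (V 5) ≠ 0) : ∃ g : PGL3, Normalized (g • u) := by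
  have h3 : V 3 = rot (V 1) := hrot 1
  have h5 : V 5 = rot (rot (V 1)) := (hrot 3).trans (by rw [h3])
  have h7 : V 7 = rot (rot (rot (V 1))) := (hrot 5).trans (by rw [h5])
  have hu1 := hu 1
  have hu3 := hu 3
  have hu5 := hu 5
  have hu7 := hu 7
  rw [h3] at hu3 hV
  rw [h5] at hu5 hV
  rw [h7] at hu7
  generalize V 1 = y at *
  have hd : det3 y (rot y) (rot (rot y)) = 2 * ((y 0 ^ 2 + y 1 ^ 2) * y 2) := by
    simp only [det3, rot, Matrix.cons_val]
    ring
  have hs : (y 0 ^ 2 + y 1 ^ 2) * y 2 ≠ 0 := right_ne_zero_of_mul (hd ▸ hV)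
  set s := (y 0 ^ 2 + y 1 ^ 2) * y 2 with hsdef
  -- The matrix commutes with the rotation: it multiplies X + iY by y₂ (y₀ - i y₁) and scales Z so
  -- that y goes to s (1,0,1). The other three vertices follow.
  obtain ⟨g, hg⟩ := exists_projective_of_det_ne_zero
    (A := !![y 0 * y 2, y 1 * y 2, 0; -(y 1 * y 2), y 0 * y 2, 0; 0, 0, y 0 ^ 2 + y 1 ^ 2])
    (by
      convert mul_ne_zero hs hs using 1
      simp [Matrix.det_fin_three, hsdef]
      ring)
  have hfix : ∀ i {z : Fin 3 → ℂ} {a b : ℂ}, Represents (u i) z →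
      Matrix.mulVec !![y 0 * y 2, y 1 * y 2, 0; -(y 1 * y 2), y 0 * y 2, 0; 0, 0, y 0 ^ 2 + y 1 ^ 2]
        z = s • ![a, b, 1] → (g • u) i = affinePoint a b := fun i z a b hz h =>
    (Represents.of_smul (h ▸ hg _ _ hz)).eq (affinePoint_represents a b)
  refine ⟨g, hfix 1 hu1 ?_, hfix 3 hu3 ?_, hfix 5 hu5 ?_, hfix 7 hu7 ?_⟩ <;>
  · funext j
    fin_cases j <;> simp [rot, Matrix.mulVec, dotProduct, Fin.sum_univ_three, hsdef] <;> ring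

/-- At a general point, all projectivizations of the induced map take the same value. -/
lemma exists_value_eq {x : Fin 3 → ℂ} (hx : eval x (positionForm (octVec X)) ≠ 0)
    (hx' : eval x (positionForm (imgVec X)) ≠ 0) :
    ∃ p : Plane, ∀ f : RatMap, f.IsProjectivization → f.value x ≠ 0 → Represents p (f.value x) := by
  have hd : ∀ i j k, i ≠ j → j ≠ k → i ≠ k →
      det3 (octVec x i) (octVec x j) (octVec x k) ≠ 0 := fun i j k hij hjk hik => by
    simpa only [map_octVec, eval_comp_X] using det3_ne_zero_of_eval_positionForm hx hij hjk hik
  have hd' : ∀ i j k, i ≠ j → j ≠ k → i ≠ k →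
      det3 (imgVec x i) (imgVec x j) (imgVec x k) ≠ 0 := fun i j k hij hjk hik => by
    simpa only [map_imgVec, eval_comp_X] using det3_ne_zero_of_eval_positionForm hx' hij hjk hik
  obtain ⟨w, hw, hwx⟩ := exists_polygon hd (octVec_add_two x)
  obtain ⟨u, hu, hux⟩ := exists_polygon hd' (imgVec_add_two x)
  obtain ⟨g, hg⟩ := exists_normalized hux (imgVec_add_two x)
    (hd' 1 3 5 (by decide) (by decide) (by decide))
  have hT : IsSkewImage 0 2 1 4 w u := by
    refine hw.1.isSkewImage (fun i => ?_) fun i => ?_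
    all_goals rw [(hux i).submodule_eq, Submodule.span_singleton_le_iff_mem]
    · exact ((hwx _).mem_line_iff (hwx _)).mpr (exists_imgVec_eq_first x i)
    · exact ((hwx _).mem_line_iff (hwx _)).mpr (exists_imgVec_eq_second x i)
  have hn : Normalized w := ⟨(hwx 1).eq (affinePoint_represents _ _),
    (hwx 3).eq (affinePoint_represents _ _), (hwx 5).eq (affinePoint_represents _ _),
    (hwx 7).eq (affinePoint_represents _ _)⟩
  refine ⟨(g • u) 2, fun f hf hfx => ⟨hfx, ?_⟩⟩
  refine (hf _ _ ⟨w, hw, u, hu, hT, rfl, rfl⟩ (w 2) _ ⟨⟨w, hw, rfl⟩, w, rfl, hn, rfl⟩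
    ⟨⟨u, hu, rfl⟩, g • u, octagonClass_smul g u, hg, rfl⟩ _ ?_).symm
  obtain ⟨hx0, h2⟩ : Represents (w 2) x := hwx 2
  rw [h2, RatMap.mapsTo_mk_iff]
  exact ⟨1, one_ne_zero, (one_smul ℂ _).symm⟩

lemma RatMap.IsProjectivization.same {f g : RatMap} (hf : f.IsProjectivization)
    (hg : g.IsProjectivization) : f.Same g := by
  intro i j
  have hH := mul_ne_zero positionForm_octVec_ne_zero positionForm_imgVec_ne_zero
  -- Multiplying by the nonzero position forms makes the identity trivial at special points, so only
  -- general points have to be compared.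
  refine mul_left_cancel₀ hH (funext fun x => ?_)
  rw [map_mul, map_mul (eval x) (_ * _) (f.form j * _)]
  by_cases hx : eval x (positionForm (octVec X) * positionForm (imgVec X)) = 0
  · rw [hx, zero_mul, zero_mul]
  rw [map_mul] at hx
  obtain ⟨p, hp⟩ := exists_value_eq (left_ne_zero_of_mul hx) (right_ne_zero_of_mul hx)
  congr 1
  rw [map_mul, map_mul]
  change f.value x i * g.value x j = f.value x j * g.value x i
  by_cases hfx : f.value x = 0
  · simp [hfx]
  by_cases hgx : g.value x = 0
  · simp [hgx]
  obtain ⟨a, -, ha⟩ := (hp f hf hfx).exists_eq_smul (hp g hg hgx)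
  rw [ha, Pi.smul_apply, Pi.smul_apply, smul_eq_mul, smul_eq_mul]
  ring

end SkewPentagram

theorem mainTheorem4 :
    ∃ f : SkewPentagram.RatMap,
      f.IsProjectivization ∧
      (∀ g : SkewPentagram.RatMap, g.IsProjectivization → g.Same f) ∧
      f.Dominant ∧
      f.degree = 5 ∧
      f.HasFirstDynamicalDegree 4 ∧
      f.HasSecondDynamicalDegree 5 ∧
      f.HasTopologicalDegree 5 ∧
      f.AlgebraicallyStableOnBlowup ∧
      f.HasPullbackMatrix SkewPentagram.stableMatrix ∧
      SkewPentagram.stableMatrix.charpoly.roots = {4, 2, 1, 1} := by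
  exact ⟨SkewPentagram.octagonMap, SkewPentagram.octagonMap_isProjectivization,
    fun g hg => hg.same SkewPentagram.octagonMap_isProjectivization,
    SkewPentagram.octagonMap_hasTopologicalDegree.dominant (by norm_num), rfl,
    SkewPentagram.octagonMap_hasFirstDynamicalDegree,
    SkewPentagram.octagonMap_hasSecondDynamicalDegree,
    SkewPentagram.octagonMap_hasTopologicalDegree,
    SkewPentagram.octagonMap_algebraicallyStable,
    SkewPentagram.octagonMap_hasPullbackMatrix,
    SkewPentagram.roots_charpoly_stableMatrix⟩
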